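/- Let $N$ be a closed 3-manifold with a (smooth) contact form $\lambda$, Reeb vector field $X$ and Reeb flow $\psi_t$. Let $f:\Sigma\to N$ be a surface of section: $\Sigma$ is a compact surface with boundary, $f$ is a smooth immersion which restricts to an embedding of the interior of $\Sigma$ that is transverse to $X$, and which restricts to a covering of $\partial\Sigma$ onto a finite union of closed orbits. Let $\Gamma\subset f(\partial\Sigma)$ be a closed orbit of minimal period $T$ and let $\partial_\Gamma\Sigma=\partial\Sigma\cap f^{-1}(\Gamma)$ be the union of the boundary circles over $\Gamma$. Assume that (a) $\Gamma$ is rotating: there are $\ell>0$ and a neighborhood $U$ of $\partial_\Gamma\Sigma$ in $\Sigma$ such that for every $p\in U$ both $\psi_{]0,\ell[}(f(p))$ and $\psi_{]-\ell,0[}(f(p))$ meet $f(\Sigma)$; (b) after blowing up $\Gamma$ in polar coordinates, the extension of $\Sigma$ to the unit normal bundle of $\Gamma$ (the torus of rays of $TN/\mathbb{R}X$ over $\Gamma$) is an embedded collection of closed curves, transverse to the extension of $X$, i.e. to the generator of the flow $(z,[v])\mapsto(\psi_t z,[d\psi_t v])$. Suppose that $\Gamma$ is elliptic, i.e. the Floquet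 multipliers of $\Gamma$ (the complex eigenvalues of $d\psi_T$ on the contact plane $\ker\lambda$ at a point of $\Gamma$) have modulus $1$, and that no Floquet multiplier of $\Gamma$ is a root of unity. Then the first return map $p\mapsto q$, $f(q)=\psi_{\tau}(f(p))$, $\tau=\min\{t>0:\psi_t(f(p))\in f(\Sigma)\}$, which is defined at the interior points of $\Sigma$ near $\partial_\Gamma\Sigma$, extends continuously to $\partial_\Gamma\Sigma$; the extension is unique on $\partial_\Gamma\Sigma$, it maps $\partial_\Gamma\Sigma$ into itself, and it has no periodic points in $\partial_\Gamma\Sigma$. -/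

import Mathlib

open scoped Manifold ContDiff Topology

noncomputable section

namespace ReebSection

/-- The model space of 3-manifolds. Since `TangentSpace (𝓡 3) x` is by definition this space
(tangent vectors at `x` are written in the preferred chart at `x`), we may compare
tangent vectors at points that are only propositionally equal. -/
abbrev E3 : Type := EuclideanSpace ℝ (Fin 3)

/-- The model space of surfaces. -/
abbrev E2 : Type := EuclideanSpace ℝ (Fin 2)

section Contact

variable {N : Type*} [TopologicalSpace N] [ChartedSpace E3 N]

/-- A (not necessarily smooth) differential 1-form on `N`. -/
abbrev OneForm (N : Type*) [TopologicalSpace N] [ChartedSpace E3 N] : Type _ :=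
  (x : N) → TangentSpace (𝓡 3) x →L[ℝ] ℝ

/-- A (not necessarily smooth) vector field on `N`. -/
abbrev VField (N : Type*) [TopologicalSpace N] [ChartedSpace E3 N] : Type _ :=
  (x : N) → TangentSpace (𝓡 3) x

/-- The 1-form is `C^∞`: equivalently, it is a smooth function on the tangent bundle. -/
def SmoothOneForm (lam : OneForm N) [IsManifold (𝓡 3) ∞ N] : Prop :=
  ContMDiff (𝓡 3).tangent 𝓘(ℝ, ℝ) ∞ (fun v : TangentBundle (𝓡 3) N => lam v.1 v.2)

/-- The coordinate expression of a 1-form in the preferred chart at `x`: its pullback under the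
inverse of the chart, a map from (an open subset of) `ℝ³` to the dual of `ℝ³`. -/
def OneForm.inChart (lam : OneForm N) (x : N) (u : E3) : E3 →L[ℝ] ℝ :=
  (lam ((extChartAt (𝓡 3) x).symm u)).comp
    (mfderiv 𝓘(ℝ, E3) (𝓡 3) (extChartAt (𝓡 3) x).symm u)

/-- The exterior derivative `dλ` at `x`, computed in the preferred chart at `x`:
`dλ(v, w) = D_v λ(w) - D_w λ(v)`. -/
def OneForm.d (lam : OneForm N) (x : N) (v w : TangentSpace (𝓡 3) x) : ℝ :=
  fderiv ℝ (lam.inChart x) (extChartAt (𝓡 3) x x) (v : E3) (w : E3) -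
    fderiv ℝ (lam.inChart x) (extChartAt (𝓡 3) x x) (w : E3) (v : E3)

/-- `lam` is a contact form: it is smooth and `λ ∧ dλ` vanishes nowhere. -/
structure IsContactForm (lam : OneForm N) [IsManifold (𝓡 3) ∞ N] : Prop where
  smooth : SmoothOneForm lam
  wedge_ne_zero : ∀ x : N, ∃ u v w : TangentSpace (𝓡 3) x,
    lam x u * lam.d x v w + lam x v * lam.d x w u + lam x w * lam.d x u v ≠ 0

/-- `X` is the Reeb vector field of `lam`: `λ(X) = 1` and `i_X dλ = 0`. -/
structure IsReebField (lam : OneForm N) (X : VField N) : Prop where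
  apply_self : ∀ x, lam x (X x) = 1
  d_apply : ∀ x (v : TangentSpace (𝓡 3) x), lam.d x (X x) v = 0

/-- `ψ` is the flow of the vector field `X`: the smooth one-parameter group generated by `X`. -/
structure IsFlowOf (ψ : Flow ℝ N) (X : VField N) : Prop where
  smooth : ContMDiff (𝓘(ℝ, ℝ).prod (𝓡 3)) (𝓡 3) ∞ (fun a : ℝ × N => ψ a.1 a.2)
  integral : ∀ x, IsMIntegralCurve (I := 𝓡 3) (fun t => ψ t x) X

/-- The point `z` lies on a closed orbit of `ψ` whose (minimal) period is `T`. -/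
def HasPeriod (ψ : Flow ℝ N) (z : N) (T : ℝ) : Prop :=
  IsLeast {t : ℝ | 0 < t ∧ ψ t z = z} T

/-- The orbit through `z`. -/
def orbit (ψ : Flow ℝ N) (z : N) : Set N := Set.range (fun t : ℝ => ψ t z)

/-- The derivative `dψ_t` at `x`. -/
def flowDeriv (ψ : Flow ℝ N) (t : ℝ) (x : N) : E3 →L[ℝ] E3 :=
  mfderiv (𝓡 3) (𝓡 3) (fun y => ψ t y) x

/-- `σ` is a Floquet multiplier of the closed orbit of period `T` through `z`: a complex eigenvalue
of the linearized Poincaré map, i.e. of `dψ_T` restricted to the contact plane `ξ = ker λ` at `z`.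
The eigenvector is `u + i v` with `u, v ∈ ξ`. -/
def IsFloquetMultiplier (lam : OneForm N) (ψ : Flow ℝ N) (z : N) (T : ℝ) (σ : ℂ) : Prop :=
  ∃ u v : E3, lam z u = 0 ∧ lam z v = 0 ∧ (u ≠ 0 ∨ v ≠ 0) ∧
    flowDeriv ψ T z u = σ.re • u - σ.im • v ∧ flowDeriv ψ T z v = σ.im • u + σ.re • v

/-- The closed orbit of period `T` through `z` is elliptic: its Floquet multipliers have
modulus `1`. -/
def IsElliptic (lam : OneForm N) (ψ : Flow ℝ N) (z : N) (T : ℝ) : Prop :=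
  ∀ σ : ℂ, IsFloquetMultiplier lam ψ z T σ → ‖σ‖ = 1

end Contact

section Surface

variable {N : Type*} [TopologicalSpace N] [ChartedSpace E3 N]
variable {S : Type*} [TopologicalSpace S] [ChartedSpace (EuclideanHalfSpace 2) S]

/-- The derivative of a map from a surface to a 3-manifold. -/
def surfDeriv (f : S → N) (p : S) : E2 →L[ℝ] E3 := mfderiv (𝓡∂ 2) (𝓡 3) f p

/-- `f : S → N` is a surface of section for the flow `ψ` of `X` (`S` being a compact surface
with boundary): `f` is an immersion, its restriction to the interior of `S` is an embedding
transverse to `X`, and its restriction to the boundary is a covering of a finite union of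
closed orbits. -/
structure IsSurfaceOfSection (X : VField N) (ψ : Flow ℝ N) (f : S → N) : Prop where
  immersion : Manifold.IsImmersion (𝓡∂ 2) (𝓡 3) ∞ f
  embedding : Topology.IsEmbedding (fun p : (𝓡∂ 2).interior S => f p)
  transverse : ∀ p ∈ (𝓡∂ 2).interior S, (X (f p) : E3) ∉ Set.range (surfDeriv f p)
  boundary : ∃ Z : Finset N, (∀ z ∈ Z, ∃ T, HasPeriod ψ z T) ∧
    ∃ h : Set.MapsTo f ((𝓡∂ 2).boundary S) (⋃ z ∈ Z, orbit ψ z),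
      Function.Surjective (h.restrict f _ _) ∧ IsCoveringMap (h.restrict f _ _)

/-- The boundary circles of `S` lying over the closed orbit `Γ`. -/
def boundaryOver (f : S → N) (Γ : Set N) : Set S := (𝓡∂ 2).boundary S ∩ f ⁻¹' Γ

/-- The closed orbit `Γ` is a rotating boundary orbit of `f`: it is covered by a part of the
boundary, and the first arrival times to the surface, forward and backward, are bounded
near `Γ` in the surface. -/
structure IsRotating (ψ : Flow ℝ N) (f : S → N) (Γ : Set N) : Prop where
  subset_boundary : Γ ⊆ f '' (𝓡∂ 2).boundary S
  returns : ∃ ℓ : ℝ, 0 < ℓ ∧ ∃ U : Set S, IsOpen U ∧ boundaryOver f Γ ⊆ U ∧ ∀ p ∈ U,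
    (∃ t ∈ Set.Ioo 0 ℓ, ψ t (f p) ∈ Set.range f) ∧
    (∃ t ∈ Set.Ioo (-ℓ) 0, ψ t (f p) ∈ Set.range f)

/-- A tangent vector at a boundary point of `S` points to the interior: the model is the
half plane where the coordinate number `0` is nonnegative. -/
def IsInward {p : S} (w : TangentSpace (𝓡∂ 2) p) : Prop := 0 < (show E2 from w) 0

/-- The trace of the surface on the unit normal bundle of a boundary orbit.
A point of the unit normal bundle over `z`, i.e. an oriented line (a ray) in `T_z N / ℝ X(z)`, is
the same thing as an open half plane of `T_z N` bounded by `ℝ X(z)`. When `p` is a boundary point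
of the surface, the curve `f(∂S)` is tangent to `X` at `f p`, and the ray
in which the surface leaves `f p` corresponds to the half plane of all the vectors `df_p(w)` with
`w` pointing inward. It is represented here as a subset of the tangent bundle. -/
def traceRay (f : S → N) (p : S) : Set (TangentBundle (𝓡 3) N) :=
  {u | ∃ w : TangentSpace (𝓡∂ 2) p, IsInward w ∧ u = ⟨f p, surfDeriv f p w⟩}

/-- The trace of the surface on the unit normal bundle is, at the boundary point `p`,
transverse to the extension of the vector field `X`.

The extension of `X` to the unit normal bundle generates the flow
`(z, [v]) ↦ (ψ_s z, [dψ_s v])`. Near `p` the boundary is a curve `c` with `f (c s) = ψ_s (f p)`,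
and its trace on the unit normal bundle is `s ↦ [df (w s)]` for any smooth field `w` of inward
vectors along `c`. Pulled back by the extended flow, this becomes the curve of rays
`[v s]` in the fixed plane `T N / ℝ X` at `f p`, where `v s = dψ_{-s} (df (w s))`. The trace is
transverse to the extended vector field at `s = 0` iff the angular velocity of `[v s]` at `s = 0`
is nonzero, i.e. iff `X`, `v 0` and `v' 0` are linearly independent. -/
def TraceTransverseAt (X : VField N) (ψ : Flow ℝ N) (f : S → N) [IsManifold (𝓡∂ 2) ∞ S]
    (p : S) : Prop :=
  ∃ (c : ℝ → S) (w : (s : ℝ) → TangentSpace (𝓡∂ 2) (c s)) (v : ℝ → E3) (v' : E3),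
    c 0 = p ∧ (∀ s, c s ∈ (𝓡∂ 2).boundary S) ∧ (∀ s, f (c s) = ψ s (f p)) ∧
    ContMDiff 𝓘(ℝ, ℝ) (𝓡∂ 2).tangent ∞
      (fun s : ℝ => (⟨c s, w s⟩ : TangentBundle (𝓡∂ 2) S)) ∧
    (∀ s, IsInward (w s)) ∧
    (∀ s, v s = flowDeriv ψ (-s) (f (c s)) (surfDeriv f (c s) (w s))) ∧
    HasDerivAt v v' 0 ∧
    LinearIndependent ℝ ![(X (f p) : E3), v 0, v']

/-- The extension of the surface to the unit normal bundle of `Γ`, by blowing up `Γ` in polar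
coordinates, is an embedded collection of closed curves, transverse to the
extension of the vector field `X`. (The trace is a continuous map of the compact
1-manifold `boundaryOver f Γ`, immersed because it covers `Γ`, so that it is embedded as soon as
it is injective.) -/
structure HasTransverseTrace (X : VField N) (ψ : Flow ℝ N) (f : S → N) (Γ : Set N)
    [IsManifold (𝓡∂ 2) ∞ S] : Prop where
  embedded : Set.InjOn (traceRay f) (boundaryOver f Γ)
  transverse : ∀ p ∈ boundaryOver f Γ, TraceTransverseAt X ψ f p

/-- `q` is the image of `p` under the first return map to the surface:
`f q = ψ_τ (f p)` with `τ = min {t > 0 | ψ_t (f p) ∈ f S}`. -/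
def IsFirstReturn (ψ : Flow ℝ N) (f : S → N) (p q : S) : Prop :=
  ∃ τ : ℝ, IsLeast {t : ℝ | 0 < t ∧ ψ t (f p) ∈ Set.range f} τ ∧ ψ τ (f p) = f q

/-- `F` is a continuous extension to the boundary circles over `Γ` of the return map: on some
neighbourhood of these circles it is continuous, and at the interior points it is the first
return map. (Values of `F` outside the neighbourhood are irrelevant.) -/
def IsReturnExtension (ψ : Flow ℝ N) (f : S → N) (Γ : Set N) (F : S → S) : Prop :=
  ∃ U : Set S, IsOpen U ∧ boundaryOver f Γ ⊆ U ∧ ContinuousOn F U ∧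
    ∀ p ∈ U ∩ (𝓡∂ 2).interior S, IsFirstReturn ψ f p (F p)

end Surface

end ReebSection

end

/-! The blow-up of Γ is never built. A boundary point `p` over Γ stands for the ray of `inwardVec f
p` in TN/ℝX, and `InwardRel X ψ f p t q` says that dψ_t carries the ray at `p` to the ray at `q`. On
the boundary, the extended return map follows the linearized flow from one ray of the trace to the
next.

Local picture. In a flow box (`exists_flowBox`) project along the flow lines. Near a boundary point
the projected surface is a map g(r, s), r ≥ 0, that vanishes on the axis r = 0, so g = r · h with h
differentiable at the origin. Transversality of the trace says exactly that the direction of h(0, s)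
turns with nonzero speed (`boundary_structure`). Hence g behaves like polar coordinates
(`polar_chart`): it is injective for r > 0, and it reaches every point that tends to the origin
along the inward direction.

Limits of returns. Let interior points x tend to `p`. First return times are bounded because Γ is
rotating, and S is compact, so times and image points have ultrafilter limits (t, q). Every limit
satisfies t > 0 and `InwardRel` (`inwardRel_of_tendsto`): after the flow and the projection, the
points leave the origin both along the transported ray of `p` and along the ray of `q`. Conversely,
every related pair (t, q) with t > 0 forces all nearby interior x to meet the surface at a time
close to t (`eventually_return_boundary`). First return times therefore cannot have two different
limits, and t determines q because the trace is embedded (`inwardRel_unique`). The criterion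
`exists_tendsto_return` turns this into convergence. All this uses that the interior of the surface
avoids the boundary orbits (`IsSurfaceOfSection.map_ne_of_interior`), which follows from
embeddedness by an intermediate value argument.

No periodic points. `InwardRel` composes and times add, so a periodic boundary point gives
`InwardRel X ψ f p t p` with t > 0. Then t = kT with k > 0, and (dψ_T)^k has a positive eigenvalue μ
on TN/ℝX. The Reeb flow preserves λ (`IsFlowOf.formVec_flowDeriv`), so this quotient can be replaced
by ker λ, and some Floquet multiplier σ satisfies σ^k = μ. Ellipticity gives μ = |σ|^k = 1, so σ is
a root of unity, a contradiction (`not_inwardRel_self`). -/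

namespace ReebSection

open Set Filter

/-! ### Polar coordinates for maps of the plane that collapse an axis. -/

section PolarBlowUp

variable {W : Type*} [NormedAddCommGroup W] [NormedSpace ℝ W] [CompleteSpace W]

/-- The average of `D` over the segment from `(0, u.2)` to `u`. -/
noncomputable def segmentAverage (D : ℝ × ℝ → W) (u : ℝ × ℝ) : W :=
  ∫ t in (0 : ℝ)..1, D (t * u.1, u.2)

lemma norm_scale_fst_le {t : ℝ} (ht : t ∈ Icc (0 : ℝ) 1) (u : ℝ × ℝ) : ‖(t * u.1, u.2)‖ ≤ ‖u‖ := by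
  rw [Prod.norm_def, Prod.norm_def]
  refine max_le_max ?_ le_rfl
  rw [norm_mul, Real.norm_eq_abs t, abs_of_nonneg ht.1]
  exact mul_le_of_le_one_left (norm_nonneg _) ht.2

omit [NormedSpace ℝ W] [CompleteSpace W] in
lemma intervalIntegrable_segment {D : ℝ × ℝ → W} {δ : ℝ}
    (hD : ContinuousOn D (Metric.ball 0 δ)) {u : ℝ × ℝ} (hu : u ∈ Metric.ball (0 : ℝ × ℝ) δ) :
    IntervalIntegrable (fun t : ℝ => D (t * u.1, u.2)) MeasureTheory.volume 0 1 := by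
  apply ContinuousOn.intervalIntegrable
  rw [uIcc_of_le zero_le_one]
  refine hD.comp (by fun_prop) fun t ht => ?_
  rw [mem_ball_zero_iff] at hu ⊢
  exact (norm_scale_fst_le ht u).trans_lt hu

/-- Hadamard's lemma: the fundamental theorem of calculus on the horizontal segment from the axis to
`u`. -/
lemma eq_smul_segmentAverage {g : ℝ × ℝ → W} {δ : ℝ}
    (hg : ∀ u ∈ Metric.ball (0 : ℝ × ℝ) δ, DifferentiableAt ℝ g u)
    (hD : ContinuousOn (fun u => fderiv ℝ g u (1, 0)) (Metric.ball 0 δ))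
    {u : ℝ × ℝ} (hu : u ∈ Metric.ball (0 : ℝ × ℝ) δ) (h0 : g (0, u.2) = 0) :
    g u = u.1 • segmentAverage (fun u => fderiv ℝ g u (1, 0)) u := by
  have key : ∀ t ∈ uIcc (0 : ℝ) 1, HasDerivAt (fun t : ℝ => g (t * u.1, u.2))
      (u.1 • fderiv ℝ g (t * u.1, u.2) (1, 0)) t := by
    intro t ht
    rw [uIcc_of_le zero_le_one] at ht
    have hmem : (t * u.1, u.2) ∈ Metric.ball (0 : ℝ × ℝ) δ := by
      rw [mem_ball_zero_iff] at hu ⊢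
      exact (norm_scale_fst_le ht u).trans_lt hu
    have h1 : HasDerivAt (fun t : ℝ => (t * u.1, u.2)) (u.1, (0 : ℝ)) t :=
      (by simpa using (hasDerivAt_id t).mul_const u.1 : HasDerivAt (fun t : ℝ => t * u.1) u.1 t).prodMk
        (hasDerivAt_const t u.2)
    have h2 := (hg _ hmem).hasFDerivAt.comp_hasDerivAt t h1
    have h3 : ((u.1, (0 : ℝ)) : ℝ × ℝ) = u.1 • ((1 : ℝ), (0 : ℝ)) := by ext <;> simp
    rw [h3, map_smul] at h2
    exact h2
  have hint := (intervalIntegrable_segment hD hu).smul u.1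
  have := intervalIntegral.integral_eq_sub_of_hasDerivAt key hint
  rw [intervalIntegral.integral_smul] at this
  simp only [one_mul, zero_mul, h0, sub_zero, Prod.mk.eta] at this
  exact this.symm

/-- Shrinking the first coordinate by t ≤ 1 keeps points in the ball, so the strict estimate for `D`
at 0 holds uniformly in t and can be integrated. The factor 1/2 is the integral of t over [0, 1]. -/
lemma hasStrictFDerivAt_segmentAverage {D : ℝ × ℝ → W} {D' : ℝ × ℝ →L[ℝ] W} {δ : ℝ} (hδ : 0 < δ)
    (hD : ContinuousOn D (Metric.ball 0 δ)) (hD' : HasStrictFDerivAt D D' 0) :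
    HasStrictFDerivAt (segmentAverage D)
      (D'.comp (((1 / 2 : ℝ) • ContinuousLinearMap.fst ℝ ℝ ℝ).prod
        (ContinuousLinearMap.snd ℝ ℝ ℝ))) 0 := by
  rw [hasStrictFDerivAt_iff_isLittleO, Asymptotics.isLittleO_iff]
  intro c hc
  have hev := (Asymptotics.isLittleO_iff.1 hD'.isLittleO) hc
  obtain ⟨ε, hε, hεs⟩ := Metric.eventually_nhds_iff_ball.1 hev
  have hmin : 0 < min ε δ := lt_min hε hδ
  filter_upwards [Metric.ball_mem_nhds ((0, 0) : (ℝ × ℝ) × ℝ × ℝ) hmin]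
  rintro ⟨a, b⟩ hab
  rw [← Prod.zero_eq_mk, mem_ball_zero_iff, Prod.norm_def, max_lt_iff] at hab
  obtain ⟨ha, hb⟩ := hab
  have hi : ∀ {u : ℝ × ℝ}, ‖u‖ < min ε δ →
      IntervalIntegrable (fun t : ℝ => D (t * u.1, u.2)) MeasureTheory.volume 0 1 := fun hu =>
    intervalIntegrable_segment hD (mem_ball_zero_iff.2 (hu.trans_le (min_le_right _ _)))
  have hlin : ∫ t in (0 : ℝ)..1, D' (t * (a - b).1, (a - b).2) =
      D' (((1 / 2 : ℝ) * (a - b).1, (a - b).2)) := by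
    have : ∀ t : ℝ, D' (t * (a - b).1, (a - b).2) =
        t • D' ((a - b).1, 0) + D' (0, (a - b).2) := by
      intro t
      rw [← map_smul, ← map_add]
      congr 1
      ext <;> simp
    simp_rw [this]
    rw [intervalIntegral.integral_add (by apply Continuous.intervalIntegrable; fun_prop) (by simp),
      intervalIntegral.integral_smul_const]
    simp
  have hlin_int : IntervalIntegrable (fun t : ℝ => D' (t * (a - b).1, (a - b).2))
      MeasureTheory.volume 0 1 := by
    apply Continuous.intervalIntegrable; fun_prop
  have heq : segmentAverage D a - segmentAverage D b -
      (D'.comp (((1 / 2 : ℝ) • ContinuousLinearMap.fst ℝ ℝ ℝ).prod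
        (ContinuousLinearMap.snd ℝ ℝ ℝ))) (a - b) =
      ∫ t in (0 : ℝ)..1, (D (t * a.1, a.2) - D (t * b.1, b.2) -
        D' (t * (a - b).1, (a - b).2)) := by
    rw [intervalIntegral.integral_sub ((hi ha).sub (hi hb)) hlin_int,
      intervalIntegral.integral_sub (hi ha) (hi hb), hlin]
    rfl
  simp only
  rw [heq]
  have := intervalIntegral.norm_integral_le_of_norm_le_const (a := (0 : ℝ)) (b := 1)
    (C := c * ‖a - b‖)
    (f := fun t => D (t * a.1, a.2) - D (t * b.1, b.2) - D' (t * (a - b).1, (a - b).2)) ?_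
  · simpa using this
  intro t ht
  rw [uIoc_of_le zero_le_one] at ht
  have ht' : t ∈ Icc (0 : ℝ) 1 := ⟨ht.1.le, ht.2⟩
  have hmem : (((t * a.1, a.2), (t * b.1, b.2)) : (ℝ × ℝ) × ℝ × ℝ) ∈
      Metric.ball ((0, 0) : (ℝ × ℝ) × ℝ × ℝ) ε := by
    rw [← Prod.zero_eq_mk, mem_ball_zero_iff, Prod.norm_def, max_lt_iff]
    exact ⟨(norm_scale_fst_le ht' a).trans_lt (ha.trans_le (min_le_left _ _)),
      (norm_scale_fst_le ht' b).trans_lt (hb.trans_le (min_le_left _ _))⟩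
  have h1 := hεs _ hmem
  have h2 : ((t * a.1, a.2) : ℝ × ℝ) - (t * b.1, b.2) = (t * (a - b).1, (a - b).2) := by
    ext <;> simp [mul_sub]
  simp only [h2] at h1
  exact h1.trans (mul_le_mul_of_nonneg_left (norm_scale_fst_le ht' _) hc.le)

/-- If a `C^∞` map vanishes on the axis `u.1 = 0` then it is divisible by `u.1`. -/
lemma exists_eq_smul_of_vanishing_on_axis {g : ℝ × ℝ → W} (hg : ContDiffAt ℝ ∞ g 0)
    (h0 : ∀ᶠ s in 𝓝 (0 : ℝ), g (0, s) = 0) :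
    ∃ (h : ℝ × ℝ → W) (h' : ℝ × ℝ →L[ℝ] W), HasStrictFDerivAt h h' 0 ∧
      (∀ᶠ u in 𝓝 (0 : ℝ × ℝ), g u = u.1 • h u) ∧ h 0 = fderiv ℝ g 0 (1, 0) ∧
      h' (0, 1) = fderiv ℝ (fun u => fderiv ℝ g u (1, 0)) 0 (0, 1) := by
  have hg2 : ContDiffAt ℝ 2 g 0 := mod_cast contDiffAt_infty.1 hg 2
  have hD : ContDiffAt ℝ 1 (fun u => fderiv ℝ g u (1, 0)) 0 :=
    (hg2.fderiv_right (m := 1) (by norm_num)).clm_apply contDiffAt_const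
  have e1 : ∀ᶠ u in 𝓝 (0 : ℝ × ℝ), DifferentiableAt ℝ g u :=
    (hg2.eventually (by simp)).mono fun u hu => hu.differentiableAt (by simp)
  have e2 : ∀ᶠ u in 𝓝 (0 : ℝ × ℝ), ContinuousAt (fun u => fderiv ℝ g u (1, 0)) u :=
    (hD.eventually (by simp)).mono fun u hu => hu.continuousAt
  obtain ⟨δ, hδ, hball⟩ := Metric.eventually_nhds_iff_ball.1 (e1.and e2)
  have hcont : ContinuousOn (fun u => fderiv ℝ g u (1, 0)) (Metric.ball 0 δ) := fun u hu =>
    (hball u hu).2.continuousWithinAt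
  refine ⟨segmentAverage (fun u => fderiv ℝ g u (1, 0)), _,
    hasStrictFDerivAt_segmentAverage hδ hcont (hD.hasStrictFDerivAt (by simp)), ?_, ?_, ?_⟩
  · have h0' : ∀ᶠ u in 𝓝 (0 : ℝ × ℝ), g (0, u.2) = 0 :=
      (continuous_snd.tendsto' (0 : ℝ × ℝ) 0 rfl).eventually h0
    filter_upwards [Metric.ball_mem_nhds _ hδ, h0'] with u hu hu0
    exact eq_smul_segmentAverage (fun u hu => (hball u hu).1) hcont hu hu0
  · simp [segmentAverage, Prod.zero_eq_mk]
  · simp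

/-- For `u.1 > 0` the quotient is the continuous factor `h`, so the limit does not depend on how `u`
approaches the origin, even tangentially to the axis. -/
lemma tendsto_inv_smul_of_vanishing_on_axis {g : ℝ × ℝ → W} (hg : ContDiffAt ℝ ∞ g 0)
    (h0 : ∀ᶠ s in 𝓝 (0 : ℝ), g (0, s) = 0) :
    Tendsto (fun u : ℝ × ℝ => u.1⁻¹ • g u) (𝓝[{u | 0 < u.1}] 0) (𝓝 (fderiv ℝ g 0 (1, 0))) := by
  obtain ⟨h, h', hh, hgh, he, -⟩ := exists_eq_smul_of_vanishing_on_axis hg h0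
  rw [← he]
  refine (hh.hasFDerivAt.continuousAt.tendsto.mono_left nhdsWithin_le_nhds).congr' ?_
  filter_upwards [hgh.filter_mono nhdsWithin_le_nhds, self_mem_nhdsWithin] with u hu hpos
  rw [hu, smul_smul, inv_mul_cancel₀ (ne_of_gt hpos), one_smul]

lemma exists_openPartialHomeomorph_of_injective {E F : Type*} [NormedAddCommGroup E]
    [NormedSpace ℝ E] [FiniteDimensional ℝ E] [NormedAddCommGroup F] [NormedSpace ℝ F]
    [FiniteDimensional ℝ F] (hEF : Module.finrank ℝ E = Module.finrank ℝ F) {f : E → F}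
    {f' : E →L[ℝ] F} {a : E} (hf : HasStrictFDerivAt f f' a) (hinj : ∀ v, f' v = 0 → v = 0) :
    ∃ Φ : OpenPartialHomeomorph E F, (∀ u, Φ u = f u) ∧ a ∈ Φ.source := by
  have : CompleteSpace E := FiniteDimensional.complete ℝ E
  have hinj' : Function.Injective (f' : E →ₗ[ℝ] F) :=
    (injective_iff_map_eq_zero (f' : E →ₗ[ℝ] F)).2 hinj
  let L : E ≃L[ℝ] F :=
    (LinearEquiv.ofInjectiveOfFinrankEq (f' : E →ₗ[ℝ] F) hinj' hEF).toContinuousLinearEquiv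
  have hL : (L : E →L[ℝ] F) = f' := by ext v; rfl
  rw [← hL] at hf
  exact ⟨hf.toOpenPartialHomeomorph f, fun u => rfl, hf.mem_toOpenPartialHomeomorph_source⟩

/-- Polar coordinates: if `g` vanishes on the axis `u.1 = 0` and the direction of `∂₁ g` turns
along the axis with nonzero velocity, then `g` maps a half disk to a sector at the origin in a
one-to-one way. -/
theorem polar_chart {g : ℝ × ℝ → ℝ × ℝ} (hg : ContDiffAt ℝ ∞ g 0)
    (h0 : ∀ᶠ s in 𝓝 (0 : ℝ), g (0, s) = 0) {e k : ℝ × ℝ} (he : fderiv ℝ g 0 (1, 0) = e)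
    (hk : fderiv ℝ (fun u => fderiv ℝ g u (1, 0)) 0 (0, 1) = k)
    (hdet : e.1 * k.2 - e.2 * k.1 ≠ 0) :
    (∃ A ∈ 𝓝 (0 : ℝ × ℝ), InjOn g (A ∩ {u | 0 < u.1})) ∧
    ∀ A ∈ 𝓝 (0 : ℝ × ℝ), ∀ {ι : Type*} (l : Filter ι) (y : ι → ℝ × ℝ) (ρ : ι → ℝ) (μ : ℝ),
      0 < μ → Tendsto y l (𝓝 0) → (∀ᶠ n in l, 0 < ρ n) →
      Tendsto (fun n => (ρ n)⁻¹ • y n) l (𝓝 (μ • e)) →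
      ∀ᶠ n in l, ∃ u ∈ A, 0 < u.1 ∧ g u = y n := by
  obtain ⟨h, h', hh, hgh, hhe, hhk⟩ := exists_eq_smul_of_vanishing_on_axis hg h0
  rw [he] at hhe
  rw [hk] at hhk
  set m : ℝ := e.1 * e.1 + e.2 * e.2 with hm
  have hmpos : 0 < m := by
    rcases eq_or_ne e.1 0 with h1 | h1
    · rcases eq_or_ne e.2 0 with h2 | h2
      · simp [h1, h2] at hdet
      · have := mul_self_pos.2 h2; nlinarith [mul_self_nonneg e.1]
    · have := mul_self_pos.2 h1; nlinarith [mul_self_nonneg e.2]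
  -- Scalar product and determinant with `e`: β/α is the slope measured from the ray of `e`.
  let α : ℝ × ℝ →L[ℝ] ℝ := e.1 • ContinuousLinearMap.fst ℝ ℝ ℝ + e.2 • ContinuousLinearMap.snd ℝ ℝ ℝ
  let β : ℝ × ℝ →L[ℝ] ℝ := e.1 • ContinuousLinearMap.snd ℝ ℝ ℝ - e.2 • ContinuousLinearMap.fst ℝ ℝ ℝ
  have hα : ∀ y, α y = e.1 * y.1 + e.2 * y.2 := fun y => rfl
  have hβ : ∀ y, β y = e.1 * y.2 - e.2 * y.1 := fun y => rfl
  have hαe : α e = m := rfl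
  have hβe : β e = 0 := by rw [hβ]; ring
  have hsep : ∀ y z : ℝ × ℝ, α y = α z → β y = β z → y = z := by
    intro y z h1 h2
    rw [hα, hα] at h1
    rw [hβ, hβ] at h2
    have e1 : m * (y.1 - z.1) = 0 := by rw [hm]; linear_combination e.1 * h1 - e.2 * h2
    have e2 : m * (y.2 - z.2) = 0 := by rw [hm]; linear_combination e.2 * h1 + e.1 * h2
    ext
    · exact sub_eq_zero.1 ((mul_eq_zero.1 e1).resolve_left hmpos.ne')
    · exact sub_eq_zero.1 ((mul_eq_zero.1 e2).resolve_left hmpos.ne')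
  have hg0 : g 0 = 0 := h0.self_of_nhds
  have hgs : HasStrictFDerivAt g (fderiv ℝ g 0) 0 := hg.hasStrictFDerivAt (by simp)
  have hg01 : fderiv ℝ g 0 (0, 1) = 0 := by
    have h1 : HasDerivAt (fun s : ℝ => ((0 : ℝ), s)) (0, 1) 0 :=
      (hasDerivAt_const _ _).prodMk (hasDerivAt_id _)
    have h2 : HasDerivAt (fun s : ℝ => g (0, s)) (fderiv ℝ g 0 (0, 1)) 0 :=
      hgs.hasFDerivAt.comp_hasDerivAt (0 : ℝ) h1
    exact h2.unique ((hasDerivAt_const (0 : ℝ) (0 : ℝ × ℝ)).congr_of_eventuallyEq h0)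
  have hαh : ∀ᶠ u in 𝓝 (0 : ℝ × ℝ), 0 < α (h u) := by
    have : Tendsto (fun u => α (h u)) (𝓝 0) (𝓝 (α (h 0))) :=
      (α.continuous.continuousAt.comp hh.hasFDerivAt.continuousAt)
    rw [hhe, hαe] at this
    exact this.eventually_const_lt hmpos
  -- The slope of g equals the slope of h off the axis; written with h it extends across the axis.
  -- Since β(h 0) = 0, only the derivative of β ∘ h survives.
  have hφ : HasStrictFDerivAt (fun u => β (h u) * (α (h u))⁻¹)
      (m⁻¹ • (β.comp h')) 0 := by
    have h1 : HasStrictFDerivAt (fun u => β (h u)) (β.comp h') 0 := β.hasStrictFDerivAt.comp 0 hh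
    have h2 : HasStrictFDerivAt (fun u => α (h u)) (α.comp h') 0 := α.hasStrictFDerivAt.comp 0 hh
    have h3 := h1.mul ((hasStrictDerivAt_inv
      (show α (h 0) ≠ 0 by rw [hhe, hαe]; exact hmpos.ne')).comp_hasStrictFDerivAt 0 h2)
    convert! h3 using 1
    simp [hhe, hαe, hβe]
  -- The pair (α ∘ g, slope) has triangular derivative at 0, with diagonal entries m and `hdet`'s
  -- determinant divided by m; the inverse function theorem applies.
  have hG := ((α.hasStrictFDerivAt (x := g 0)).comp 0 hgs).prodMk hφ
  obtain ⟨Φ, hΦ, hΦ0⟩ := exists_openPartialHomeomorph_of_injective rfl hG (by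
    intro v hv
    have hv' : v = v.1 • ((1 : ℝ), (0 : ℝ)) + v.2 • ((0 : ℝ), (1 : ℝ)) := by ext <;> simp
    have h1 : α (fderiv ℝ g 0 v) = 0 := congrArg Prod.fst hv
    have h2 : m⁻¹ * β (h' v) = 0 := congrArg Prod.snd hv
    rw [hv', map_add, map_smul, map_smul, he, hg01, smul_zero, add_zero, map_smul, hαe,
      smul_eq_mul] at h1
    have h3 : v.1 = 0 := (mul_eq_zero.1 h1).resolve_right hmpos.ne'
    rw [hv', h3, zero_smul, zero_add, map_smul, hhk, map_smul, hβ, smul_eq_mul] at h2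
    have h4 : v.2 = 0 := by
      have := (mul_eq_zero.1 h2).resolve_left (inv_ne_zero hmpos.ne')
      exact (mul_eq_zero.1 this).resolve_right hdet
    exact Prod.ext h3 h4)
  have hΦ' : ∀ u, Φ u = (α (g u), β (h u) * (α (h u))⁻¹) := hΦ
  refine ⟨⟨_, inter_mem (Φ.open_source.mem_nhds hΦ0) (inter_mem hgh hαh), ?_⟩, ?_⟩
  · rintro u ⟨⟨hu, hu1, hu2⟩, hu3⟩ v ⟨⟨hv, hv1, hv2⟩, hv3⟩ huv
    refine Φ.injOn hu hv ?_
    have hslope : ∀ w : ℝ × ℝ, 0 < w.1 → g w = w.1 • h w → 0 < α (h w) →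
        β (h w) * (α (h w))⁻¹ = β (g w) * (α (g w))⁻¹ := by
      intro w h1 h2 h3
      rw [h2, map_smul, map_smul, smul_eq_mul, smul_eq_mul]
      have := h1.ne'
      have := h3.ne'
      field_simp
    rw [hΦ', hΦ', hslope u hu3 hu1 hu2, hslope v hv3 hv1 hv2, huv]
  · intro A hA ι l y ρ μ hμ hy hρ hlim
    have hsymm : Tendsto Φ.symm (𝓝 0) (𝓝 0) := by
      have h1 := Φ.continuousAt_symm (Φ.map_source hΦ0)
      have h2 : Φ 0 = 0 := by
        rw [hΦ', hg0, hhe, hβe, map_zero, zero_mul]; rfl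
      rw [ContinuousAt, Φ.left_inv hΦ0, h2] at h1
      exact h1
    have htgt : Φ.target ∈ 𝓝 (0 : ℝ × ℝ) := by
      have h2 : Φ 0 = 0 := by
        rw [hΦ', hg0, hhe, hβe, map_zero, zero_mul]; rfl
      exact h2 ▸ Φ.open_target.mem_nhds (Φ.map_source hΦ0)
    have hα' : Tendsto (fun n => α ((ρ n)⁻¹ • y n)) l (𝓝 (μ * m)) := by
      have := (α.continuous.tendsto (μ • e)).comp hlim
      rwa [map_smul, hαe] at this
    have hβ' : Tendsto (fun n => β ((ρ n)⁻¹ • y n)) l (𝓝 0) := by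
      have := (β.continuous.tendsto (μ • e)).comp hlim
      rwa [map_smul, hβe, smul_zero] at this
    -- The slope is scale invariant, so it may be computed on the rescaled points, which tend to a
    -- positive multiple of `e`.
    have hz : Tendsto (fun n => ((α (y n), β (y n) * (α (y n))⁻¹) : ℝ × ℝ)) l (𝓝 0) := by
      refine Tendsto.prodMk_nhds ?_ ?_
      · exact (α.continuous.tendsto' 0 0 (map_zero α)).comp hy
      · have h1 := hβ'.mul (hα'.inv₀ (mul_pos hμ hmpos).ne')
        rw [zero_mul] at h1
        refine h1.congr' ?_
        filter_upwards [hρ] with n hn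
        rw [map_smul, map_smul, smul_eq_mul, smul_eq_mul]
        have := hn.ne'
        by_cases h : α (y n) = 0
        · simp [h]
        · field_simp
    have hαpos : ∀ᶠ n in l, 0 < α (y n) := by
      filter_upwards [hα'.eventually_const_lt (mul_pos hμ hmpos), hρ] with n h1 h2
      rw [map_smul, smul_eq_mul] at h1
      exact (mul_pos_iff_of_pos_left (inv_pos.2 h2)).1 h1
    filter_upwards [hαpos, hz.eventually htgt,
      (hsymm.comp hz).eventually (inter_mem hA (inter_mem hgh hαh))] with n h1 h2 h3
    obtain ⟨h3, h4, h5⟩ := h3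
    refine ⟨_, h3, ?_⟩
    have h6 := Φ.right_inv h2
    simp only [Function.comp_apply, Set.mem_ofPred_eq] at h4 h5 ⊢
    set u := Φ.symm (α (y n), β (y n) * (α (y n))⁻¹)
    rw [hΦ'] at h6
    have h7 : α (g u) = α (y n) := congrArg Prod.fst h6
    have h8 : β (h u) * (α (h u))⁻¹ = β (y n) * (α (y n))⁻¹ := congrArg Prod.snd h6
    have h9 : u.1 * α (h u) = α (y n) := by rw [← h7, h4, map_smul, smul_eq_mul]
    -- The local inverse is defined on both sides of the axis; the signs of α(y) and α(h u) select
    -- the half plane.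
    have h10 : 0 < u.1 := by
      rw [← h9] at h1
      exact (pos_iff_pos_of_mul_pos h1).2 h5
    refine ⟨h10, hsep _ _ h7 ?_⟩
    rw [h4, map_smul, smul_eq_mul]
    have := h1.ne'
    have := h5.ne'
    field_simp at h8
    have h11 : β (h u) * (u.1 * α (h u)) = β (y n) * α (h u) := by rw [h9]; linarith
    have h12 : α (h u) * (u.1 * β (h u) - β (y n)) = 0 := by linear_combination h11
    linarith [(mul_eq_zero.1 h12).resolve_left h5.ne']

end PolarBlowUp

end ReebSection

namespace ReebSection

open Set Filter

/-! ### Derivatives along a flow, and the flow in a chart. -/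

section FlowCalculus

variable {N : Type*} [TopologicalSpace N] [ChartedSpace E3 N]
variable {W : Type*} [NormedAddCommGroup W] [NormedSpace ℝ W]
variable {W' : Type*} [NormedAddCommGroup W'] [NormedSpace ℝ W']

/-- The derivative of a map from a 3-manifold to a normed space. -/
noncomputable def derivFrom (P : N → W) (x : N) : E3 →L[ℝ] W := mfderiv (𝓡 3) 𝓘(ℝ, W) P x

/-- The derivative of a map from a normed space to a 3-manifold. -/
noncomputable def derivTo (F : W → N) (u : W) : W →L[ℝ] E3 := mfderiv 𝓘(ℝ, W) (𝓡 3) F u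

/-- The value of a vector field, as a vector of the model space. -/
def fieldVec (X : VField N) (x : N) : E3 := X x

/-- The chain rule with all tangent spaces read as the fixed model space, so that it can be
rewritten along equalities of base points. -/
lemma fderiv_comp_derivTo {P : N → W'} {F : W → N} {u : W}
    (hP : MDifferentiableAt (𝓡 3) 𝓘(ℝ, W') P (F u))
    (hF : MDifferentiableAt 𝓘(ℝ, W) (𝓡 3) F u) (w : W) :
    fderiv ℝ (fun u => P (F u)) u w = derivFrom P (F u) (derivTo F u w) := by
  have := mfderiv_comp u hP hF
  rw [mfderiv_eq_fderiv] at this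
  exact congrArg (fun L : W →L[ℝ] W' => L w) this

lemma derivFrom_comp_flow {ψ : Flow ℝ N} {P : N → W} {t : ℝ} {x : N}
    (hψ : MDifferentiableAt (𝓡 3) (𝓡 3) (fun y => ψ t y) x)
    (hP : MDifferentiableAt (𝓡 3) 𝓘(ℝ, W) P (ψ t x)) (v : E3) :
    derivFrom (fun y => P (ψ t y)) x v = derivFrom P (ψ t x) (flowDeriv ψ t x v) := by
  have := mfderiv_comp x hP hψ
  exact congrArg (fun L : E3 →L[ℝ] W => L v) this

lemma derivTo_flow_comp {ψ : Flow ℝ N} {F : W → N} {t : ℝ} {u : W}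
    (hψ : MDifferentiableAt (𝓡 3) (𝓡 3) (fun y => ψ t y) (F u))
    (hF : MDifferentiableAt 𝓘(ℝ, W) (𝓡 3) F u) (w : W) :
    derivTo (fun u => ψ t (F u)) u w = flowDeriv ψ t (F u) (derivTo F u w) := by
  have := mfderiv_comp u hψ hF
  exact congrArg (fun L : W →L[ℝ] E3 => L w) this

namespace IsFlowOf

variable {ψ : Flow ℝ N} {X : VField N}

lemma comp_contMDiffAt (hψ : IsFlowOf ψ X) {H E M : Type*} [NormedAddCommGroup E]
    [NormedSpace ℝ E] [TopologicalSpace H] {I : ModelWithCorners ℝ E H} [TopologicalSpace M]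
    [ChartedSpace H M] {a : M → ℝ} {b : M → N} {w : M}
    (ha : ContMDiffAt I 𝓘(ℝ, ℝ) ∞ a w) (hb : ContMDiffAt I (𝓡 3) ∞ b w) :
    ContMDiffAt I (𝓡 3) ∞ (fun w => ψ (a w) (b w)) w :=
  (hψ.smooth.contMDiffAt (x := (a w, b w))).comp w (ha.prodMk hb)

lemma contMDiffAt (hψ : IsFlowOf ψ X) (t : ℝ) (x : N) :
    ContMDiffAt (𝓡 3) (𝓡 3) ∞ (fun y => ψ t y) x :=
  hψ.comp_contMDiffAt contMDiffAt_const contMDiffAt_id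

lemma mdifferentiableAt (hψ : IsFlowOf ψ X) (t : ℝ) (x : N) :
    MDifferentiableAt (𝓡 3) (𝓡 3) (fun y => ψ t y) x :=
  (hψ.contMDiffAt t x).mdifferentiableAt (by simp)

lemma flowDeriv_add (hψ : IsFlowOf ψ X) (s t : ℝ) (x : N) (v : E3) :
    flowDeriv ψ (s + t) x v = flowDeriv ψ s (ψ t x) (flowDeriv ψ t x v) := by
  have h1 : (fun y => ψ (s + t) y) = (fun y => ψ s y) ∘ (fun y => ψ t y) :=
    funext fun y => ψ.map_add s t y
  have h2 := mfderiv_comp x (hψ.mdifferentiableAt s (ψ t x)) (hψ.mdifferentiableAt t x)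
  rw [← h1] at h2
  exact congrArg (fun L : E3 →L[ℝ] E3 => L v) h2

omit [NormedAddCommGroup W] [NormedSpace ℝ W] in
lemma flowDeriv_zero (ψ : Flow ℝ N) (x : N) (v : E3) : flowDeriv ψ 0 x v = v := by
  have h1 : (fun y => ψ 0 y) = (id : N → N) := funext fun y => ψ.map_zero_apply y
  have h2 : mfderiv (𝓡 3) (𝓡 3) (fun y => ψ 0 y) x = mfderiv (𝓡 3) (𝓡 3) (id : N → N) x := by
    rw [h1]
  exact (congrArg (fun L : E3 →L[ℝ] E3 => L v) h2).trans
    (congrArg (fun L : E3 →L[ℝ] E3 => L v) (mfderiv_id (I := 𝓡 3) (x := x)))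

lemma derivTo_orbit (hψ : IsFlowOf ψ X) (t : ℝ) (x : N) :
    derivTo (fun s => ψ s x) t 1 = fieldVec X (ψ t x) := by
  have := (hψ.integral x t).mfderiv
  have h2 := congrArg (fun L : ℝ →L[ℝ] E3 => L 1) this
  refine h2.trans ?_
  exact one_smul ℝ (fieldVec X (ψ t x))

lemma mdifferentiableAt_orbit (hψ : IsFlowOf ψ X) (t : ℝ) (x : N) :
    MDifferentiableAt 𝓘(ℝ, ℝ) (𝓡 3) (fun s => ψ s x) t :=
  (hψ.integral x t).mdifferentiableAt

/-- Differentiate ψ_t ψ_s x = ψ_s ψ_t x in s at s = 0. -/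
lemma flowDeriv_field (hψ : IsFlowOf ψ X) (t : ℝ) (x : N) :
    flowDeriv ψ t x (fieldVec X x) = fieldVec X (ψ t x) := by
  have h1 := derivTo_flow_comp (hψ.mdifferentiableAt t _) (hψ.mdifferentiableAt_orbit 0 x) 1
  have h0 : (fun s => ψ t (ψ s x)) = fun s => ψ s (ψ t x) := by
    funext s
    rw [← ψ.map_add, add_comm, ψ.map_add]
  rw [h0, hψ.derivTo_orbit, hψ.derivTo_orbit, ψ.map_zero_apply, ψ.map_zero_apply] at h1
  exact h1.symm

lemma hasDerivAt_comp_orbit (hψ : IsFlowOf ψ X) {P : N → W} {t : ℝ} {x : N}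
    (hP : MDifferentiableAt (𝓡 3) 𝓘(ℝ, W) P (ψ t x)) :
    HasDerivAt (fun s => P (ψ s x)) (derivFrom P (ψ t x) (fieldVec X (ψ t x))) t := by
  have h1 : DifferentiableAt ℝ (fun s => P (ψ s x)) t :=
    (hP.comp t (hψ.mdifferentiableAt_orbit t x)).differentiableAt
  have h2 := fderiv_comp_derivTo (F := fun s => ψ s x) hP (hψ.mdifferentiableAt_orbit t x) 1
  rw [hψ.derivTo_orbit] at h2
  have h3 := h1.hasDerivAt
  rwa [← fderiv_apply_one_eq_deriv, h2] at h3

lemma continuous_uncurry (hψ : IsFlowOf ψ X) : Continuous (fun a : ℝ × N => ψ a.1 a.2) :=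
  hψ.smooth.continuous

end IsFlowOf

/-- The local expression of a flow in the preferred chart at `x`. -/
noncomputable def chartFlow (ψ : Flow ℝ N) (x : N) (a : ℝ × E3) : E3 :=
  extChartAt (𝓡 3) x (ψ a.1 ((extChartAt (𝓡 3) x).symm a.2))

variable [IsManifold (𝓡 3) ∞ N]

lemma contMDiffAt_extChartAt_symm (x : N) {u : E3} (hu : u ∈ (extChartAt (𝓡 3) x).target) :
    ContMDiffAt 𝓘(ℝ, E3) (𝓡 3) ∞ (extChartAt (𝓡 3) x).symm u :=
  (contMDiffOn_extChartAt_symm x).contMDiffAt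
    ((isOpen_extChartAt_target x).mem_nhds hu)

lemma derivFrom_extChartAt (x : N) (v : E3) : derivFrom (extChartAt (𝓡 3) x) x v = v := by
  have : IsManifold (𝓡 3) 1 N := IsManifold.of_le (n := ∞) (by simp)
  have := mfderiv_extChartAt_self (I := 𝓡 3) (x := x)
  exact congrArg (fun L : E3 →L[ℝ] E3 => L v) this

lemma derivTo_extChartAt_symm (x : N) (v : E3) :
    derivTo (extChartAt (𝓡 3) x).symm (extChartAt (𝓡 3) x x) v = v := by
  have : IsManifold (𝓡 3) 1 N := IsManifold.of_le (n := ∞) (by simp)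
  have := mfderivWithin_range_extChartAt_symm (I := 𝓡 3) (x := x)
  rw [(𝓡 3).range_eq_univ, mfderivWithin_univ] at this
  exact congrArg (fun L : E3 →L[ℝ] E3 => L v) this

namespace IsFlowOf

variable {ψ : Flow ℝ N} {X : VField N}

lemma contDiffAt_chartFlow (hψ : IsFlowOf ψ X) (x : N) {u : E3}
    (hu : u ∈ (extChartAt (𝓡 3) x).target) :
    ContDiffAt ℝ ∞ (chartFlow ψ x) (0, u) := by
  rw [← contMDiffAt_iff_contDiffAt]
  have h1 : ContMDiffAt 𝓘(ℝ, ℝ × E3) (𝓡 3) ∞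
      (fun a : ℝ × E3 => ψ a.1 ((extChartAt (𝓡 3) x).symm a.2)) (0, u) := by
    refine hψ.comp_contMDiffAt (contDiff_fst.contDiffAt.contMDiffAt) ?_
    exact (contMDiffAt_extChartAt_symm x hu).comp (0, u) contDiff_snd.contDiffAt.contMDiffAt
  refine ContMDiffAt.comp (0, u) ?_ h1
  have h2 : ψ 0 ((extChartAt (𝓡 3) x).symm u) ∈ (chartAt E3 x).source := by
    rw [ψ.map_zero_apply, ← extChartAt_source (𝓡 3)]
    exact (extChartAt (𝓡 3) x).map_target hu
  exact contMDiffAt_extChartAt' h2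

omit [IsManifold (𝓡 3) ∞ N] in
lemma chartFlow_zero (ψ : Flow ℝ N) (x : N) {u : E3} (hu : u ∈ (extChartAt (𝓡 3) x).target) :
    chartFlow ψ x (0, u) = u := by
  simp only [chartFlow]
  rw [ψ.map_zero_apply, (extChartAt (𝓡 3) x).right_inv hu]

lemma fderiv_chartFlow_space (hψ : IsFlowOf ψ X) (x : N) {u : E3}
    (hu : u ∈ (extChartAt (𝓡 3) x).target) (v : E3) :
    fderiv ℝ (chartFlow ψ x) (0, u) (0, v) = v := by
  have h1 : HasFDerivAt (fun w : E3 => ((0 : ℝ), w)) (ContinuousLinearMap.inr ℝ ℝ E3) u :=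
    hasFDerivAt_prodMk_right 0 u
  have h2 := ((hψ.contDiffAt_chartFlow x hu).differentiableAt (by simp)).hasFDerivAt.comp u h1
  have h3 : HasFDerivAt (chartFlow ψ x ∘ fun w : E3 => ((0 : ℝ), w))
      (ContinuousLinearMap.id ℝ E3) u := by
    refine (hasFDerivAt_id u).congr_of_eventuallyEq ?_
    filter_upwards [(isOpen_extChartAt_target x).mem_nhds hu] with w hw
    exact chartFlow_zero ψ x hw
  exact congrArg (fun L : E3 →L[ℝ] E3 => L v) (h2.unique h3)

lemma fderiv_chartFlow_time (hψ : IsFlowOf ψ X) (x : N) :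
    fderiv ℝ (chartFlow ψ x) (0, extChartAt (𝓡 3) x x) (1, 0) = fieldVec X x := by
  have hu := mem_extChartAt_target (I := 𝓡 3) x
  have h1 : HasFDerivAt (fun t : ℝ => (t, extChartAt (𝓡 3) x x)) (ContinuousLinearMap.inl ℝ ℝ E3) 0 :=
    hasFDerivAt_prodMk_left 0 _
  have h2 := ((hψ.contDiffAt_chartFlow x hu).differentiableAt (by simp)).hasFDerivAt.comp
    (0 : ℝ) h1
  have h3 : HasDerivAt (chartFlow ψ x ∘ fun t : ℝ => (t, extChartAt (𝓡 3) x x))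
      (derivFrom (extChartAt (𝓡 3) x) (ψ 0 x) (fieldVec X (ψ 0 x))) 0 := by
    have := hψ.hasDerivAt_comp_orbit (P := extChartAt (𝓡 3) x) (t := 0) (x := x) (by
      rw [ψ.map_zero_apply]
      exact contMDiffAt_extChartAt.mdifferentiableAt (n := ∞) (by simp))
    refine this.congr_of_eventuallyEq (Eventually.of_forall fun t => ?_)
    simp only [chartFlow, Function.comp_apply, extChartAt_to_inv]
  rw [ψ.map_zero_apply, derivFrom_extChartAt] at h3
  have h4 := h2.hasDerivAt.unique h3
  simpa using h4

end IsFlowOf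

end FlowCalculus

end ReebSection

namespace ReebSection

open Set Filter

/-! ### Complex eigenvalues of real endomorphisms and of their powers. -/

section Floquet

open TensorProduct

variable {K : Type*} [AddCommGroup K] [Module ℝ K]

/-- The real part `ℂ ⊗ K → K`. -/
noncomputable def tensorRe (K : Type*) [AddCommGroup K] [Module ℝ K] : ℂ ⊗[ℝ] K →ₗ[ℝ] K :=
  (TensorProduct.lid ℝ K).toLinearMap ∘ₗ LinearMap.rTensor K Complex.reLm

/-- The imaginary part `ℂ ⊗ K → K`. -/
noncomputable def tensorIm (K : Type*) [AddCommGroup K] [Module ℝ K] : ℂ ⊗[ℝ] K →ₗ[ℝ] K :=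
  (TensorProduct.lid ℝ K).toLinearMap ∘ₗ LinearMap.rTensor K Complex.imLm

@[simp] lemma tensorRe_tmul (c : ℂ) (w : K) : tensorRe K (c ⊗ₜ w) = c.re • w := by
  simp [tensorRe]

@[simp] lemma tensorIm_tmul (c : ℂ) (w : K) : tensorIm K (c ⊗ₜ w) = c.im • w := by
  simp [tensorIm]

/-- The complexification is K ⊕ iK: every element is 1 ⊗ Re + i ⊗ Im. -/
lemma tensor_eq_zero {y : ℂ ⊗[ℝ] K} (hr : tensorRe K y = 0) (hi : tensorIm K y = 0) : y = 0 := by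
  have key : y = (1 : ℂ) ⊗ₜ tensorRe K y + Complex.I ⊗ₜ tensorIm K y := by
    clear hr hi
    induction y with
    | zero => simp
    | tmul c w =>
      rw [tensorRe_tmul, tensorIm_tmul, ← TensorProduct.smul_tmul, ← TensorProduct.smul_tmul,
        ← TensorProduct.add_tmul]
      congr 1
      apply Complex.ext <;> simp
    | add a b ha hb =>
      nth_rw 1 [ha, hb]
      rw [map_add, map_add, TensorProduct.tmul_add, TensorProduct.tmul_add]
      abel
  rw [key, hr, hi, TensorProduct.tmul_zero, TensorProduct.tmul_zero, add_zero]

lemma tensorRe_smul (σ : ℂ) (y : ℂ ⊗[ℝ] K) :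
    tensorRe K (σ • y) = σ.re • tensorRe K y - σ.im • tensorIm K y := by
  induction y with
  | zero => simp
  | tmul c w => simp [TensorProduct.smul_tmul', sub_smul, mul_smul]
  | add a b ha hb => rw [smul_add, map_add, map_add, map_add, ha, hb]; module

lemma tensorIm_smul (σ : ℂ) (y : ℂ ⊗[ℝ] K) :
    tensorIm K (σ • y) = σ.im • tensorRe K y + σ.re • tensorIm K y := by
  induction y with
  | zero => simp
  | tmul c w => simp [TensorProduct.smul_tmul', add_smul, mul_smul]; abel
  | add a b ha hb => rw [smul_add, map_add, map_add, map_add, ha, hb]; module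

lemma tensorRe_baseChange (B : K →ₗ[ℝ] K) (y : ℂ ⊗[ℝ] K) :
    tensorRe K (B.baseChange ℂ y) = B (tensorRe K y) := by
  induction y with
  | zero => simp
  | tmul c w => simp
  | add a b ha hb => rw [map_add, map_add, map_add, map_add, ha, hb]

lemma tensorIm_baseChange (B : K →ₗ[ℝ] K) (y : ℂ ⊗[ℝ] K) :
    tensorIm K (B.baseChange ℂ y) = B (tensorIm K y) := by
  induction y with
  | zero => simp
  | tmul c w => simp
  | add a b ha hb => rw [map_add, map_add, map_add, map_add, ha, hb]

/-- If `μ` is an eigenvalue of the real endomorphism `B ^ k` then `B` has a complex eigenvalue `σ`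
with `σ ^ k = μ`. -/
lemma exists_complex_eigenvalue_of_pow [FiniteDimensional ℝ K] (B : K →ₗ[ℝ] K) {k : ℕ}
    (hk : 0 < k) {e : K} (he : e ≠ 0) {μ : ℝ} (hμ : (B ^ k) e = μ • e) :
    ∃ (σ : ℂ) (u v : K), (u ≠ 0 ∨ v ≠ 0) ∧ B u = σ.re • u - σ.im • v ∧
      B v = σ.im • u + σ.re • v ∧ σ ^ k = μ := by
  let BC : Module.End ℂ (ℂ ⊗[ℝ] K) := B.baseChange ℂ
  have hpow : ∀ n : ℕ, (BC ^ n) ((1 : ℂ) ⊗ₜ e) = (1 : ℂ) ⊗ₜ ((B ^ n) e) := by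
    intro n
    induction n with
    | zero => simp
    | succ n ih => rw [pow_succ', pow_succ', Module.End.mul_apply, ih]; simp [BC]
  have hne : (1 : ℂ) ⊗ₜ[ℝ] e ≠ 0 := fun h => he (by simpa using congrArg (tensorRe K) h)
  have hvec : Module.End.HasEigenvector (BC ^ k) (μ : ℂ) ((1 : ℂ) ⊗ₜ e) := by
    refine ⟨Module.End.mem_eigenspace_iff.2 ?_, hne⟩
    rw [hpow, hμ, ← TensorProduct.smul_tmul, TensorProduct.smul_tmul']
    simp
  have hspec := (Module.End.hasEigenvalue_of_hasEigenvector hvec).mem_spectrum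
  -- Spectral mapping over ℂ: an eigenvalue of the power is the power of an eigenvalue.
  rw [spectrum.map_pow_of_pos BC hk] at hspec
  obtain ⟨σ, hσ, hσk⟩ := hspec
  obtain ⟨y, hy⟩ := (Module.End.hasEigenvalue_iff_mem_spectrum.2 hσ).exists_hasEigenvector
  have hy1 : BC y = σ • y := hy.apply_eq_smul
  refine ⟨σ, tensorRe K y, tensorIm K y, ?_, ?_, ?_, hσk⟩
  · by_contra! h
    exact hy.2 (tensor_eq_zero h.1 h.2)
  · rw [← tensorRe_baseChange, ← tensorRe_smul]; exact congrArg _ hy1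
  · rw [← tensorIm_baseChange, ← tensorIm_smul]; exact congrArg _ hy1

/-- Let `A` preserve the linear form `φ` and fix a vector `x` with `φ x = 1`. If the class of a
vector `e` modulo `x` is an eigenvector of `A ^ k`, then the restriction of `A` to the kernel of `φ`
has a complex eigenvalue that is a `k`-th root of the corresponding eigenvalue. -/
lemma exists_complex_eigenvalue_on_ker {E : Type*} [AddCommGroup E] [Module ℝ E]
    [FiniteDimensional ℝ E] {A : E →ₗ[ℝ] E} {φ : E →ₗ[ℝ] ℝ} (hφ : ∀ v, φ (A v) = φ v) {x : E}
    (hx : A x = x) (hφx : φ x = 1) {k : ℕ} (hk : 0 < k) {e : E} {μ b : ℝ}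
    (he : (A ^ k) e = μ • e + b • x) (hex : ∀ c : ℝ, e ≠ c • x) :
    ∃ (σ : ℂ) (u v : E), φ u = 0 ∧ φ v = 0 ∧ (u ≠ 0 ∨ v ≠ 0) ∧ A u = σ.re • u - σ.im • v ∧
      A v = σ.im • u + σ.re • v ∧ σ ^ k = μ := by
  have hmem : ∀ v ∈ LinearMap.ker φ, A v ∈ LinearMap.ker φ := fun v hv => by
    rw [LinearMap.mem_ker] at hv ⊢; rw [hφ, hv]
  let B : LinearMap.ker φ →ₗ[ℝ] LinearMap.ker φ := A.restrict hmem
  have hB : ∀ (n : ℕ) (v : LinearMap.ker φ), (((B ^ n) v : LinearMap.ker φ) : E) = (A ^ n) v := by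
    intro n v
    induction n with
    | zero => simp
    | succ n ih => rw [pow_succ', pow_succ', Module.End.mul_apply, Module.End.mul_apply, ← ih]; rfl
  have hAx : ∀ n : ℕ, (A ^ n) x = x := by
    intro n
    induction n with
    | zero => simp
    | succ n ih => rw [pow_succ', Module.End.mul_apply, ih, hx]
  have hφn : ∀ (n : ℕ) (v : E), φ ((A ^ n) v) = φ v := by
    intro n v
    induction n with
    | zero => simp
    | succ n ih => rw [pow_succ', Module.End.mul_apply, hφ, ih]
  -- The representative of the class of `e` modulo `x` that lies in ker φ.
  let e' : LinearMap.ker φ := ⟨e - φ e • x, by simp [hφx]⟩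
  have he' : e' ≠ 0 := by
    intro h
    exact hex (φ e) (sub_eq_zero.1 (congrArg Subtype.val h))
  -- Invariance of φ determines `b`, and this makes `e'` an honest eigenvector.
  have hb : φ e = μ * φ e + b := by
    have := congrArg φ he
    simpa [hφn, hφx] using this
  have hpow : (B ^ k) e' = μ • e' := by
    apply Subtype.ext
    rw [hB]
    change (A ^ k) (e - φ e • x) = μ • (e - φ e • x)
    rw [map_sub, map_smul, hAx, he]
    nth_rw 1 [hb]
    module
  obtain ⟨σ, u, v, huv, hu, hv, hσ⟩ := exists_complex_eigenvalue_of_pow B hk he' hpow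
  refine ⟨σ, u, v, u.2, v.2, ?_, congrArg Subtype.val hu, congrArg Subtype.val hv, hσ⟩
  exact huv.imp (fun h h0 => h (Subtype.ext h0)) fun h h0 => h (Subtype.ext h0)

end Floquet

end ReebSection

namespace ReebSection

open Set Filter

/-! ### Invariance of the contact form under the Reeb flow. -/

section FormInvariance

variable {N : Type*} [TopologicalSpace N] [ChartedSpace E3 N] [IsManifold (𝓡 3) ∞ N]

/-- The value of a 1-form, as a linear form on the model space. -/
def formVec (lam : OneForm N) (x : N) : E3 →L[ℝ] ℝ := lam x

omit [IsManifold (𝓡 3) ∞ N] in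
lemma derivTo_comp_fderiv {W W' : Type*} [NormedAddCommGroup W] [NormedSpace ℝ W]
    [NormedAddCommGroup W'] [NormedSpace ℝ W'] {F : W' → N} {G : W → W'} {u : W}
    (hF : MDifferentiableAt 𝓘(ℝ, W') (𝓡 3) F (G u)) (hG : DifferentiableAt ℝ G u) (w : W) :
    derivTo (fun u => F (G u)) u w = derivTo F (G u) (fderiv ℝ G u w) := by
  have := mfderiv_comp u hF hG.mdifferentiableAt
  rw [mfderiv_eq_fderiv] at this
  exact congrArg (fun L : W →L[ℝ] E3 => L w) this

omit [IsManifold (𝓡 3) ∞ N] in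
lemma derivTo_congr {W : Type*} [NormedAddCommGroup W] [NormedSpace ℝ W] {F G : W → N} {u : W}
    (h : F =ᶠ[𝓝 u] G) : derivTo F u = derivTo G u := h.mfderiv_eq

lemma contDiffOn_inChart {lam : OneForm N} (hlam : SmoothOneForm lam) (x : N) :
    ContDiffOn ℝ ∞ (lam.inChart x : E3 → E3 →L[ℝ] ℝ) (extChartAt (𝓡 3) x).target := by
  rw [contDiffOn_clm_apply]
  intro w u₀ hu₀
  have hT : IsOpen (extChartAt (𝓡 3) x).target := isOpen_extChartAt_target x
  have : IsManifold (𝓡 3) 1 N := IsManifold.of_le (n := ∞) (by simp)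
  have h1 := (contMDiffOn_extChartAt_symm (n := ∞) (I := 𝓡 3) x).contMDiffOn_tangentMapWithin
    (m := ∞) (by simp) hT.uniqueMDiffOn
  have h2 : ContMDiffAt 𝓘(ℝ, E3) 𝓘(ℝ, E3).tangent ∞
      (fun u : E3 => (⟨u, w⟩ : TangentBundle 𝓘(ℝ, E3) E3)) u₀ :=
    contMDiffAt_vectorSpace_iff_contDiffAt.2 contDiffAt_const
  have h3 : ContMDiffAt 𝓘(ℝ, E3) (𝓡 3).tangent ∞
      (fun u : E3 => tangentMapWithin 𝓘(ℝ, E3) (𝓡 3) (extChartAt (𝓡 3) x).symm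
        (extChartAt (𝓡 3) x).target (⟨u, w⟩ : TangentBundle 𝓘(ℝ, E3) E3)) u₀ := by
    refine ContMDiffAt.comp u₀ (h1.contMDiffAt ?_) h2
    exact (hT.preimage (FiberBundle.continuous_proj E3 (TangentSpace 𝓘(ℝ, E3)))).mem_nhds hu₀
  refine ContDiffAt.contDiffWithinAt ?_
  rw [← contMDiffAt_iff_contDiffAt]
  refine (hlam.contMDiffAt.comp _ h3).congr_of_eventuallyEq ?_
  filter_upwards [hT.mem_nhds hu₀] with u hu
  simp only [OneForm.inChart, Function.comp_apply, tangentMapWithin]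
  rw [mfderivWithin_of_isOpen hT hu]
  rfl

omit [IsManifold (𝓡 3) ∞ N] in
lemma inChart_apply (lam : OneForm N) (x : N) (u w : E3) :
    lam.inChart x u w =
      formVec lam ((extChartAt (𝓡 3) x).symm u) (derivTo (extChartAt (𝓡 3) x).symm u w) := rfl

namespace IsFlowOf

variable {ψ : Flow ℝ N} {X : VField N} {lam : OneForm N}

/-- λ(X) = 1 read in one fixed chart; holding on the whole chart target, it can be differentiated in
u. -/
lemma inChart_chartFlow_time (hψ : IsFlowOf ψ X) (hX : IsReebField lam X) (x : N) {u : E3}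
    (hu : u ∈ (extChartAt (𝓡 3) x).target) :
    lam.inChart x u (fderiv ℝ (chartFlow ψ x) (0, u) (1, 0)) = 1 := by
  set φ := extChartAt (𝓡 3) x
  have hθ := (hψ.contDiffAt_chartFlow x hu).differentiableAt (by simp)
  have h1 : HasFDerivAt (fun t : ℝ => (t, u)) (ContinuousLinearMap.inl ℝ ℝ E3) 0 :=
    hasFDerivAt_prodMk_left 0 u
  have h2 := hθ.hasFDerivAt.comp (0 : ℝ) h1
  have hs : MDifferentiableAt 𝓘(ℝ, E3) (𝓡 3) φ.symm (chartFlow ψ x (0, u)) := by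
    rw [chartFlow_zero ψ x hu]
    exact (contMDiffAt_extChartAt_symm x hu).mdifferentiableAt (by simp)
  have h3 := derivTo_comp_fderiv (G := fun t : ℝ => chartFlow ψ x (t, u)) (u := 0) hs
    h2.differentiableAt 1
  have h4 : (fun t : ℝ => φ.symm (chartFlow ψ x (t, u))) =ᶠ[𝓝 0] fun t => ψ t (φ.symm u) := by
    have hc : Continuous fun t : ℝ => ψ t (φ.symm u) :=
      ψ.continuous continuous_id continuous_const
    have : ∀ᶠ t in 𝓝 (0 : ℝ), ψ t (φ.symm u) ∈ φ.source := by
      refine hc.continuousAt.eventually_mem ((isOpen_extChartAt_source x).mem_nhds ?_)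
      rw [ψ.map_zero_apply]
      exact φ.map_target hu
    filter_upwards [this] with t ht
    exact φ.left_inv ht
  rw [derivTo_congr h4, hψ.derivTo_orbit, ψ.map_zero_apply] at h3
  have h5 : fderiv ℝ (fun t : ℝ => chartFlow ψ x (t, u)) 0 1 =
      fderiv ℝ (chartFlow ψ x) (0, u) (1, 0) := by
    have := congrArg (fun L : ℝ →L[ℝ] E3 => L 1) h2.fderiv
    simpa [Function.comp_def] using this
  rw [h5, chartFlow_zero ψ x hu] at h3
  rw [inChart_apply, ← h3]
  exact hX.apply_self _

lemma formVec_flowDeriv_eq_inChart (hψ : IsFlowOf ψ X) (x : N) (v : E3) :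
    ∀ᶠ s in 𝓝 (0 : ℝ), formVec lam (ψ s x) (flowDeriv ψ s x v) =
      lam.inChart x (chartFlow ψ x (s, extChartAt (𝓡 3) x x))
        (fderiv ℝ (chartFlow ψ x) (s, extChartAt (𝓡 3) x x) (0, v)) := by
  set φ := extChartAt (𝓡 3) x with hφ
  have hu := mem_extChartAt_target (I := 𝓡 3) x
  have hc : Continuous fun t : ℝ => ψ t x := ψ.continuous continuous_id continuous_const
  have e1 : ∀ᶠ s in 𝓝 (0 : ℝ), ψ s x ∈ φ.source := by
    refine hc.continuousAt.eventually_mem ((isOpen_extChartAt_source x).mem_nhds ?_)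
    rw [ψ.map_zero_apply]
    exact mem_extChartAt_source x
  have e2 : ∀ᶠ s in 𝓝 (0 : ℝ), DifferentiableAt ℝ (chartFlow ψ x) (s, φ x) := by
    have h1 : ContDiffAt ℝ 1 (chartFlow ψ x) (0, φ x) :=
      mod_cast contDiffAt_infty.1 (hψ.contDiffAt_chartFlow x hu) 1
    have h2 : Tendsto (fun s : ℝ => (s, φ x)) (𝓝 0) (𝓝 (0, φ x)) := by
      exact (Continuous.prodMk_left (φ x)).tendsto 0
    exact h2.eventually ((h1.eventually (by simp)).mono fun a ha => ha.differentiableAt (by simp))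
  filter_upwards [e1, e2] with s h1 h2
  have hG : HasFDerivAt (fun u : E3 => chartFlow ψ x (s, u))
      ((fderiv ℝ (chartFlow ψ x) (s, φ x)).comp (ContinuousLinearMap.inr ℝ ℝ E3)) (φ x) :=
    h2.hasFDerivAt.comp (φ x) (hasFDerivAt_prodMk_right s (φ x))
  have h0 : φ.symm (φ x) = x := extChartAt_to_inv x
  have hval : chartFlow ψ x (s, φ x) = φ (ψ s x) := by simp only [chartFlow, ← hφ, h0]
  have ht : chartFlow ψ x (s, φ x) ∈ φ.target := by rw [hval]; exact φ.map_source h1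
  have h3 := derivTo_comp_fderiv (u := φ x)
    ((contMDiffAt_extChartAt_symm x ht).mdifferentiableAt (by simp)) hG.differentiableAt v
  have h4 : (fun u : E3 => φ.symm (chartFlow ψ x (s, u))) =ᶠ[𝓝 (φ x)]
      fun u => ψ s (φ.symm u) := by
    have hcont : ContinuousAt (fun u : E3 => ψ s (φ.symm u)) (φ x) :=
      ContinuousAt.comp (g := fun y => ψ s y) (hψ.contMDiffAt s _).continuousAt
        (contMDiffAt_extChartAt_symm x hu).continuousAt
    have : ∀ᶠ u in 𝓝 (φ x), ψ s (φ.symm u) ∈ φ.source :=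
      hcont.eventually_mem ((isOpen_extChartAt_source x).mem_nhds (by rw [h0]; exact h1))
    filter_upwards [this] with u hu
    exact φ.left_inv hu
  rw [derivTo_congr h4, derivTo_flow_comp (hψ.mdifferentiableAt s _)
    ((contMDiffAt_extChartAt_symm x hu).mdifferentiableAt (by simp)),
    derivTo_extChartAt_symm, h0, hG.fderiv] at h3
  rw [inChart_apply, h3]
  congr 2
  rw [hval]
  exact (φ.left_inv h1).symm

/-- Cartan's formula L_X λ = d(λ(X)) + i_X dλ in coordinates: the first term vanishes because λ(X)
is constant, the second by the Reeb condition. -/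
lemma hasDerivAt_formVec_flowDeriv_zero (hψ : IsFlowOf ψ X) (hlam : SmoothOneForm lam)
    (hX : IsReebField lam X) (x : N) (v : E3) :
    HasDerivAt (fun s => formVec lam (ψ s x) (flowDeriv ψ s x v)) 0 0 := by
  refine HasDerivAt.congr_of_eventuallyEq ?_ (hψ.formVec_flowDeriv_eq_inChart x v)
  set u := extChartAt (𝓡 3) x x with hu0
  have hu : u ∈ (extChartAt (𝓡 3) x).target := mem_extChartAt_target (I := 𝓡 3) x
  set θ := chartFlow ψ x with hθ
  have hθs : ContDiffAt ℝ 2 θ (0, u) :=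
    mod_cast contDiffAt_infty.1 (hψ.contDiffAt_chartFlow x hu) 2
  have hL : HasFDerivAt (lam.inChart x : E3 → E3 →L[ℝ] ℝ) (fderiv ℝ (lam.inChart x) u) u :=
    (((contDiffOn_inChart hlam x).contDiffAt ((isOpen_extChartAt_target x).mem_nhds hu)).differentiableAt
      (by simp)).hasFDerivAt
  have hD : HasFDerivAt (fderiv ℝ θ) (fderiv ℝ (fderiv ℝ θ) (0, u)) (0, u) :=
    ((hθs.fderiv_right (m := 1) (by norm_num)).differentiableAt (by simp)).hasFDerivAt
  have h1 : HasFDerivAt (fun t : ℝ => (t, u)) (ContinuousLinearMap.inl ℝ ℝ E3) 0 :=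
    hasFDerivAt_prodMk_left 0 u
  have h2 : HasFDerivAt (fun w : E3 => ((0 : ℝ), w)) (ContinuousLinearMap.inr ℝ ℝ E3) u :=
    hasFDerivAt_prodMk_right 0 u
  have hθ0 : θ (0, u) = u := chartFlow_zero ψ x hu
  have hXu : fderiv ℝ θ (0, u) (1, 0) = fieldVec X x := hψ.fderiv_chartFlow_time x
  have hV : fderiv ℝ θ (0, u) (0, v) = v := hψ.fderiv_chartFlow_space x hu v
  -- The time derivative of D_v ψ_s at s = 0 is the derivative of X in the direction v.
  have hsym := hθs.isSymmSndFDerivAt (by simp) (1, 0) (0, v)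
  have hA : HasDerivAt (fun s : ℝ => lam.inChart x (θ (s, u)))
      (fderiv ℝ (lam.inChart x) u (fieldVec X x)) 0 := by
    have h3 := ((hθs.differentiableAt (by simp)).hasFDerivAt.comp (0 : ℝ) h1).hasDerivAt
    rw [← hθ0] at hL
    have h4 := hL.comp_hasDerivAt (0 : ℝ) h3
    rw [hθ0] at h4
    simpa [hXu, Function.comp_def] using! h4
  have hB : HasDerivAt (fun s : ℝ => fderiv ℝ θ (s, u) (0, v))
      (fderiv ℝ (fderiv ℝ θ) (0, u) (1, 0) (0, v)) 0 := by
    have h3 := (hD.comp (0 : ℝ) h1).hasDerivAt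
    have h4 := h3.clm_apply (hasDerivAt_const (0 : ℝ) ((0, v) : ℝ × E3))
    simpa using h4
  -- Differentiating λ(X) = 1 along v trades λ(D_v X) for −(D_v λ)(X), which leaves dλ(X, v).
  have hC : HasFDerivAt (fun w : E3 => lam.inChart x w (fderiv ℝ θ (0, w) (1, 0)))
      (0 : E3 →L[ℝ] ℝ) u := by
    refine (hasFDerivAt_const (1 : ℝ) u).congr_of_eventuallyEq ?_
    filter_upwards [(isOpen_extChartAt_target x).mem_nhds hu] with w hw
    exact hψ.inChart_chartFlow_time hX x hw
  have hC' := (hL.clm_apply ((hD.comp u h2).clm_apply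
    (hasFDerivAt_const ((1, 0) : ℝ × E3) u))).unique hC
  have hC'' := congrArg (fun L : E3 →L[ℝ] ℝ => L v) hC'
  have hdX : fderiv ℝ (lam.inChart x) u (fieldVec X x) v -
      fderiv ℝ (lam.inChart x) u v (fieldVec X x) = 0 := hX.d_apply x v
  have hfin := hA.clm_apply hB
  convert! hfin using 1
  simp [hXu] at hC''
  rw [hθ0, hV, hsym]
  linarith

/-- The Reeb flow preserves the contact form. -/
theorem formVec_flowDeriv (hψ : IsFlowOf ψ X) (hlam : SmoothOneForm lam)
    (hX : IsReebField lam X) (t : ℝ) (x : N) (v : E3) :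
    formVec lam (ψ t x) (flowDeriv ψ t x v) = formVec lam x v := by
  -- The group law reduces time t to time 0 at the point ψ_t x with the transported vector.
  have key : ∀ t, HasDerivAt (fun s => formVec lam (ψ s x) (flowDeriv ψ s x v)) 0 t := by
    intro t
    have h1 := hψ.hasDerivAt_formVec_flowDeriv_zero hlam hX (ψ t x) (flowDeriv ψ t x v)
    have h2 : HasDerivAt (fun s => formVec lam (ψ (s - t) (ψ t x))
        (flowDeriv ψ (s - t) (ψ t x) (flowDeriv ψ t x v))) 0 t :=
      HasDerivAt.comp_sub_const (f := fun s => formVec lam (ψ s (ψ t x))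
        (flowDeriv ψ s (ψ t x) (flowDeriv ψ t x v))) t t (by rw [sub_self]; exact h1)
    refine h2.congr_of_eventuallyEq (Eventually.of_forall fun s => ?_)
    simp only
    rw [← ψ.map_add, ← hψ.flowDeriv_add, sub_add_cancel]
  have hconst := is_const_of_deriv_eq_zero (fun t => (key t).differentiableAt)
    (fun t => (key t).deriv) t 0
  simpa [flowDeriv_zero, ψ.map_zero_apply] using hconst

end IsFlowOf

end FormInvariance

end ReebSection

namespace ReebSection

open Set Filter

/-! ### Flow boxes. -/

section FlowBox

variable {N : Type*} [TopologicalSpace N] [ChartedSpace E3 N]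

/-- A flow box at `x`: coordinates near `x` in which the flow is a translation in time. -/
structure FlowBox (X : VField N) (ψ : Flow ℝ N) (x : N) where
  /-- The projection along the flow lines. -/
  proj : N → ℝ × ℝ
  /-- The time coordinate. -/
  time : N → ℝ
  /-- The parametrization of the transverse disk where the time vanishes. -/
  sec : ℝ × ℝ → N
  smooth_proj : ContMDiffAt (𝓡 3) 𝓘(ℝ, ℝ × ℝ) ∞ proj x
  smooth_time : ContMDiffAt (𝓡 3) 𝓘(ℝ, ℝ) ∞ time x
  proj_self : proj x = 0
  time_self : time x = 0
  left_inv : ∀ᶠ y in 𝓝 x, ψ (time y) (sec (proj y)) = y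
  right_inv : ∀ᶠ a : ℝ × ℝ × ℝ in 𝓝 0,
    time (ψ a.1 (sec a.2)) = a.1 ∧ proj (ψ a.1 (sec a.2)) = a.2
  ker : ∀ v, derivFrom proj x v = 0 → ∃ a : ℝ, v = a • fieldVec X x

lemma derivFrom_comp_fderiv {W W' : Type*} [NormedAddCommGroup W] [NormedSpace ℝ W]
    [NormedAddCommGroup W'] [NormedSpace ℝ W'] {F : W → W'} {G : N → W} {x : N}
    (hF : DifferentiableAt ℝ F (G x)) (hG : MDifferentiableAt (𝓡 3) 𝓘(ℝ, W) G x) (v : E3) :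
    derivFrom (fun y => F (G y)) x v = fderiv ℝ F (G x) (derivFrom G x v) := by
  have := mfderiv_comp x hF.mdifferentiableAt hG
  rw [mfderiv_eq_fderiv] at this
  exact congrArg (fun L : E3 →L[ℝ] W' => L v) this

lemma derivFrom_congr {W : Type*} [NormedAddCommGroup W] [NormedSpace ℝ W] {F G : N → W} {x : N}
    (h : F =ᶠ[𝓝 x] G) : derivFrom F x = derivFrom G x := h.mfderiv_eq

lemma exists_adapted_equiv {v : E3} (hv : v ≠ 0) :
    ∃ M : (ℝ × ℝ × ℝ) ≃L[ℝ] E3, M (1, 0) = v := by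
  let M₀ : (ℝ × ℝ × ℝ) ≃L[ℝ] E3 := ContinuousLinearEquiv.ofFinrankEq (by simp)
  obtain ⟨A, hA⟩ := SeparatingDual.exists_continuousLinearEquiv_apply_eq (R := ℝ)
    (x := M₀ (1, 0)) (y := v) (by simp) hv
  exact ⟨M₀.trans A, hA⟩

/-- Flow a small disk transverse to X. In the chart the resulting map has derivative `M` at 0, where
`M` sends the time direction to X; its local inverse gives time and projection. -/
theorem exists_flowBox [IsManifold (𝓡 3) ∞ N] {X : VField N} {ψ : Flow ℝ N} (hψ : IsFlowOf ψ X)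
    {x : N} (hx : fieldVec X x ≠ 0) : Nonempty (FlowBox X ψ x) := by
  obtain ⟨M, hM⟩ := exists_adapted_equiv hx
  set φ := extChartAt (𝓡 3) x with hφ
  set u₀ := φ x with hu₀
  have hu : u₀ ∈ φ.target := mem_extChartAt_target (I := 𝓡 3) x
  have hφu : φ.symm u₀ = x := extChartAt_to_inv x
  let ι : ℝ × ℝ × ℝ → ℝ × E3 := fun a => (a.1, u₀ + M (0, a.2))
  let ι' : ℝ × ℝ × ℝ →L[ℝ] ℝ × E3 := (ContinuousLinearMap.fst ℝ ℝ (ℝ × ℝ)).prod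
    ((M : (ℝ × ℝ × ℝ) →L[ℝ] E3).comp ((0 : ℝ × ℝ × ℝ →L[ℝ] ℝ).prod
      (ContinuousLinearMap.snd ℝ ℝ (ℝ × ℝ))))
  have hι0 : ι 0 = (0, u₀) := by simp [ι]
  have hι : ContDiff ℝ ∞ ι :=
    contDiff_fst.prodMk (contDiff_const.add (M.contDiff.comp (contDiff_const.prodMk contDiff_snd)))
  have hι' : HasFDerivAt ι ι' 0 := by
    have h : ι = fun a => (0, u₀) + ι' a := by
      funext a
      simp [ι, ι']
    rw [h]
    exact ι'.hasFDerivAt.const_add _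
  have hΘ : ContDiffAt ℝ ∞ (fun a => chartFlow ψ x (ι a)) 0 := by
    refine ContDiffAt.comp (g := chartFlow ψ x) 0 ?_ hι.contDiffAt
    rw [hι0]; exact hψ.contDiffAt_chartFlow x hu
  have hΘ' : HasFDerivAt (fun a => chartFlow ψ x (ι a)) (M : (ℝ × ℝ × ℝ) →L[ℝ] E3) 0 := by
    have h1 : HasFDerivAt (chartFlow ψ x) (fderiv ℝ (chartFlow ψ x) (0, u₀)) (ι 0) := by
      rw [hι0]
      exact ((hψ.contDiffAt_chartFlow x hu).differentiableAt (by simp)).hasFDerivAt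
    have h2 := h1.comp 0 hι'
    convert! h2 using 1
    refine ContinuousLinearMap.ext fun a => ?_
    have h3 : ι' a = a.1 • ((1 : ℝ), (0 : E3)) + (0, M (0, a.2)) := by simp [ι']
    have h4 : a = a.1 • ((1 : ℝ), (0 : ℝ × ℝ)) + (0, a.2) := by simp
    rw [ContinuousLinearMap.comp_apply, h3, map_add, map_smul, hψ.fderiv_chartFlow_time,
      hψ.fderiv_chartFlow_space x hu, ← hM, ← map_smul]
    change M a = _
    nth_rw 1 [h4]
    rw [map_add]
  let Ψ := hΘ.toOpenPartialHomeomorph _ hΘ' (by simp)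
  have hΨ : ∀ a, Ψ a = chartFlow ψ x (ι a) := fun a => rfl
  have hΨs : (0 : ℝ × ℝ × ℝ) ∈ Ψ.source := hΘ.mem_toOpenPartialHomeomorph_source hΘ' (by simp)
  have hΨ0 : Ψ 0 = u₀ := by rw [hΨ, hι0, IsFlowOf.chartFlow_zero ψ x hu]
  have hΨt : u₀ ∈ Ψ.target := hΨ0 ▸ Ψ.map_source hΨs
  have hsymm0 : Ψ.symm u₀ = 0 := by rw [← hΨ0, Ψ.left_inv hΨs]
  have hsymmD : HasFDerivAt Ψ.symm (M.symm : E3 →L[ℝ] ℝ × ℝ × ℝ) u₀ :=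
    Ψ.hasFDerivAt_symm hΨt (by rw [hsymm0]; exact hΘ')
  have hsymmC : ContDiffAt ℝ ∞ Ψ.symm u₀ :=
    Ψ.contDiffAt_symm hΨt (by rw [hsymm0]; exact hΘ') (by rw [hsymm0]; exact hΘ)
  have hφC : ContMDiffAt (𝓡 3) 𝓘(ℝ, E3) ∞ φ x := contMDiffAt_extChartAt
  have hcomp : ContMDiffAt (𝓡 3) 𝓘(ℝ, ℝ × ℝ × ℝ) ∞ (fun y => Ψ.symm (φ y)) x :=
    ContDiffAt.comp_contMDiffAt (g := Ψ.symm) hsymmC hφC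
  have hsec : ContinuousAt (fun v : ℝ × ℝ => φ.symm (u₀ + M (0, v))) 0 := by
    have h1 : ContinuousAt φ.symm (u₀ + M (0, (0 : ℝ × ℝ))) := by
      rw [← Prod.zero_eq_mk, map_zero, add_zero]
      exact (contMDiffAt_extChartAt_symm x hu).continuousAt
    exact ContinuousAt.comp (f := fun v : ℝ × ℝ => u₀ + M (0, v)) h1
      (Continuous.continuousAt (by fun_prop))
  have hsec0 : φ.symm (u₀ + M (0, (0 : ℝ × ℝ))) = x := by
    rw [← Prod.zero_eq_mk, map_zero, add_zero, hφu]
  refine ⟨{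
    proj := fun y => (Ψ.symm (φ y)).2
    time := fun y => (Ψ.symm (φ y)).1
    sec := fun v => φ.symm (u₀ + M (0, v))
    smooth_proj := ContDiffAt.comp_contMDiffAt contDiff_snd.contDiffAt hcomp
    smooth_time := ContDiffAt.comp_contMDiffAt contDiff_fst.contDiffAt hcomp
    proj_self := by rw [← hu₀, hsymm0]; rfl
    time_self := by rw [← hu₀, hsymm0]; rfl
    left_inv := ?_
    right_inv := ?_
    ker := ?_ }⟩
  · have e1 : ∀ᶠ y in 𝓝 x, y ∈ φ.source := extChartAt_source_mem_nhds x
    have e2 : ∀ᶠ y in 𝓝 x, φ y ∈ Ψ.target :=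
      hφC.continuousAt.eventually_mem (Ψ.open_target.mem_nhds hΨt)
    -- The chart is injective only on its source, so the reconstructed point must lie there before
    -- equal coordinates give equal points.
    have e3 : ∀ᶠ y in 𝓝 x,
        ψ (Ψ.symm (φ y)).1 (φ.symm (u₀ + M (0, (Ψ.symm (φ y)).2))) ∈ φ.source := by
      have h1 : Tendsto (fun y => Ψ.symm (φ y)) (𝓝 x) (𝓝 0) := by
        have := hcomp.continuousAt
        rwa [ContinuousAt, ← hu₀, hsymm0] at this
      have h2 : Tendsto (fun a : ℝ × ℝ × ℝ => ψ a.1 (φ.symm (u₀ + M (0, a.2)))) (𝓝 0)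
          (𝓝 x) := by
        have h3 : Tendsto (fun a : ℝ × ℝ × ℝ => (a.1, φ.symm (u₀ + M (0, a.2)))) (𝓝 0)
            (𝓝 (0, x)) := by
          refine Tendsto.prodMk_nhds (continuous_fst.tendsto' 0 0 rfl) ?_
          rw [ContinuousAt, hsec0] at hsec
          exact hsec.comp (continuous_snd.tendsto' (0 : ℝ × ℝ × ℝ) 0 rfl)
        have h4 := hψ.continuous_uncurry.tendsto (0, x)
        simp only [ψ.map_zero_apply] at h4
        exact h4.comp h3
      exact (h2.comp h1).eventually (extChartAt_source_mem_nhds (I := 𝓡 3) x)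
    filter_upwards [e1, e2, e3] with y h1 h2 h3
    have h4 := Ψ.right_inv h2
    rw [hΨ] at h4
    exact φ.injOn h3 h1 h4
  · filter_upwards [Ψ.open_source.mem_nhds hΨs] with a ha
    have h1 : Ψ.symm (φ (ψ a.1 (φ.symm (u₀ + M (0, a.2))))) = a := Ψ.left_inv ha
    rw [h1]
    exact ⟨rfl, rfl⟩
  · intro v hv
    have h1 := derivFrom_comp_fderiv (F := fun w => (Ψ.symm w).2) (G := φ) (x := x)
      (contDiff_snd.contDiffAt.comp _ hsymmC |>.differentiableAt (by simp))
      (hφC.mdifferentiableAt (by simp)) v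
    rw [hv, derivFrom_extChartAt, ← hu₀, (HasFDerivAt.snd hsymmD).fderiv] at h1
    refine ⟨(M.symm v).1, ?_⟩
    have h2 : M.symm v = (M.symm v).1 • ((1 : ℝ), (0 : ℝ × ℝ)) := by
      ext1
      · simp
      · simpa using h1.symm
    rw [← hM, ← map_smul, ← h2, M.apply_symm_apply]

namespace FlowBox

variable {X : VField N} {ψ : Flow ℝ N} {x : N} (b : FlowBox X ψ x)

lemma tendsto_proj : Tendsto b.proj (𝓝 x) (𝓝 0) := by
  have := b.smooth_proj.continuousAt
  rwa [ContinuousAt, b.proj_self] at this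

lemma tendsto_time : Tendsto b.time (𝓝 x) (𝓝 0) := by
  have := b.smooth_time.continuousAt
  rwa [ContinuousAt, b.time_self] at this

/-- Write the point as ψ_time(sec(proj)); flowing further only adds to the time, and box coordinates
are unique. -/
lemma eventually_flow : ∀ᶠ a : ℝ × N in 𝓝 (0, x),
    b.proj (ψ a.1 a.2) = b.proj a.2 ∧ b.time (ψ a.1 a.2) = a.1 + b.time a.2 := by
  have h2 : Tendsto (fun a : ℝ × N => a.2) (𝓝 (0, x)) (𝓝 x) := continuous_snd.tendsto' _ _ rfl
  have h1 : Tendsto (fun a : ℝ × N => (a.1 + b.time a.2, b.proj a.2)) (𝓝 (0, x)) (𝓝 0) := by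
    refine Tendsto.prodMk_nhds ?_ (b.tendsto_proj.comp h2)
    have h3 : Tendsto (fun a : ℝ × N => a.1) (𝓝 (0, x)) (𝓝 0) := continuous_fst.tendsto' _ _ rfl
    simpa using! h3.add (b.tendsto_time.comp h2)
  filter_upwards [h1.eventually b.right_inv, h2.eventually b.left_inv] with a ha hb
  simp only [ψ.map_add, hb] at ha
  exact ha.symm

lemma eventually_eq_flow : ∀ᶠ a : N × N in 𝓝 (x, x),
    b.proj a.1 = b.proj a.2 → ψ (b.time a.2 - b.time a.1) a.1 = a.2 := by
  have h1 : Tendsto (fun a : N × N => a.1) (𝓝 (x, x)) (𝓝 x) := continuous_fst.tendsto' _ _ rfl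
  have h2 : Tendsto (fun a : N × N => a.2) (𝓝 (x, x)) (𝓝 x) := continuous_snd.tendsto' _ _ rfl
  filter_upwards [h1.eventually b.left_inv, h2.eventually b.left_inv] with a ha hb hab
  nth_rw 2 [← ha]
  rw [← ψ.map_add, sub_add_cancel, hab, hb]

lemma eventually_proj_flow : ∀ᶠ s in 𝓝 (0 : ℝ), b.proj (ψ s x) = 0 ∧ b.time (ψ s x) = s := by
  have h1 : Tendsto (fun s : ℝ => (s, x)) (𝓝 0) (𝓝 (0, x)) :=
    (Continuous.prodMk_left x).tendsto 0
  filter_upwards [h1.eventually b.eventually_flow] with s hs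
  rwa [b.proj_self, b.time_self, add_zero] at hs

end FlowBox

end FlowBox

end ReebSection

namespace ReebSection

open Set Filter

/-! ### Charts of the surface at boundary and interior points. -/

section SurfaceChart

/-- The coordinates of the plane. -/
noncomputable def planeCoord : E2 ≃L[ℝ] ℝ × ℝ :=
  (EuclideanSpace.equiv (Fin 2) ℝ).trans (ContinuousLinearEquiv.finTwoArrow ℝ ℝ)

lemma planeCoord_apply (u : E2) : planeCoord u = (u 0, u 1) := rfl

variable {N : Type*} [TopologicalSpace N] [ChartedSpace E3 N]
variable {S : Type*} [TopologicalSpace S] [ChartedSpace (EuclideanHalfSpace 2) S]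

/-- The derivative of a map from a surface to a normed space. -/
noncomputable def surfDerivFrom {W : Type*} [NormedAddCommGroup W] [NormedSpace ℝ W] (g : S → W)
    (p : S) : E2 →L[ℝ] W := mfderiv (𝓡∂ 2) 𝓘(ℝ, W) g p

/-- A chart of the surface near `p`, with values in a half plane, together with an extension
of `f` across the boundary. -/
structure SurfaceChart (f : S → N) (p : S) where
  /-- The chart. -/
  coord : S → ℝ × ℝ
  /-- The inverse of the chart. -/
  coordInv : ℝ × ℝ → S
  /-- The extension of `f`. -/
  ext : ℝ × ℝ → N
  /-- The domain of the chart. -/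
  source : Set S
  isOpen_source : IsOpen source
  mem_source : p ∈ source
  smooth_coord : ContMDiffOn (𝓡∂ 2) 𝓘(ℝ, ℝ × ℝ) ∞ coord source
  smooth_ext : ∀ᶠ u in 𝓝 (coord p), ContMDiffAt 𝓘(ℝ, ℝ × ℝ) (𝓡 3) ∞ ext u
  eq_ext : ∀ q ∈ source, f q = ext (coord q)
  left_inv : ∀ q ∈ source, coordInv (coord q) = q
  tendsto_coordInv : Tendsto coordInv (𝓝[{u | 0 ≤ u.1}] coord p) (𝓝 p)
  right_inv : ∀ᶠ u in 𝓝[{u | 0 ≤ u.1}] coord p, coord (coordInv u) = u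
  interior_iff : ∀ q ∈ source, q ∈ (𝓡∂ 2).interior S ↔ 0 < (coord q).1
  nonneg : ∀ q ∈ source, 0 ≤ (coord q).1
  snd_eq_zero : (coord p).2 = 0
  ext_injective : ∀ w, derivTo ext (coord p) w = 0 → w = 0
  coord_injective : ∀ w, surfDerivFrom coord p w = 0 → w = 0

variable [IsManifold (𝓡∂ 2) ∞ S]

omit [IsManifold (𝓡∂ 2) ∞ S] in
-- Local diffeomorphisms preserve interior points, so any chart of the maximal atlas may be used to
-- detect them, in particular the one supplied by the immersion.
lemma isInteriorPoint_iff_of_mem_maximalAtlas {e : OpenPartialHomeomorph S (EuclideanHalfSpace 2)}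
    (he : e ∈ IsManifold.maximalAtlas (𝓡∂ 2) ∞ S) {q : S} (hq : q ∈ e.source) :
    q ∈ (𝓡∂ 2).interior S ↔ 0 < (e.extend (𝓡∂ 2) q) 0 := by
  let Φ : PartialDiffeomorph (𝓡∂ 2) (𝓡∂ 2) S (EuclideanHalfSpace 2) ∞ :=
    { toPartialEquiv := e.toPartialEquiv
      open_source := e.open_source
      open_target := e.open_target
      contMDiffOn_toFun := contMDiffOn_of_mem_maximalAtlas he
      contMDiffOn_invFun := contMDiffOn_symm_of_mem_maximalAtlas he }
  have h0 : IsLocalDiffeomorphAt (𝓡∂ 2) (𝓡∂ 2) ∞ e q := ⟨Φ, hq, fun _ _ => rfl⟩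
  have h1 := h0.isInteriorPoint_iff (by simp)
  refine h1.trans ?_
  have h2 : (𝓡∂ 2).IsInteriorPoint (e q) ↔ (𝓡∂ 2) (e q) ∈ interior (range (𝓡∂ 2)) := by
    simp only [ModelWithCorners.IsInteriorPoint, mfld_simps]
    rw [chartAt_self_eq]
    rfl
  rw [h2, interior_range_modelWithCornersEuclideanHalfSpace]
  rfl

lemma mfderiv_extend_injective {e : OpenPartialHomeomorph S (EuclideanHalfSpace 2)}
    (he : e ∈ IsManifold.maximalAtlas (𝓡∂ 2) ∞ S) {q : S} (hq : q ∈ e.source) (w : E2)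
    (hw : surfDerivFrom (e.extend (𝓡∂ 2)) q w = 0) : w = 0 := by
  have : IsManifold (𝓡∂ 2) 1 S := IsManifold.of_le (n := ∞) (by simp)
  have h1 : e.MDifferentiable (𝓡∂ 2) (𝓡∂ 2) :=
    ⟨(contMDiffOn_of_mem_maximalAtlas he).mdifferentiableOn (by simp),
      (contMDiffOn_symm_of_mem_maximalAtlas he).mdifferentiableOn (by simp)⟩
  have h2 := (𝓡∂ 2).hasMFDerivAt.comp q (h1.mdifferentiableAt hq).hasMFDerivAt
  have h3 : surfDerivFrom (e.extend (𝓡∂ 2)) q w = mfderiv (𝓡∂ 2) (𝓡∂ 2) e q w :=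
    congrArg (fun L : E2 →L[ℝ] E2 => L w) h2.mfderiv
  rw [h3] at hw
  exact (injective_iff_map_eq_zero _).1 (h1.mfderiv_injective hq) w hw

omit [IsManifold (𝓡∂ 2) ∞ S] in
lemma surfDerivFrom_comp {W W' : Type*} [NormedAddCommGroup W] [NormedSpace ℝ W]
    [NormedAddCommGroup W'] [NormedSpace ℝ W'] {F : W → W'} {g : S → W} {p : S}
    (hF : DifferentiableAt ℝ F (g p)) (hg : MDifferentiableAt (𝓡∂ 2) 𝓘(ℝ, W) g p) (w : E2) :
    surfDerivFrom (fun q => F (g q)) p w = fderiv ℝ F (g p) (surfDerivFrom g p w) := by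
  have := mfderiv_comp p hF.mdifferentiableAt hg
  rw [mfderiv_eq_fderiv] at this
  exact congrArg (fun L : E2 →L[ℝ] W' => L w) this

variable [IsManifold (𝓡 3) ∞ N]

omit [IsManifold (𝓡 3) ∞ N] in
lemma derivTo_extend_symm_injective {c : OpenPartialHomeomorph N E3}
    (hc : c ∈ IsManifold.maximalAtlas (𝓡 3) ∞ N) {u : E3} (hu : u ∈ (c.extend (𝓡 3)).target)
    (w : E3) (hw : derivTo (c.extend (𝓡 3)).symm u w = 0) : w = 0 := by
  have h1 : ContMDiffAt (𝓡 3) 𝓘(ℝ, E3) ∞ (c.extend (𝓡 3)) ((c.extend (𝓡 3)).symm u) :=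
    c.contMDiffAt_extend hc (by simpa using (c.extend (𝓡 3)).map_target hu)
  have hT : IsOpen (c.extend (𝓡 3)).target := c.isOpen_extend_target
  have h2 : ContMDiffAt 𝓘(ℝ, E3) (𝓡 3) ∞ (c.extend (𝓡 3)).symm u := by
    have := contMDiffOn_extend_symm (I := 𝓡 3) hc
    rw [show (𝓡 3) '' c.target = (c.extend (𝓡 3)).target by simp] at this
    exact this.contMDiffAt (hT.mem_nhds hu)
  have h3 := fderiv_comp_derivTo (h1.mdifferentiableAt (by simp)) (h2.mdifferentiableAt (by simp)) w
  have h4 : (fun u => (c.extend (𝓡 3)) ((c.extend (𝓡 3)).symm u)) =ᶠ[𝓝 u] id := by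
    filter_upwards [hT.mem_nhds hu] with v hv
    exact (c.extend (𝓡 3)).right_inv hv
  rw [h4.fderiv_eq, fderiv_id, hw, map_zero] at h3
  exact h3

omit [IsManifold (𝓡 3) ∞ N] in
-- In immersion charts `f` is the linear map v ↦ L(v, 0). It makes sense on the whole plane, and
-- this extends `f` past the boundary.
theorem exists_surfaceChart {f : S → N} (hf : Manifold.IsImmersion (𝓡∂ 2) (𝓡 3) ∞ f) (p : S) :
    Nonempty (SurfaceChart f p) := by
  obtain ⟨F, _, _, hF⟩ := hf
  have h := hF p
  set e := h.domChart
  set c := h.codChart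
  set L := h.equiv
  have he : e ∈ IsManifold.maximalAtlas (𝓡∂ 2) ∞ S := h.domChart_mem_maximalAtlas
  have hc : c ∈ IsManifold.maximalAtlas (𝓡 3) ∞ N := h.codChart_mem_maximalAtlas
  have hp : p ∈ e.source := h.mem_domChart_source
  set φ := e.extend (𝓡∂ 2) with hφ
  set χ := c.extend (𝓡 3) with hχ
  have hφs : φ.source = e.source := e.extend_source
  -- The shift is along the boundary only, so the first coordinate still measures the position in
  -- the half plane.
  let a : ℝ × ℝ := (0, (φ p) 1)
  let A : ℝ × ℝ → E2 := fun u => planeCoord.symm (u + a)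
  have hA : ContDiff ℝ ∞ A := planeCoord.symm.contDiff.comp (contDiff_id.add contDiff_const)
  have hA0 : ∀ u, (A u) 0 = u.1 := by
    intro u
    have := congrArg Prod.fst (planeCoord.apply_symm_apply (u + a))
    exact this.trans (by simp [a])
  have hAφ : ∀ q, A (planeCoord (φ q) - a) = φ q := fun q => by simp [A]
  have hAD : ∀ u w, fderiv ℝ A u w = planeCoord.symm w := by
    intro u w
    have : HasFDerivAt A (planeCoord.symm : ℝ × ℝ →L[ℝ] E2) u :=
      (planeCoord.symm.hasFDerivAt).comp u ((hasFDerivAt_id u).add_const a)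
    rw [this.fderiv]; rfl
  let B : E2 → E3 := fun v => L (v, 0)
  have hB : ContDiff ℝ ∞ B := L.contDiff.comp (contDiff_id.prodMk contDiff_const)
  have hBD : ∀ u w, fderiv ℝ B u w = L (w, 0) := by
    intro u w
    have h1 : HasFDerivAt B ((L : E2 × F →L[ℝ] E3).comp (ContinuousLinearMap.inl ℝ E2 F)) u :=
      ((L : E2 × F →L[ℝ] E3).comp (ContinuousLinearMap.inl ℝ E2 F)).hasFDerivAt
    rw [h1.fderiv]; rfl
  have hT : IsOpen χ.target := c.isOpen_extend_target
  have hφp : φ p ∈ φ.target := φ.map_source (by rw [hφs]; exact hp)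
  have hBt : ∀ v ∈ φ.target, B v ∈ χ.target := fun v hv => h.target_subset_preimage_target hv
  have hχsmooth : ∀ v ∈ χ.target, ContMDiffAt 𝓘(ℝ, E3) (𝓡 3) ∞ χ.symm v := by
    intro v hv
    have := contMDiffOn_extend_symm (I := 𝓡 3) hc
    rw [show (𝓡 3) '' c.target = (c.extend (𝓡 3)).target by simp] at this
    exact this.contMDiffAt (hT.mem_nhds hv)
  have hBA : ContDiff ℝ ∞ (fun u => B (A u)) := hB.comp hA
  refine ⟨{
    coord := fun q => planeCoord (φ q) - a
    coordInv := fun u => φ.symm (A u)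
    ext := fun u => χ.symm (B (A u))
    source := e.source
    isOpen_source := e.open_source
    mem_source := hp
    smooth_coord := ?_
    smooth_ext := ?_
    eq_ext := ?_
    left_inv := ?_
    tendsto_coordInv := ?_
    right_inv := ?_
    interior_iff := ?_
    nonneg := ?_
    snd_eq_zero := ?_
    ext_injective := ?_
    coord_injective := ?_ }⟩
  · exact fun q hq => ContDiff.comp_contMDiffWithinAt (g := fun v : E2 => planeCoord v - a)
      (planeCoord.contDiff.sub contDiff_const) (e.contMDiffOn_extend he q hq)
  · have h1 : ∀ᶠ u in 𝓝 (planeCoord (φ p) - a), B (A u) ∈ χ.target := by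
      refine hBA.continuous.continuousAt.eventually_mem (hT.mem_nhds ?_)
      rw [hAφ]; exact hBt _ hφp
    filter_upwards [h1] with u hu
    exact (hχsmooth _ hu).comp u hBA.contDiffAt.contMDiffAt
  · intro q hq
    have hq' : φ q ∈ φ.target := φ.map_source (by rw [hφs]; exact hq)
    have h1 := h.writtenInCharts hq'
    simp only [Function.comp_apply] at h1
    rw [hAφ]
    change f q = χ.symm (L (φ q, 0))
    rw [← h1]
    change f q = χ.symm (χ (f (φ.symm (φ q))))
    have hq'' : q ∈ φ.source := by rw [hφs]; exact hq
    rw [φ.left_inv hq'', χ.left_inv]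
    rw [c.extend_source]
    exact h.source_subset_preimage_source hq
  · intro q hq
    simp only [hAφ]
    exact φ.left_inv (by rw [hφs]; exact hq)
  · have h1 : ContinuousWithinAt φ.symm (range (𝓡∂ 2)) (φ p) :=
      (e.continuousAt_extend_symm hp).continuousWithinAt
    have h2 : Tendsto A (𝓝[{u | 0 ≤ u.1}] (planeCoord (φ p) - a)) (𝓝[range (𝓡∂ 2)] (φ p)) := by
      refine tendsto_nhdsWithin_iff.2 ⟨?_, ?_⟩
      · have := hA.continuous.tendsto (planeCoord (φ p) - a)
        rw [hAφ] at this
        exact this.mono_left nhdsWithin_le_nhds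
      · filter_upwards [self_mem_nhdsWithin] with u hu
        rw [range_modelWithCornersEuclideanHalfSpace]
        exact hu.trans_eq (hA0 u).symm
    have h3 := h1.tendsto.comp h2
    rwa [φ.left_inv (by rw [hφs]; exact hp)] at h3
  · have h2 : Tendsto A (𝓝[{u | 0 ≤ u.1}] (planeCoord (φ p) - a)) (𝓝[range (𝓡∂ 2)] (φ p)) := by
      refine tendsto_nhdsWithin_iff.2 ⟨?_, ?_⟩
      · have := hA.continuous.tendsto (planeCoord (φ p) - a)
        rw [hAφ] at this
        exact this.mono_left nhdsWithin_le_nhds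
      · filter_upwards [self_mem_nhdsWithin] with u hu
        rw [range_modelWithCornersEuclideanHalfSpace]
        exact hu.trans_eq (hA0 u).symm
    filter_upwards [h2.eventually (e.extend_target_mem_nhdsWithin hp)] with u hu
    rw [φ.right_inv hu]
    simp [A]
  · intro q hq
    rw [isInteriorPoint_iff_of_mem_maximalAtlas he hq]
    simp [planeCoord_apply, a, hφ]
  · intro q hq
    have : φ q ∈ range (𝓡∂ 2) := mem_range_self _
    rw [range_modelWithCornersEuclideanHalfSpace] at this
    simpa [planeCoord_apply, a] using! this
  · simp [planeCoord_apply, a]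
  · intro w hw
    have hm : B (A (planeCoord (φ p) - a)) ∈ χ.target := by rw [hAφ]; exact hBt _ hφp
    rw [derivTo_comp_fderiv (F := χ.symm) (G := fun u => B (A u))
      ((hχsmooth _ hm).mdifferentiableAt (by simp)) (hBA.differentiable (by simp) _)] at hw
    have h1 := derivTo_extend_symm_injective hc hm _ hw
    have h2 := (((hB.differentiable (by simp)) (A (planeCoord (φ p) - a))).hasFDerivAt.comp
      (planeCoord (φ p) - a) (hA.differentiable (by simp) _).hasFDerivAt).fderiv
    have h3 : fderiv ℝ (fun u => B (A u)) (planeCoord (φ p) - a) w =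
        L (planeCoord.symm w, 0) := by
      rw [← hBD (A (planeCoord (φ p) - a)), ← hAD (planeCoord (φ p) - a) w]
      exact congrArg (fun T : ℝ × ℝ →L[ℝ] E3 => T w) h2
    rw [h3] at h1
    have h4 := congrArg Prod.fst (L.map_eq_zero_iff.1 h1)
    exact planeCoord.symm.map_eq_zero_iff.1 h4
  · intro w hw
    have h1 : HasFDerivAt (fun v : E2 => planeCoord v - a) (planeCoord : E2 →L[ℝ] ℝ × ℝ) (φ p) :=
      planeCoord.hasFDerivAt.sub_const a
    have h2 := surfDerivFrom_comp (F := fun v : E2 => planeCoord v - a) (g := φ) (p := p)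
      h1.differentiableAt ((e.contMDiffAt_extend he hp).mdifferentiableAt (by simp)) w
    rw [h1.fderiv] at h2
    rw [h2] at hw
    exact mfderiv_extend_injective he hp w (planeCoord.map_eq_zero_iff.1 hw)

end SurfaceChart

end ReebSection

namespace ReebSection

open Set Filter

/-! ### First-order behaviour of surface charts. -/

namespace SurfaceChart

variable {N : Type*} [TopologicalSpace N] [ChartedSpace E3 N]
variable {S : Type*} [TopologicalSpace S] [ChartedSpace (EuclideanHalfSpace 2) S]
variable {f : S → N} {p : S} (C : SurfaceChart f p)

lemma source_mem : C.source ∈ 𝓝 p := C.isOpen_source.mem_nhds C.mem_source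

lemma continuousAt_coord : ContinuousAt C.coord p :=
  C.smooth_coord.continuousOn.continuousAt C.source_mem

lemma mdifferentiableAt_coord {q : S} (hq : q ∈ C.source) :
    MDifferentiableAt (𝓡∂ 2) 𝓘(ℝ, ℝ × ℝ) C.coord q :=
  (C.smooth_coord.contMDiffAt (C.isOpen_source.mem_nhds hq)).mdifferentiableAt (by simp)

lemma coord_eq_zero (hp : p ∈ (𝓡∂ 2).boundary S) : C.coord p = 0 := by
  have h1 : p ∉ (𝓡∂ 2).interior S := by
    rw [← ModelWithCorners.compl_boundary]; exact fun h => h hp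
  rw [C.interior_iff p C.mem_source, not_lt] at h1
  exact Prod.ext (le_antisymm h1 (C.nonneg p C.mem_source)) C.snd_eq_zero

lemma coord_fst_eq_zero {q : S} (hq : q ∈ C.source) (hqb : q ∈ (𝓡∂ 2).boundary S) :
    (C.coord q).1 = 0 := by
  have h1 : q ∉ (𝓡∂ 2).interior S := by
    rw [← ModelWithCorners.compl_boundary]; exact fun h => h hqb
  rw [C.interior_iff q hq, not_lt] at h1
  exact le_antisymm h1 (C.nonneg q hq)

/-- The first coordinate is nonnegative and vanishes at `p`, so its one-sided difference quotients
along an inward ray are nonnegative. -/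
lemma surfDerivFrom_coord_nonneg (hp : p ∈ (𝓡∂ 2).boundary S) {w : E2} (hw : 0 < w 0) :
    0 ≤ (surfDerivFrom C.coord p w).1 := by
  set φ := extChartAt (𝓡∂ 2) p
  have hrange : ∀ t ∈ Ici (0 : ℝ), φ p + t • w ∈ range (𝓡∂ 2) := by
    intro t ht
    have h0 : φ p ∈ range (𝓡∂ 2) := mem_range_self _
    rw [range_modelWithCornersEuclideanHalfSpace] at h0 ⊢
    exact add_nonneg h0 (mul_nonneg ht hw.le)
  have h1 := (C.mdifferentiableAt_coord C.mem_source).hasMFDerivAt.2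
  have h2 : HasDerivWithinAt (fun t : ℝ => φ p + t • w) w (Ici 0) 0 := by
    simpa using (((hasDerivAt_id (0 : ℝ)).smul_const w).const_add (φ p)).hasDerivWithinAt
  have h3 : HasDerivWithinAt
      (fun t : ℝ => (C.coord (φ.symm (φ p + t • w))).1) (surfDerivFrom C.coord p w).1 (Ici 0) 0 := by
    have h1' : HasFDerivWithinAt (fun u : E2 => C.coord (φ.symm u)) (surfDerivFrom C.coord p)
        (range (𝓡∂ 2)) (φ p + (0 : ℝ) • w) := by
      rw [zero_smul, add_zero]; exact h1
    have h4 := h1'.comp_hasDerivWithinAt (0 : ℝ) h2 hrange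
    exact hasFDerivAt_fst.comp_hasDerivWithinAt (0 : ℝ) h4
  have h5 : ∀ᶠ t in 𝓝[>] (0 : ℝ), φ.symm (φ p + t • w) ∈ C.source := by
    have h6 : ContinuousAt φ.symm (φ p + (0 : ℝ) • w) := by
      rw [zero_smul, add_zero]
      exact continuousAt_extChartAt_symm p
    have h7 : ContinuousAt (fun t : ℝ => φ.symm (φ p + t • w)) 0 :=
      ContinuousAt.comp (f := fun t : ℝ => φ p + t • w) h6 (by fun_prop)
    refine (h7.eventually_mem ?_).filter_mono nhdsWithin_le_nhds
    rw [zero_smul, add_zero, extChartAt_to_inv]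
    exact C.source_mem
  rw [← hasDerivWithinAt_Ioi_iff_Ici, hasDerivWithinAt_iff_tendsto_slope,
    Set.sdiff_singleton_eq_self (by simp)] at h3
  refine ge_of_tendsto h3 ?_
  filter_upwards [h5, self_mem_nhdsWithin] with t ht htpos
  rw [slope_def_field, zero_smul, add_zero, extChartAt_to_inv, C.coord_eq_zero hp]
  exact div_nonneg (by simpa using C.nonneg _ ht) (by simpa using (le_of_lt htpos))

/-- The derivative of the chart at a boundary point preserves the boundary direction and the
inward side. -/
lemma exists_surfDerivFrom_coord_fst (hp : p ∈ (𝓡∂ 2).boundary S) :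
    ∃ m > 0, ∀ w : E2, (surfDerivFrom C.coord p w).1 = m * w 0 := by
  set L := surfDerivFrom C.coord p
  let e₀ : E2 := planeCoord.symm (1, 0)
  let e₁ : E2 := planeCoord.symm (0, 1)
  have h00 : e₀ 0 = 1 := congrArg Prod.fst (planeCoord.apply_symm_apply (1, 0))
  have h10 : e₁ 0 = 0 := congrArg Prod.fst (planeCoord.apply_symm_apply (0, 1))
  have hdecomp : ∀ w : E2, w = w 0 • e₀ + w 1 • e₁ := by
    intro w
    apply planeCoord.injective
    rw [map_add, map_smul, map_smul, planeCoord.apply_symm_apply, planeCoord.apply_symm_apply,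
      planeCoord_apply]
    simp
  -- Every e₀ + c e₁ points inward; an affine function of c that is bounded below has zero slope.
  have hnn : ∀ c : ℝ, 0 ≤ (L e₀).1 + c * (L e₁).1 := by
    intro c
    have := C.surfDerivFrom_coord_nonneg hp (w := e₀ + c • e₁) (by simp [h00, h10])
    rw [map_add, map_smul] at this
    simpa using this
  have h1 : (L e₁).1 = 0 := by
    by_contra h
    have := hnn (-((L e₀).1 + 1) / (L e₁).1)
    rw [div_mul_cancel₀ _ h] at this
    linarith
  have hinj : Function.Injective (L : E2 →ₗ[ℝ] ℝ × ℝ) :=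
    (injective_iff_map_eq_zero _).2 C.coord_injective
  have hsurj : Function.Surjective (L : E2 →ₗ[ℝ] ℝ × ℝ) :=
    (LinearMap.injective_iff_surjective_of_finrank_eq_finrank (by simp)).1 hinj
  have hform : ∀ w : E2, (L w).1 = (L e₀).1 * w 0 := by
    intro w
    conv_lhs => rw [hdecomp w]
    rw [map_add, map_smul, map_smul]
    simp [h1, mul_comm]
  refine ⟨(L e₀).1, lt_of_le_of_ne (by simpa using hnn 0) fun h => ?_, hform⟩
  obtain ⟨w, hw⟩ := hsurj (1, 0)
  have h2 := hform w
  rw [← h, zero_mul] at h2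
  have h3 : (L w).1 = 1 := congrArg Prod.fst hw
  rw [h2] at h3
  exact zero_ne_one h3

lemma eventually_mdifferentiableAt_ext :
    ∀ᶠ u in 𝓝 (C.coord p), MDifferentiableAt 𝓘(ℝ, ℝ × ℝ) (𝓡 3) C.ext u :=
  C.smooth_ext.mono fun _ hu => hu.mdifferentiableAt (by simp)

lemma surfDeriv_eq {q : S} (hq : q ∈ C.source)
    (hF : MDifferentiableAt 𝓘(ℝ, ℝ × ℝ) (𝓡 3) C.ext (C.coord q)) (w : E2) :
    surfDeriv f q w = derivTo C.ext (C.coord q) (surfDerivFrom C.coord q w) := by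
  have h1 := mfderiv_comp q hF (C.mdifferentiableAt_coord hq)
  have h2 : f =ᶠ[𝓝 q] C.ext ∘ C.coord := by
    filter_upwards [C.isOpen_source.mem_nhds hq] with r hr
    exact C.eq_ext r hr
  have h3 : surfDeriv f q = mfderiv (𝓡∂ 2) (𝓡 3) (C.ext ∘ C.coord) q := h2.mfderiv_eq
  rw [h1] at h3
  exact congrArg (fun L : E2 →L[ℝ] E3 => L w) h3

lemma continuousAt_map (C : SurfaceChart f p) : ContinuousAt f p := by
  have h1 : ContinuousAt C.ext (C.coord p) := C.smooth_ext.self_of_nhds.continuousAt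
  refine (h1.comp C.continuousAt_coord).congr_of_eventuallyEq ?_
  filter_upwards [C.source_mem] with r hr
  exact C.eq_ext r hr

lemma smoothAt_proj_comp {W : Type*} [NormedAddCommGroup W] [NormedSpace ℝ W] {P : N → W}
    (hP : ContMDiffAt (𝓡 3) 𝓘(ℝ, W) ∞ P (f p)) :
    ContDiffAt ℝ ∞ (fun u => P (C.ext u)) (C.coord p) := by
  rw [← contMDiffAt_iff_contDiffAt]
  rw [C.eq_ext p C.mem_source] at hP
  exact hP.comp _ C.smooth_ext.self_of_nhds

end SurfaceChart

end ReebSection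

namespace ReebSection

open Set Filter

/-! ### The boundary curve, and the turning of the surface around it. -/

namespace SurfaceChart

variable {N : Type*} [TopologicalSpace N] [ChartedSpace E3 N] [IsManifold (𝓡 3) ∞ N]
variable {S : Type*} [TopologicalSpace S] [ChartedSpace (EuclideanHalfSpace 2) S]
variable [IsManifold (𝓡∂ 2) ∞ S] {f : S → N} {p : S} (C : SurfaceChart f p)

omit [IsManifold (𝓡 3) ∞ N] in
lemma contDiffAt_coord_curve {c : ℝ → S} {w : (s : ℝ) → TangentSpace (𝓡∂ 2) (c s)}
    (hc : ContMDiff 𝓘(ℝ, ℝ) (𝓡∂ 2).tangent ∞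
      (fun s : ℝ => (⟨c s, w s⟩ : TangentBundle (𝓡∂ 2) S))) {s : ℝ} (hs : c s ∈ C.source) :
    ContDiffAt ℝ ∞ (fun s => C.coord (c s)) s ∧
      ContDiffAt ℝ ∞ (fun s => surfDerivFrom C.coord (c s) (w s)) s := by
  have hsrc := C.isOpen_source.mem_nhds hs
  have hc0 : ContMDiff 𝓘(ℝ, ℝ) (𝓡∂ 2) ∞ c := fun s =>
    (Bundle.contMDiffAt_proj (TangentSpace (𝓡∂ 2))).comp s (hc s)
  refine ⟨?_, ?_⟩
  · rw [← contMDiffAt_iff_contDiffAt]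
    exact (C.smooth_coord.contMDiffAt hsrc).comp s (hc0 s)
  · have h1 := C.smooth_coord.contMDiffOn_tangentMapWithin (m := ∞) (by simp)
      C.isOpen_source.uniqueMDiffOn
    have hopen : IsOpen (Bundle.TotalSpace.proj (F := E2) (E := TangentSpace (𝓡∂ 2) (M := S)) ⁻¹'
        C.source) := C.isOpen_source.preimage (FiberBundle.continuous_proj _ _)
    have h2 := (h1.contMDiffAt (hopen.mem_nhds
      (show (⟨c s, w s⟩ : TangentBundle (𝓡∂ 2) S) ∈ _ from hs))).comp s (hc s)
    have h3 := (contMDiff_snd_tangentBundle_modelSpace (ℝ × ℝ) 𝓘(ℝ, ℝ × ℝ)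
      (n := ∞)).contMDiffAt.comp s h2
    rw [← contMDiffAt_iff_contDiffAt]
    refine h3.congr_of_eventuallyEq ?_
    filter_upwards [(hc0.continuous.continuousAt (x := s)).eventually_mem hsrc] with r hr
    change mfderiv (𝓡∂ 2) 𝓘(ℝ, ℝ × ℝ) C.coord (c r) (w r) = _
    rw [← mfderivWithin_of_isOpen C.isOpen_source hr]
    rfl

omit [IsManifold (𝓡 3) ∞ N] in
/-- The boundary of the surface near a boundary point, in a chart. -/
lemma exists_boundary_parameter {X : VField N} {ψ : Flow ℝ N} (hψ : IsFlowOf ψ X)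
    (hp : p ∈ (𝓡∂ 2).boundary S) (b : FlowBox X ψ (f p))
    {c : ℝ → S} {w : (s : ℝ) → TangentSpace (𝓡∂ 2) (c s)}
    (hc : ContMDiff 𝓘(ℝ, ℝ) (𝓡∂ 2).tangent ∞
      (fun s : ℝ => (⟨c s, w s⟩ : TangentBundle (𝓡∂ 2) S)))
    (hc0 : c 0 = p) (hcb : ∀ s, c s ∈ (𝓡∂ 2).boundary S) (hcf : ∀ s, f (c s) = ψ s (f p)) :
    ∃ (a : ℝ → ℝ) (a' : ℝ), a' ≠ 0 ∧ ContDiffAt ℝ ∞ a 0 ∧ HasDerivAt a a' 0 ∧ a 0 = 0 ∧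
      (∀ᶠ s in 𝓝 0, c s ∈ C.source ∧ C.coord (c s) = (0, a s)) ∧
      derivTo C.ext 0 (0, 1) = a'⁻¹ • fieldVec X (f p) := by
  have hcoord := C.coord_eq_zero hp
  have hcont : Continuous c :=
    (FiberBundle.continuous_proj E2 (TangentSpace (𝓡∂ 2) (M := S))).comp hc.continuous
  have hev : ∀ᶠ s in 𝓝 0, c s ∈ C.source := by
    refine hcont.continuousAt.eventually_mem ?_
    rw [hc0]; exact C.source_mem
  have hsm : ContDiffAt ℝ ∞ (fun s => C.coord (c s)) 0 :=
    (C.contDiffAt_coord_curve hc (s := 0) (by rw [hc0]; exact C.mem_source)).1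
  set a : ℝ → ℝ := fun s => (C.coord (c s)).2 with ha
  have hasm : ContDiffAt ℝ ∞ a 0 := contDiffAt_snd.comp (0 : ℝ) hsm
  have hev2 : ∀ᶠ s in 𝓝 0, c s ∈ C.source ∧ C.coord (c s) = (0, a s) := by
    filter_upwards [hev] with s hs
    exact ⟨hs, Prod.ext (C.coord_fst_eq_zero hs (hcb s)) rfl⟩
  have ha0 : a 0 = 0 := by simp [ha, hc0, hcoord]
  have had : HasDerivAt a (deriv a 0) 0 := (hasm.differentiableAt (by simp)).hasDerivAt
  have hext : MDifferentiableAt 𝓘(ℝ, ℝ × ℝ) (𝓡 3) C.ext 0 := by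
    have := C.eventually_mdifferentiableAt_ext.self_of_nhds
    rwa [hcoord] at this
  have hline : HasDerivAt (fun s => ((0 : ℝ), a s)) (0, deriv a 0) 0 :=
    (hasDerivAt_const (0 : ℝ) (0 : ℝ)).prodMk had
  have horb : derivTo C.ext 0 (0, deriv a 0) = fieldVec X (f p) := by
    have h1 : (fun s => C.ext (0, a s)) =ᶠ[𝓝 0] fun s => ψ s (f p) := by
      filter_upwards [hev2] with s hs
      rw [← hs.2, ← C.eq_ext _ hs.1, hcf]
    have h2 := congrArg (fun L : ℝ →L[ℝ] E3 => L 1) (derivTo_congr h1)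
    simp only [hψ.derivTo_orbit, ψ.map_zero_apply] at h2
    have h3 := derivTo_comp_fderiv (F := C.ext) (G := fun s => ((0 : ℝ), a s)) (u := (0 : ℝ))
      (by rw [ha0]; exact hext) hline.differentiableAt 1
    rw [h2, ha0] at h3
    rw [h3]
    congr 1
    exact hline.deriv.symm
  -- The boundary curve moves with velocity X, which is nonzero because flow-box time grows at unit
  -- speed.
  have hne : deriv a 0 ≠ 0 := by
    intro h
    have h1 : fieldVec X (f p) = 0 := by
      rw [← horb, h]; exact map_zero _
    have h2 := hψ.hasDerivAt_comp_orbit (P := b.time) (t := 0) (x := f p)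
      (by rw [ψ.map_zero_apply]; exact b.smooth_time.mdifferentiableAt (by simp))
    have h3 : HasDerivAt (fun s => b.time (ψ s (f p))) 1 0 :=
      (hasDerivAt_id (0 : ℝ)).congr_of_eventuallyEq
        (b.eventually_proj_flow.mono fun s hs => hs.2)
    have h4 := h2.unique h3
    rw [ψ.map_zero_apply, h1, map_zero] at h4
    exact zero_ne_one h4
  refine ⟨a, deriv a 0, hne, hasm, had, ha0, hev2, ?_⟩
  rw [← horb, ← map_smul]
  simp [hne]

/-- The behaviour of the surface near a boundary point in a flow box. -/
theorem boundary_structure {X : VField N} {ψ : Flow ℝ N} (hψ : IsFlowOf ψ X)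
    (hp : p ∈ (𝓡∂ 2).boundary S) (htr : TraceTransverseAt X ψ f p)
    (b : FlowBox X ψ (f p)) :
    (∃ σ : ℝ → ℝ, Tendsto σ (𝓝 0) (𝓝 0) ∧ ∀ᶠ s in 𝓝 0, C.ext (0, s) = ψ (σ s) (f p)) ∧
    (∃ d ≠ (0 : ℝ), derivTo C.ext 0 (0, 1) = d • fieldVec X (f p)) ∧
    ∃ e k : ℝ × ℝ, fderiv ℝ (fun u => b.proj (C.ext u)) 0 (1, 0) = e ∧
      fderiv ℝ (fun u => fderiv ℝ (fun u => b.proj (C.ext u)) u (1, 0)) 0 (0, 1) = k ∧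
      e.1 * k.2 - e.2 * k.1 ≠ 0 := by
  obtain ⟨c, w, v, v', hc0, hcb, hcf, hc, hw, hv, hv', hli⟩ := htr
  obtain ⟨a, a', ha', hasm, had, ha0, hev, hd⟩ :=
    C.exists_boundary_parameter hψ hp b hc hc0 hcb hcf
  have hcoord := C.coord_eq_zero hp
  have hextp : f p = C.ext 0 := by rw [← hcoord]; exact C.eq_ext p C.mem_source
  -- σ is the local inverse of `a`: it turns the boundary coordinate into flow time.
  have haxis : ∃ σ : ℝ → ℝ, Tendsto σ (𝓝 0) (𝓝 0) ∧
      ∀ᶠ s in 𝓝 0, C.ext (0, s) = ψ (σ s) (f p) := by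
    obtain ⟨Φ, hΦ, hΦ0⟩ := exists_openPartialHomeomorph_of_injective rfl
      (hasm.hasStrictDerivAt' had (by simp)).hasStrictFDerivAt (by
        intro x hx
        simpa [ha'] using hx)
    have hΦ00 : Φ 0 = 0 := by rw [hΦ, ha0]
    have hσ : Tendsto Φ.symm (𝓝 0) (𝓝 0) := by
      have := Φ.symm.continuousAt (x := 0) (by rw [← hΦ00]; exact Φ.map_source hΦ0)
      rwa [ContinuousAt, ← hΦ00, Φ.left_inv hΦ0, hΦ00] at this
    refine ⟨Φ.symm, hσ, ?_⟩
    have htgt : Φ.target ∈ 𝓝 (0 : ℝ) :=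
      Φ.open_target.mem_nhds (by rw [← hΦ00]; exact Φ.map_source hΦ0)
    filter_upwards [hσ.eventually hev, htgt] with s hs hst
    have h1 : a (Φ.symm s) = s := by rw [← hΦ]; exact Φ.right_inv hst
    rw [h1] at hs
    rw [← hs.2, ← C.eq_ext _ hs.1, hcf]
  refine ⟨haxis, ⟨a'⁻¹, inv_ne_zero ha', hd⟩, ?_⟩
  set g : ℝ × ℝ → ℝ × ℝ := fun u => b.proj (C.ext u) with hg
  have hgs : ContDiffAt ℝ ∞ g 0 := by
    rw [← hcoord]; exact C.smoothAt_proj_comp b.smooth_proj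
  have hg0 : ∀ᶠ s in 𝓝 (0 : ℝ), g (0, s) = 0 := by
    obtain ⟨σ, hσ, h⟩ := haxis
    filter_upwards [h, hσ.eventually b.eventually_proj_flow] with s hs hs'
    rw [hg]
    simp only
    rw [hs, hs'.1]
  have hgd : ∀ᶠ u in 𝓝 (0 : ℝ × ℝ), DifferentiableAt ℝ g u :=
    (contDiffAt_infty.1 hgs 1).eventually (by simp) |>.mono fun u hu => hu.differentiableAt (by simp)
  have hax : Tendsto (fun s : ℝ => ((0 : ℝ), s)) (𝓝 0) (𝓝 0) :=
    (Continuous.prodMk_right (0 : ℝ)).tendsto 0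
  have hg01 : ∀ᶠ s in 𝓝 (0 : ℝ), fderiv ℝ g (0, s) (0, 1) = 0 := by
    filter_upwards [hg0.eventually_nhds, hax.eventually hgd] with s hs hd
    have h1 : HasDerivAt (fun t : ℝ => g (0, t)) (fderiv ℝ g (0, s) (0, 1)) s :=
      HasFDerivAt.comp_hasDerivAt s hd.hasFDerivAt
        ((hasDerivAt_const s (0 : ℝ)).prodMk (hasDerivAt_id s))
    have h2 : HasDerivAt (fun t : ℝ => g (0, t)) 0 s :=
      (hasDerivAt_const s (0 : ℝ × ℝ)).congr_of_eventuallyEq hs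
    exact h1.unique h2
  have hκ : HasDerivAt (fun s : ℝ => fderiv ℝ g (0, s) (1, 0))
      (fderiv ℝ (fun u => fderiv ℝ g u (1, 0)) 0 (0, 1)) 0 := by
    have h1 : DifferentiableAt ℝ (fun u => fderiv ℝ g u (1, 0)) 0 :=
      ((hgs.fderiv_right (m := 1) (by norm_cast)).clm_apply contDiffAt_const).differentiableAt
        (by simp)
    exact HasFDerivAt.comp_hasDerivAt (0 : ℝ) h1.hasFDerivAt
        ((hasDerivAt_const (0 : ℝ) (0 : ℝ)).prodMk (hasDerivAt_id (0 : ℝ)))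
  set k := fderiv ℝ (fun u => fderiv ℝ g u (1, 0)) 0 (0, 1) with hk
  set e := fderiv ℝ g 0 (1, 0) with he
  refine ⟨e, k, rfl, rfl, ?_⟩
  have hPd : ∀ᶠ y in 𝓝 (f p), MDifferentiableAt (𝓡 3) 𝓘(ℝ, ℝ × ℝ) b.proj y := by
    have h1 : ContMDiffAt (𝓡 3) 𝓘(ℝ, ℝ × ℝ) 1 b.proj (f p) := b.smooth_proj.of_le (by simp)
    filter_upwards [(contMDiffAt_iff_contMDiffAt_nhds (by simp)).1 h1] with y hy
    exact hy.mdifferentiableAt (by simp)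
  have hFd : ∀ᶠ u in 𝓝 (0 : ℝ × ℝ), MDifferentiableAt 𝓘(ℝ, ℝ × ℝ) (𝓡 3) C.ext u := by
    rw [← hcoord]; exact C.eventually_mdifferentiableAt_ext
  -- the first-order behaviour in the direction of the boundary
  have he0 : e ≠ 0 := by
    intro h0
    rw [he, fderiv_comp_derivTo (by rw [← hextp]; exact hPd.self_of_nhds) hFd.self_of_nhds,
      ← hextp] at h0
    obtain ⟨t, ht⟩ := b.ker _ h0
    have h1 : derivTo C.ext (C.coord p) ((1, 0) - (t * a') • (0, 1)) = 0 := by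
      rw [hcoord, map_sub, map_smul, hd, ht, smul_smul, mul_assoc, mul_inv_cancel₀ ha', mul_one,
        sub_self]
    have h2 := congrArg Prod.fst (C.ext_injective _ h1)
    simp at h2
  have ha0t : Tendsto a (𝓝 0) (𝓝 0) := by
    have := had.continuousAt
    rwa [ContinuousAt, ha0] at this
  have hcurve : Tendsto (fun s : ℝ => (-s, ψ s (f p))) (𝓝 0) (𝓝 (0, f p)) := by
    refine Continuous.tendsto' ?_ _ _ (by simp)
    exact continuous_neg.prodMk (hψ.continuous_uncurry.comp (Continuous.prodMk_left (f p)))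
  have hflow : ∀ᶠ s in 𝓝 (0 : ℝ), ∀ᶠ y in 𝓝 (ψ s (f p)), b.proj (ψ (-s) y) = b.proj y := by
    filter_upwards [hcurve.eventually b.eventually_flow.eventually_nhds] with s hs
    exact ((Continuous.prodMk_right (-s)).tendsto (ψ s (f p))).eventually hs |>.mono
      fun y hy => hy.1
  obtain ⟨W, hW⟩ : ∃ W : ℝ → E2, ∀ s, W s = w s := ⟨w, fun _ => rfl⟩
  have hvW : ∀ s, v s = flowDeriv ψ (-s) (f (c s)) (surfDeriv f (c s) (W s)) := fun s => by
    rw [hW]; exact hv s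
  -- The projection is invariant under short flows, so the pull-back by dψ_{-s} in the definition of
  -- `v` disappears, and ∂₂g = 0 on the axis removes the tangential part.
  have hPv : ∀ᶠ s in 𝓝 (0 : ℝ), derivFrom b.proj (f p) (v s) =
      (surfDerivFrom C.coord (c s) (W s)).1 • fderiv ℝ g (0, a s) (1, 0) := by
    have hψt : Tendsto (fun s => ψ s (f p)) (𝓝 0) (𝓝 (f p)) := by
      have := (continuous_snd.tendsto _).comp hcurve
      exact this
    filter_upwards [hev, hflow, ha0t.eventually hg01, (hax.comp ha0t).eventually hFd, hψt.eventually hPd] with s hs hfl hs1 hs2 hs4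
    have h1 : ψ (-s) (f (c s)) = f p := by rw [hcf, ← ψ.map_add]; simp
    have h2 := derivFrom_comp_flow (P := b.proj) (hψ.mdifferentiableAt (-s) (f (c s)))
      (by rw [h1]; exact hPd.self_of_nhds) (surfDeriv f (c s) (W s))
    rw [h1, ← hvW s] at h2
    have h3 : (fun y => b.proj (ψ (-s) y)) =ᶠ[𝓝 (f (c s))] b.proj := by
      rw [hcf]; exact hfl
    rw [← h2, derivFrom_congr h3]
    have hs2' : MDifferentiableAt 𝓘(ℝ, ℝ × ℝ) (𝓡 3) C.ext (C.coord (c s)) := by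
      rw [hs.2]; exact hs2
    rw [C.surfDeriv_eq hs.1 hs2', C.eq_ext _ hs.1,
      ← fderiv_comp_derivTo (by rw [← C.eq_ext _ hs.1, hcf]; exact hs4) hs2', hs.2]
    set η := surfDerivFrom C.coord (c s) (W s)
    have hη : η = η.1 • ((1 : ℝ), (0 : ℝ)) + η.2 • ((0 : ℝ), (1 : ℝ)) := by ext <;> simp
    change fderiv ℝ g (0, a s) η = _
    conv_lhs => rw [hη]
    rw [map_add, map_smul, map_smul, hs1, smul_zero, add_zero]
  have hωs : ContDiffAt ℝ ∞ (fun s => surfDerivFrom C.coord (c s) (W s)) 0 := by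
    simp only [hW]
    exact (C.contDiffAt_coord_curve hc (s := 0) (by rw [hc0]; exact C.mem_source)).2
  set ω₁ : ℝ → ℝ := fun s => (surfDerivFrom C.coord (c s) (W s)).1 with hω₁
  have hω₁d : HasDerivAt ω₁ (deriv ω₁ 0) 0 :=
    ((contDiffAt_fst.comp (0 : ℝ) hωs).differentiableAt (by simp)).hasDerivAt
  have hω₁0 : 0 < ω₁ 0 := by
    -- The vector `w 0` is typed at `c 0`, which is only propositionally `p`, so the chart is
    -- transported there.
    obtain ⟨C', hC'⟩ : ∃ C' : SurfaceChart f (c 0), C'.coord = C.coord := by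
      rw [hc0]; exact ⟨C, rfl⟩
    obtain ⟨m, hm, h⟩ := C'.exists_surfDerivFrom_coord_fst (hcb 0)
    rw [hC'] at h
    rw [hω₁]
    simp only
    rw [h (W 0), hW]
    exact mul_pos hm (hw 0)
  have hd1 : HasDerivAt (fun s => derivFrom b.proj (f p) (v s)) (derivFrom b.proj (f p) v') 0 :=
    (derivFrom b.proj (f p)).hasFDerivAt.comp_hasDerivAt (0 : ℝ) hv'
  have hκa : HasDerivAt (fun s => fderiv ℝ g (0, a s) (1, 0)) (a' • k) 0 := by
    have h1 : HasDerivAt (fun s : ℝ => fderiv ℝ g (0, s) (1, 0)) k (a 0) := by rw [ha0]; exact hκ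
    exact h1.scomp (0 : ℝ) had
  have hd2 : HasDerivAt (fun s => derivFrom b.proj (f p) (v s))
      (ω₁ 0 • a' • k + deriv ω₁ 0 • e) 0 := by
    have h1 := hω₁d.smul hκa
    simp only [ha0] at h1
    exact h1.congr_of_eventuallyEq hPv
  have hv0 : derivFrom b.proj (f p) (v 0) = ω₁ 0 • e := by
    rw [hPv.self_of_nhds, ha0]; rfl
  have hv1 := hd1.unique hd2
  intro hdet
  obtain ⟨κ, hκe⟩ : ∃ κ : ℝ, k = κ • e := by
    have h1 : e.1 ≠ 0 ∨ e.2 ≠ 0 := by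
      by_contra! h
      exact he0 (Prod.ext h.1 h.2)
    rcases h1 with h | h
    · refine ⟨k.1 / e.1, Prod.ext ?_ ?_⟩
      · simp [h]
      · simp only [Prod.smul_snd, smul_eq_mul]; field_simp; linarith
    · refine ⟨k.2 / e.2, Prod.ext ?_ ?_⟩
      · simp only [Prod.smul_fst, smul_eq_mul]; field_simp; linarith
      · simp [h]
  -- If k were parallel to e, the projections of v(0) and v'(0) would be parallel; this μ cancels
  -- them, so v' − μ v(0) lies in ℝX, against linear independence.
  set μ := (ω₁ 0 * a' * κ + deriv ω₁ 0) / ω₁ 0 with hμ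
  have h1 : derivFrom b.proj (f p) (v' - μ • v 0) = 0 := by
    rw [map_sub, map_smul, hv0, hv1, hκe, smul_smul, smul_smul, smul_smul, ← add_smul, ← sub_smul,
      hμ, div_mul_cancel₀ _ hω₁0.ne']
    simp [mul_assoc]
  obtain ⟨α, hα⟩ := b.ker _ h1
  have h2 := Fintype.linearIndependent_iff.1 hli ![-α, -μ, 1] (by
    rw [Fin.sum_univ_three]
    change -α • fieldVec X (f p) + -μ • v 0 + (1 : ℝ) • v' = 0
    rw [neg_smul, ← hα]
    module) 2
  simp at h2

end SurfaceChart

end ReebSection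

namespace ReebSection

open Set Filter

/-! ### Inward vectors as representatives of the trace. -/

section InwardVec

variable {N : Type*} [TopologicalSpace N] [ChartedSpace E3 N]
variable {S : Type*} [TopologicalSpace S] [ChartedSpace (EuclideanHalfSpace 2) S]

/-- A vector tangent to the surface at a boundary point and pointing inward. -/
noncomputable def inwardVec (f : S → N) (p : S) : E3 := surfDeriv f p (planeCoord.symm (1, 0))

/-- At the boundary point `p`, the tangent plane of the surface contains the vector field. -/
structure IsTangentToField (X : VField N) (f : S → N) (p : S) : Prop where
  surfDeriv_eq : ∀ w : E2, ∃ a : ℝ, surfDeriv f p w = w 0 • inwardVec f p + a • fieldVec X (f p)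
  exists_eq : ∃ w : E2, w 0 = 0 ∧ surfDeriv f p w = fieldVec X (f p)
  ne_smul : ∀ a : ℝ, inwardVec f p ≠ a • fieldVec X (f p)

lemma IsTangentToField.traceRay_eq {X : VField N} {f : S → N} {p : S}
    (h : IsTangentToField X f p) : traceRay f p =
      {u | ∃ m : ℝ, 0 < m ∧ ∃ a : ℝ, u = ⟨f p, (m • inwardVec f p + a • fieldVec X (f p) : E3)⟩} := by
  ext u
  constructor
  · rintro ⟨w, hw, rfl⟩
    obtain ⟨a, ha⟩ := h.surfDeriv_eq w
    refine ⟨(show E2 from w) 0, hw, a, ?_⟩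
    congr 1
  · rintro ⟨m, hm, a, rfl⟩
    obtain ⟨w, hw0, hw⟩ := h.exists_eq
    refine ⟨(m • planeCoord.symm (1, 0) + a • w : E2), ?_, ?_⟩
    · have h1 : (planeCoord.symm (1, 0) : E2) 0 = 1 :=
        congrArg Prod.fst (planeCoord.apply_symm_apply (1, 0))
      change 0 < (m • planeCoord.symm (1, 0) + a • w : E2) 0
      simp [h1, hw0, hm]
    · congr 1
      change _ = surfDeriv f p (m • planeCoord.symm (1, 0) + a • w : E2)
      rw [map_add, map_smul, map_smul, hw]
      rfl

/-- A ray modulo X does not change under positive scaling and addition of multiples of X. -/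
lemma traceRay_eq_traceRay {X : VField N} {f : S → N} {p q : S}
    (hp : IsTangentToField X f p) (hq : IsTangentToField X f q) (hpq : f p = f q) {μ a : ℝ}
    (hμ : 0 < μ) (h : inwardVec f p = μ • inwardVec f q + a • fieldVec X (f q)) :
    traceRay f p = traceRay f q := by
  rw [hp.traceRay_eq, hq.traceRay_eq, hpq, h]
  ext u
  constructor
  · rintro ⟨m, hm, c, rfl⟩
    refine ⟨m * μ, mul_pos hm hμ, m * a + c, ?_⟩
    exact congrArg (fun v : E3 => (⟨f q, v⟩ : TangentBundle (𝓡 3) N)) (by module)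
  · rintro ⟨m, hm, c, rfl⟩
    refine ⟨m / μ, div_pos hm hμ, c - m / μ * a, ?_⟩
    exact congrArg (fun v : E3 => (⟨f q, v⟩ : TangentBundle (𝓡 3) N))
      (by rw [smul_add, smul_smul, div_mul_cancel₀ _ hμ.ne']; module)

namespace SurfaceChart

variable {f : S → N} {p : S} (C : SurfaceChart f p)

lemma mdifferentiableAt_ext_zero (hp : p ∈ (𝓡∂ 2).boundary S) :
    MDifferentiableAt 𝓘(ℝ, ℝ × ℝ) (𝓡 3) C.ext 0 := by
  have := C.eventually_mdifferentiableAt_ext.self_of_nhds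
  rwa [C.coord_eq_zero hp] at this

lemma eq_ext_zero (hp : p ∈ (𝓡∂ 2).boundary S) : f p = C.ext 0 := by
  rw [← C.coord_eq_zero hp]; exact C.eq_ext p C.mem_source

lemma surfDeriv_eq_add (hp : p ∈ (𝓡∂ 2).boundary S) {X : VField N} {d : ℝ}
    (hd : derivTo C.ext 0 (0, 1) = d • fieldVec X (f p)) (w : E2) :
    surfDeriv f p w = (surfDerivFrom C.coord p w).1 • derivTo C.ext 0 (1, 0) +
      ((surfDerivFrom C.coord p w).2 * d) • fieldVec X (f p) := by
  have h1 := C.surfDeriv_eq C.mem_source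
    (by rw [C.coord_eq_zero hp]; exact C.mdifferentiableAt_ext_zero hp) w
  rw [h1, C.coord_eq_zero hp]
  set η := surfDerivFrom C.coord p w
  have hη : η = η.1 • ((1 : ℝ), (0 : ℝ)) + η.2 • ((0 : ℝ), (1 : ℝ)) := by ext <;> simp
  conv_lhs => rw [hη]
  rw [map_add, map_smul, map_smul, hd, smul_smul]

lemma exists_inwardVec_eq (hp : p ∈ (𝓡∂ 2).boundary S) {X : VField N} {d : ℝ}
    (hd : derivTo C.ext 0 (0, 1) = d • fieldVec X (f p)) :
    ∃ m : ℝ, 0 < m ∧ ∃ a : ℝ, inwardVec f p = m • derivTo C.ext 0 (1, 0) + a • fieldVec X (f p) := by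
  obtain ⟨m, hm, h⟩ := C.exists_surfDerivFrom_coord_fst hp
  refine ⟨m, hm, (surfDerivFrom C.coord p (planeCoord.symm (1, 0))).2 * d, ?_⟩
  rw [inwardVec, C.surfDeriv_eq_add hp hd, h]
  have h1 : (planeCoord.symm (1, 0) : E2) 0 = 1 :=
    congrArg Prod.fst (planeCoord.apply_symm_apply (1, 0))
  rw [h1, mul_one]

lemma isTangentToField (hp : p ∈ (𝓡∂ 2).boundary S) {X : VField N} {d : ℝ} (hd0 : d ≠ 0)
    (hd : derivTo C.ext 0 (0, 1) = d • fieldVec X (f p)) : IsTangentToField X f p := by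
  obtain ⟨m, hm, h⟩ := C.exists_surfDerivFrom_coord_fst hp
  have h1 : (planeCoord.symm (1, 0) : E2) 0 = 1 :=
    congrArg Prod.fst (planeCoord.apply_symm_apply (1, 0))
  have h0 : (planeCoord.symm (0, 1) : E2) 0 = 0 :=
    congrArg Prod.fst (planeCoord.apply_symm_apply (0, 1))
  refine ⟨fun w => ?_, ?_, fun a ha => ?_⟩
  · refine ⟨(surfDerivFrom C.coord p w).2 * d -
      w 0 * ((surfDerivFrom C.coord p (planeCoord.symm (1, 0))).2 * d), ?_⟩
    rw [inwardVec, C.surfDeriv_eq_add hp hd w, C.surfDeriv_eq_add hp hd (planeCoord.symm (1, 0)),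
      h w, h (planeCoord.symm (1, 0)), h1]
    module
  · set e₁ : E2 := planeCoord.symm (0, 1)
    set l := (surfDerivFrom C.coord p e₁).2 with hl
    have hl0 : l ≠ 0 := by
      intro hl0
      have h2 : e₁ = 0 := C.coord_injective e₁ (Prod.ext (by rw [h, h0]; simp) hl0)
      rw [map_eq_zero_iff _ planeCoord.symm.injective] at h2
      simp at h2
    refine ⟨(l * d)⁻¹ • e₁, by simp [h0], ?_⟩
    rw [map_smul, C.surfDeriv_eq_add hp hd e₁, h, h0, mul_zero, zero_smul, zero_add, smul_smul,
      inv_mul_cancel₀ (mul_ne_zero hl0 hd0), one_smul]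
  · obtain ⟨m, hm, c, hc⟩ := C.exists_inwardVec_eq hp hd
    have h2 : derivTo C.ext (C.coord p)
        (m • ((1 : ℝ), (0 : ℝ)) + ((c - a) / d) • ((0 : ℝ), (1 : ℝ))) = 0 := by
      rw [C.coord_eq_zero hp, map_add, map_smul, map_smul, hd, smul_smul, div_mul_cancel₀ _ hd0,
        sub_smul, ← ha, hc]
      abel
    have h3 := congrArg Prod.fst (C.ext_injective _ h2)
    simp at h3
    exact hm.ne' h3

lemma tendsto_coordInv_interior (hp : p ∈ (𝓡∂ 2).boundary S) :
    Tendsto C.coordInv (𝓝[{u | 0 < u.1}] 0) (𝓝[(𝓡∂ 2).interior S] p) ∧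
      ∀ᶠ u in 𝓝[{u : ℝ × ℝ | 0 < u.1}] 0, C.coordInv u ∈ C.source ∧ C.coord (C.coordInv u) = u := by
  have hle : 𝓝[{u : ℝ × ℝ | 0 < u.1}] 0 ≤ 𝓝[{u : ℝ × ℝ | 0 ≤ u.1}] (C.coord p) := by
    rw [C.coord_eq_zero hp]
    exact nhdsWithin_mono _ fun u (hu : 0 < u.1) => hu.le
  have h1 := C.tendsto_coordInv.mono_left hle
  have h2 : ∀ᶠ u in 𝓝[{u : ℝ × ℝ | 0 < u.1}] 0,
      C.coordInv u ∈ C.source ∧ C.coord (C.coordInv u) = u :=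
    (h1.eventually C.source_mem).and (C.right_inv.filter_mono hle)
  refine ⟨tendsto_nhdsWithin_iff.2 ⟨h1, ?_⟩, h2⟩
  filter_upwards [h2, self_mem_nhdsWithin] with u hu hu0
  rw [C.interior_iff _ hu.1, hu.2]
  exact hu0

lemma mem_closure_interior (C : SurfaceChart f p) : p ∈ closure ((𝓡∂ 2).interior S) := by
  by_cases hp : p ∈ (𝓡∂ 2).boundary S
  · rw [mem_closure_iff_nhdsWithin_neBot]
    have : (𝓝[{u : ℝ × ℝ | 0 < u.1}] (0 : ℝ × ℝ)).NeBot := by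
      rw [← mem_closure_iff_nhdsWithin_neBot]
      have h1 : Tendsto (fun t : ℝ => (t, (0 : ℝ))) (𝓝[>] 0) (𝓝 0) :=
        ((Continuous.prodMk_left (0 : ℝ)).tendsto' 0 0 rfl).mono_left nhdsWithin_le_nhds
      exact mem_closure_of_tendsto h1 (by filter_upwards [self_mem_nhdsWithin] with t ht using ht)
    exact (C.tendsto_coordInv_interior hp).1.neBot
  · apply subset_closure
    rw [← ModelWithCorners.compl_boundary]
    exact hp

lemma tendsto_coord_interior (hp : p ∈ (𝓡∂ 2).boundary S) :
    Tendsto C.coord (𝓝[(𝓡∂ 2).interior S] p) (𝓝[{u | 0 < u.1}] 0) := by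
  have h1 := C.continuousAt_coord
  rw [ContinuousAt, C.coord_eq_zero hp] at h1
  refine tendsto_nhdsWithin_iff.2 ⟨h1.mono_left nhdsWithin_le_nhds, ?_⟩
  filter_upwards [self_mem_nhdsWithin, nhdsWithin_le_nhds C.source_mem] with q hq hqs
  exact (C.interior_iff q hqs).1 hq

end SurfaceChart

end InwardVec

end ReebSection

namespace ReebSection

open Set Filter

/-! ### The projected surface near the boundary. -/

section BoundaryBehaviour

variable {N : Type*} [TopologicalSpace N] [ChartedSpace E3 N] [IsManifold (𝓡 3) ∞ N]
variable {S : Type*} [TopologicalSpace S] [ChartedSpace (EuclideanHalfSpace 2) S]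
variable [IsManifold (𝓡∂ 2) ∞ S] {f : S → N} {p : S} {X : VField N} {ψ : Flow ℝ N}

omit [IsManifold (𝓡 3) ∞ N] in
lemma FlowBox.derivFrom_proj_field {x : N} (hψ : IsFlowOf ψ X) (b : FlowBox X ψ x) :
    derivFrom b.proj x (fieldVec X x) = 0 := by
  have h1 := hψ.hasDerivAt_comp_orbit (P := b.proj) (t := 0) (x := x)
    (by rw [ψ.map_zero_apply]; exact b.smooth_proj.mdifferentiableAt (by simp))
  rw [ψ.map_zero_apply] at h1
  exact h1.unique ((hasDerivAt_const (0 : ℝ) (0 : ℝ × ℝ)).congr_of_eventuallyEq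
    (b.eventually_proj_flow.mono fun s hs => hs.1))

/-- In a flow box around a point of the orbit of a boundary point, the surface transported by the
flow leaves the orbit in the direction of the transported inward vector. -/
theorem exists_tendsto_inv_smul_proj (hψ : IsFlowOf ψ X) (hX : ∀ x, fieldVec X x ≠ 0)
    (hf : Manifold.IsImmersion (𝓡∂ 2) (𝓡 3) ∞ f)
    (hp : p ∈ (𝓡∂ 2).boundary S) (htr : TraceTransverseAt X ψ f p) :
    ∃ ρ : S → ℝ, (∀ᶠ q in 𝓝[(𝓡∂ 2).interior S] p, 0 < ρ q) ∧
      ∀ (t : ℝ) (y : N), y = ψ t (f p) → ∀ b : FlowBox X ψ y,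
        Tendsto (fun q => (ρ q)⁻¹ • b.proj (ψ t (f q))) (𝓝[(𝓡∂ 2).interior S] p)
          (𝓝 (derivFrom b.proj y (flowDeriv ψ t (f p) (inwardVec f p)))) := by
  obtain ⟨C⟩ := exists_surfaceChart hf p
  obtain ⟨b₀⟩ := exists_flowBox hψ (hX (f p))
  obtain ⟨⟨σ, hσ, hext⟩, ⟨d, hd0, hd⟩, -⟩ := C.boundary_structure hψ hp htr b₀
  obtain ⟨m, hm, a, ha⟩ := C.exists_inwardVec_eq hp hd
  have hcoord := C.tendsto_coord_interior hp
  -- Dividing by m, the ratio between the inward vector and ∂₁ of the extension modulo X, makes the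
  -- limit exact; the same scale serves all t and all flow boxes.
  refine ⟨fun q => (C.coord q).1 / m, ?_, ?_⟩
  · filter_upwards [hcoord.eventually self_mem_nhdsWithin] with q hq
    exact div_pos hq hm
  · rintro t y rfl b
    have hP : ContMDiffAt (𝓡 3) 𝓘(ℝ, ℝ × ℝ) ∞ (fun y => b.proj (ψ t y)) (f p) :=
      b.smooth_proj.comp (f p) (hψ.contMDiffAt t (f p))
    have hg := C.smoothAt_proj_comp hP
    rw [C.coord_eq_zero hp] at hg
    have hP' := hP.mdifferentiableAt (by simp)
    have h0 : ∀ᶠ s in 𝓝 (0 : ℝ), b.proj (ψ t (C.ext (0, s))) = 0 := by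
      filter_upwards [hext, hσ.eventually b.eventually_proj_flow] with s hs hs'
      rw [hs, ← ψ.map_add, add_comm, ψ.map_add, hs'.1]
    have hlim := (tendsto_inv_smul_of_vanishing_on_axis hg h0).comp hcoord
    have hD : derivFrom b.proj (ψ t (f p)) (flowDeriv ψ t (f p) (inwardVec f p)) =
        m • fderiv ℝ (fun u => b.proj (ψ t (C.ext u))) 0 (1, 0) := by
      rw [fderiv_comp_derivTo (P := fun y => b.proj (ψ t y))
        (by rw [← C.eq_ext_zero hp]; exact hP') (C.mdifferentiableAt_ext_zero hp),
        ← C.eq_ext_zero hp, derivFrom_comp_flow (hψ.mdifferentiableAt t (f p))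
        (b.smooth_proj.mdifferentiableAt (by simp)), ha, map_add, map_add, map_smul, map_smul,
        map_smul, map_smul, hψ.flowDeriv_field, b.derivFrom_proj_field hψ, smul_zero, add_zero]
    rw [hD]
    refine (hlim.const_smul m).congr' ?_
    filter_upwards [nhdsWithin_le_nhds C.source_mem] with q hq
    rw [Function.comp, ← C.eq_ext q hq, smul_smul, inv_div, div_eq_mul_inv]

/-- In a flow box around a boundary point, the projection of the surface along the flow is
injective, and it contains all the directions close to that of the inward vector. -/
theorem exists_injOn_proj_boundary (hψ : IsFlowOf ψ X)
    (hf : Manifold.IsImmersion (𝓡∂ 2) (𝓡 3) ∞ f)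
    (hp : p ∈ (𝓡∂ 2).boundary S) (htr : TraceTransverseAt X ψ f p) (b : FlowBox X ψ (f p)) :
    (∃ W ∈ 𝓝 p, InjOn (fun q => b.proj (f q)) (W ∩ (𝓡∂ 2).interior S)) ∧
    ∀ W ∈ 𝓝 p, ∀ {ι : Type*} (l : Filter ι) (y : ι → ℝ × ℝ) (ρ : ι → ℝ) (μ : ℝ), 0 < μ →
      Tendsto y l (𝓝 0) → (∀ᶠ n in l, 0 < ρ n) →
      Tendsto (fun n => (ρ n)⁻¹ • y n) l
        (𝓝 (μ • derivFrom b.proj (f p) (inwardVec f p))) →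
      ∀ᶠ n in l, ∃ q ∈ W, b.proj (f q) = y n := by
  obtain ⟨C⟩ := exists_surfaceChart hf p
  obtain ⟨⟨σ, hσ, hext⟩, ⟨d, hd0, hd⟩, e, k, he, hk, hdet⟩ := C.boundary_structure hψ hp htr b
  obtain ⟨m, hm, a, ha⟩ := C.exists_inwardVec_eq hp hd
  have hg := C.smoothAt_proj_comp b.smooth_proj
  rw [C.coord_eq_zero hp] at hg
  have h0 : ∀ᶠ s in 𝓝 (0 : ℝ), b.proj (C.ext (0, s)) = 0 := by
    filter_upwards [hext, hσ.eventually b.eventually_proj_flow] with s hs hs'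
    rw [hs, hs'.1]
  obtain ⟨⟨A, hA, hinj⟩, hsurj⟩ := polar_chart hg h0 he hk hdet
  have hcoord := C.continuousAt_coord
  rw [ContinuousAt, C.coord_eq_zero hp] at hcoord
  refine ⟨⟨C.coord ⁻¹' A ∩ C.source, inter_mem (hcoord hA) C.source_mem, ?_⟩, ?_⟩
  · rintro q ⟨⟨hqA, hqs⟩, hq⟩ r ⟨⟨hrA, hrs⟩, hr⟩ hqr
    simp only [C.eq_ext q hqs, C.eq_ext r hrs] at hqr
    have h1 := hinj ⟨hqA, (C.interior_iff q hqs).1 hq⟩ ⟨hrA, (C.interior_iff r hrs).1 hr⟩ hqr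
    rw [← C.left_inv q hqs, h1, C.left_inv r hrs]
  · intro W hW ι l y ρ μ hμ hy hρ hlim
    have hD : derivFrom b.proj (f p) (inwardVec f p) = m • e := by
      rw [← he, fderiv_comp_derivTo (P := b.proj)
        (by rw [← C.eq_ext_zero hp]; exact b.smooth_proj.mdifferentiableAt (by simp))
        (C.mdifferentiableAt_ext_zero hp), ← C.eq_ext_zero hp, ha, map_add, map_smul, map_smul,
        b.derivFrom_proj_field hψ, smul_zero, add_zero]
    rw [hD, smul_smul] at hlim
    have h1 := (C.tendsto_coordInv_interior hp).1.mono_right nhdsWithin_le_nhds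
    have hA' := eventually_nhdsWithin_iff.1
      ((h1.eventually hW).and (C.tendsto_coordInv_interior hp).2)
    filter_upwards [hsurj _ hA' l y ρ (μ * m) (mul_pos hμ hm) hy hρ hlim] with n ⟨u, huA, hu0, hu⟩
    obtain ⟨h2, h3, h4⟩ := huA hu0
    exact ⟨C.coordInv u, h2, by rw [C.eq_ext _ h3, h4, hu]⟩

end BoundaryBehaviour

end ReebSection

namespace ReebSection

open Set Filter

/-! ### The interior of the surface, and its disjointness from boundary orbits. -/

section InteriorBehaviour

variable {N : Type*} [TopologicalSpace N] [ChartedSpace E3 N] [IsManifold (𝓡 3) ∞ N]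
variable {S : Type*} [TopologicalSpace S] [ChartedSpace (EuclideanHalfSpace 2) S]
variable [IsManifold (𝓡∂ 2) ∞ S] {f : S → N} {p q : S} {X : VField N} {ψ : Flow ℝ N}

omit [IsManifold (𝓡 3) ∞ N] in
/-- Near an interior point, the surface is a section of a flow box. -/
theorem exists_section_proj (hf : Manifold.IsImmersion (𝓡∂ 2) (𝓡 3) ∞ f)
    (hq : q ∈ (𝓡∂ 2).interior S) (htr : (X (f q) : E3) ∉ range (surfDeriv f q))
    (b : FlowBox X ψ (f q)) :
    (∃ W ∈ 𝓝 q, InjOn (fun r => b.proj (f r)) W) ∧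
    ∃ j : ℝ × ℝ → S, Tendsto j (𝓝 0) (𝓝 q) ∧ (∀ᶠ y in 𝓝 0, b.proj (f (j y)) = y) ∧
      ∀ᶠ y in 𝓝 0, ContinuousAt (fun y => f (j y)) y := by
  obtain ⟨C⟩ := exists_surfaceChart hf q
  have hg := C.smoothAt_proj_comp b.smooth_proj
  have hext := C.eventually_mdifferentiableAt_ext
  have hfq := C.eq_ext q C.mem_source
  have hpos : 0 < (C.coord q).1 := (C.interior_iff q C.mem_source).1 hq
  have hsurj : Function.Surjective (surfDerivFrom C.coord q : E2 →ₗ[ℝ] ℝ × ℝ) :=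
    (LinearMap.injective_iff_surjective_of_finrank_eq_finrank (by simp)).1
      ((injective_iff_map_eq_zero _).2 C.coord_injective)
  obtain ⟨Φ, hΦ, hΦ0⟩ := exists_openPartialHomeomorph_of_injective rfl
    (hg.hasStrictFDerivAt (by simp)) (by
      intro v hv
      rw [fderiv_comp_derivTo (P := b.proj)
        (by rw [← hfq]; exact b.smooth_proj.mdifferentiableAt (by simp)) hext.self_of_nhds,
        ← hfq] at hv
      obtain ⟨a, ha⟩ := b.ker _ hv
      obtain ⟨w, hw⟩ := hsurj v
      have h1 : surfDeriv f q w = a • fieldVec X (f q) := by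
        rw [C.surfDeriv_eq C.mem_source hext.self_of_nhds, ← ha]
        exact congrArg _ hw
      -- The kernel of the projected derivative is ℝX; a nonzero multiple of X in the tangent plane
      -- would violate transversality.
      by_cases ha0 : a = 0
      · rw [ha0, zero_smul] at ha
        exact C.ext_injective v ha
      · refine absurd ⟨a⁻¹ • w, ?_⟩ htr
        rw [map_smul, h1, smul_smul, inv_mul_cancel₀ ha0, one_smul]
        rfl)
  have hΦq : Φ (C.coord q) = 0 := by rw [hΦ, ← hfq, b.proj_self]
  have hsrc := C.continuousAt_coord.eventually_mem (Φ.open_source.mem_nhds hΦ0)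
  have htgt : Φ.target ∈ 𝓝 (0 : ℝ × ℝ) :=
    Φ.open_target.mem_nhds (by rw [← hΦq]; exact Φ.map_source hΦ0)
  refine ⟨⟨_, inter_mem hsrc C.source_mem, ?_⟩, ?_⟩
  · rintro r ⟨hr, hrs⟩ s ⟨hs, hss⟩ hrs'
    simp only [C.eq_ext r hrs, C.eq_ext s hss] at hrs'
    rw [← hΦ, ← hΦ] at hrs'
    rw [← C.left_inv r hrs, Φ.injOn hr hs hrs', C.left_inv s hss]
  · have hnhds : 𝓝[{u : ℝ × ℝ | 0 ≤ u.1}] C.coord q = 𝓝 (C.coord q) :=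
      nhdsWithin_eq_nhds.2
        (mem_of_superset ((isOpen_lt continuous_const continuous_fst).mem_nhds hpos)
          fun u (hu : 0 < u.1) => hu.le)
    have hinv := C.tendsto_coordInv
    have hright := C.right_inv
    rw [hnhds] at hinv hright
    have hsymm : Tendsto Φ.symm (𝓝 0) (𝓝 (C.coord q)) := by
      have := Φ.symm.continuousAt (x := 0) (mem_of_mem_nhds htgt)
      rwa [ContinuousAt, ← hΦq, Φ.left_inv hΦ0, hΦq] at this
    have hj : ∀ᶠ y in 𝓝 (0 : ℝ × ℝ), f (C.coordInv (Φ.symm y)) = C.ext (Φ.symm y) := by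
      filter_upwards [hsymm.eventually hright, hsymm.eventually (hinv.eventually C.source_mem)]
        with y hy hys
      rw [C.eq_ext _ hys, hy]
    refine ⟨fun y => C.coordInv (Φ.symm y), hinv.comp hsymm, ?_, ?_⟩
    · filter_upwards [hj, htgt] with y hy hyt
      rw [hy, ← hΦ, Φ.right_inv hyt]
    · filter_upwards [hj.eventually_nhds, Φ.open_target.mem_nhds (mem_of_mem_nhds htgt),
        hsymm.eventually hext] with y hy hyt hys
      refine ContinuousAt.congr ?_ (EventuallyEq.symm hy)
      exact ContinuousAt.comp (f := Φ.symm) hys.continuousAt (Φ.symm.continuousAt hyt)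

/-- The interior of an embedded surface of section does not meet its boundary orbits. -/
theorem IsSurfaceOfSection.map_ne_of_interior [T2Space S] (hψ : IsFlowOf ψ X)
    (hX : ∀ x, fieldVec X x ≠ 0) (hf : IsSurfaceOfSection X ψ f)
    (hp : p ∈ (𝓡∂ 2).boundary S) (htr : TraceTransverseAt X ψ f p)
    (hq : q ∈ (𝓡∂ 2).interior S) : f p ≠ f q := by
  intro hpq
  obtain ⟨C⟩ := exists_surfaceChart hf.immersion p
  obtain ⟨b⟩ := exists_flowBox hψ (hX (f q))
  obtain ⟨-, j, hj, hjproj, hjcont⟩ := exists_section_proj hf.immersion hq (hf.transverse q hq) b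
  have haxis : (∃ σ : ℝ → ℝ, Tendsto σ (𝓝 0) (𝓝 0) ∧ ∀ᶠ s in 𝓝 0, C.ext (0, s) = ψ (σ s) (f q)) ∧
      ∃ d ≠ (0 : ℝ), derivTo C.ext 0 (0, 1) = d • fieldVec X (f q) := by
    obtain ⟨b'⟩ := exists_flowBox hψ (hX (f p))
    obtain ⟨h1, h2, -⟩ := C.boundary_structure hψ hp htr b'
    rw [← hpq]
    exact ⟨h1, h2⟩
  obtain ⟨⟨σ, hσ, hext⟩, d, hd0, hd⟩ := haxis
  have hj0 : j 0 = q := by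
    have h1 : Tendsto j (pure 0) (𝓝 q) := hj.mono_left (pure_le_nhds 0)
    rw [tendsto_pure_left] at h1
    by_contra h
    exact h1 _ (isOpen_compl_singleton.mem_nhds (Ne.symm h)) rfl
  have hpq' : p ≠ q := by
    rintro rfl
    rw [← ModelWithCorners.compl_boundary] at hq
    exact hq hp
  obtain ⟨Wp, Wq, hWp, hWq, hpW, hqW, hdisj⟩ := t2_separation hpq'
  have hFd : ∀ᶠ u in 𝓝 (0 : ℝ × ℝ), MDifferentiableAt 𝓘(ℝ, ℝ × ℝ) (𝓡 3) C.ext u := by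
    rw [← C.coord_eq_zero hp]; exact C.eventually_mdifferentiableAt_ext
  have hFc : Tendsto C.ext (𝓝 0) (𝓝 (f q)) := by
    rw [← hpq, C.eq_ext_zero hp]; exact hFd.self_of_nhds.continuousAt
  have hPc : ∀ᶠ y in 𝓝 (f q), ContinuousAt b.proj y ∧ ContinuousAt b.time y := by
    have h1 : ContMDiffAt (𝓡 3) 𝓘(ℝ, ℝ × ℝ) 1 b.proj (f q) := b.smooth_proj.of_le (by simp)
    have h2 : ContMDiffAt (𝓡 3) 𝓘(ℝ, ℝ) 1 b.time (f q) := b.smooth_time.of_le (by simp)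
    filter_upwards [(contMDiffAt_iff_contMDiffAt_nhds (by simp)).1 h1,
      (contMDiffAt_iff_contMDiffAt_nhds (by simp)).1 h2] with y hy hy'
    exact ⟨hy.continuousAt, hy'.continuousAt⟩
  set P : ℝ × ℝ → ℝ × ℝ := fun u => b.proj (C.ext u) with hP
  have hP0 : Tendsto P (𝓝 0) (𝓝 0) := b.tendsto_proj.comp hFc
  -- The flow time separating the sheet near `p` from the sheet through `q` on the same flow line.
  -- On the boundary axis the second sheet is met only at `q`, while the first runs along the orbit,
  -- so φ has derivative d ≠ 0 there.
  set φ : ℝ × ℝ → ℝ := fun u => b.time (C.ext u) - b.time (f (j (P u))) with hφ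
  have hfj : Tendsto (fun u => f (j (P u))) (𝓝 0) (𝓝 (f q)) := by
    have h1 := (hjcont.self_of_nhds.tendsto).comp hP0
    rw [hj0] at h1
    exact h1
  have hφc : ∀ᶠ u in 𝓝 0, ContinuousAt φ u := by
    filter_upwards [hFd, hFc.eventually hPc, hP0.eventually hjcont, hfj.eventually hPc]
      with u h1 h2 h3 h4
    have h5 : ContinuousAt P u := ContinuousAt.comp (f := C.ext) h2.1 h1.continuousAt
    refine ContinuousAt.sub (ContinuousAt.comp (f := C.ext) h2.2 h1.continuousAt) ?_
    exact ContinuousAt.comp (f := fun u => f (j (P u))) h4.2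
      (ContinuousAt.comp (g := fun y => f (j y)) (f := P) h3 h5)
  -- a common zero of `φ` in the interior gives a double point of `f`
  have hkey : ∀ᶠ u in 𝓝 (0 : ℝ × ℝ), 0 < u.1 → φ u ≠ 0 := by
    have h1 := eventually_nhdsWithin_iff.1
      ((C.tendsto_coordInv_interior hp).2.and
        ((C.tendsto_coordInv_interior hp).1.eventually
          (inter_mem self_mem_nhdsWithin (nhdsWithin_le_nhds (hWp.mem_nhds hpW)))))
    have h2 : ∀ᶠ u in 𝓝 (0 : ℝ × ℝ), j (P u) ∈ Wq ∩ (𝓡∂ 2).interior S := by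
      refine (hj.comp hP0).eventually_mem (inter_mem (hWq.mem_nhds hqW) ?_)
      exact (ModelWithCorners.isOpen_interior (n := ∞) (by simp)).mem_nhds hq
    filter_upwards [h1, h2, hP0.eventually hjproj,
      (hFc.prodMk_nhds hfj).eventually b.eventually_eq_flow] with u hu1 hu2 hu3 hu4 hu0 hφ0
    obtain ⟨⟨hs, hc⟩, hint, hW⟩ := hu1 hu0
    have h3 := hu4 hu3.symm
    have h4 : b.time (f (j (P u))) - b.time (C.ext u) = 0 := by
      rw [hφ] at hφ0; simp only at hφ0; linarith
    rw [h4, ψ.map_zero_apply] at h3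
    have h5 : f (C.coordInv u) = f (j (P u)) := by rw [C.eq_ext _ hs, hc, h3]
    have h6 := hf.embedding.injective (a₁ := ⟨_, hint⟩) (a₂ := ⟨_, hu2.2⟩) h5
    have h7 : C.coordInv u = j (P u) := congrArg Subtype.val h6
    exact Set.disjoint_left.1 hdisj hW (by rw [h7]; exact hu2.1)
  obtain ⟨ε, hε, hball⟩ := Metric.eventually_nhds_iff.1 (hφc.and hkey)
  have hmem : ∀ {r s : ℝ}, |r| < ε → |s| < ε → ContinuousAt φ (r, s) ∧ (0 < r → φ (r, s) ≠ 0) := by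
    intro r s hr hs
    have := hball (y := (r, s)) (by
      rw [dist_zero_right, Prod.norm_def]; exact max_lt hr hs)
    exact this
  have hax : Tendsto (fun s : ℝ => ((0 : ℝ), s)) (𝓝 0) (𝓝 0) :=
    (Continuous.prodMk_right (0 : ℝ)).tendsto 0
  have hφ0 : HasDerivAt (fun s : ℝ => φ (0, s)) d 0 := by
    have h1 : HasDerivAt (fun s : ℝ => b.time (C.ext (0, s))) d 0 := by
      have hdt : MDifferentiableAt (𝓡 3) 𝓘(ℝ, ℝ) b.time (C.ext 0) := by
        rw [← C.eq_ext_zero hp, hpq]; exact b.smooth_time.mdifferentiableAt (by simp)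
      have h2 : DifferentiableAt ℝ (fun u => b.time (C.ext u)) (0, 0) :=
        (hdt.comp (0 : ℝ × ℝ) hFd.self_of_nhds).differentiableAt
      have h3 := HasFDerivAt.comp_hasDerivAt (0 : ℝ) h2.hasFDerivAt
        ((hasDerivAt_const (0 : ℝ) (0 : ℝ)).prodMk (hasDerivAt_id (0 : ℝ)))
      convert! h3 using 1
      have h4 := fderiv_comp_derivTo hdt hFd.self_of_nhds (0, 1)
      refine Eq.trans ?_ h4.symm
      rw [← C.eq_ext_zero hp, hpq, hd, map_smul]
      have h5 := hψ.hasDerivAt_comp_orbit (P := b.time) (t := 0) (x := f q)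
        (by rw [ψ.map_zero_apply]; exact b.smooth_time.mdifferentiableAt (by simp))
      rw [ψ.map_zero_apply] at h5
      rw [h5.unique ((hasDerivAt_id (0 : ℝ)).congr_of_eventuallyEq
        (b.eventually_proj_flow.mono fun s hs => hs.2))]
      simp
    refine h1.congr_of_eventuallyEq ?_
    filter_upwards [hext, hσ.eventually b.eventually_proj_flow] with s hs hs'
    have h2 : P (0, s) = 0 := by rw [hP]; simp only; rw [hs, hs'.1]
    simp only [hφ, h2, hj0, b.time_self, sub_zero]
  have hφ00 : φ (0, 0) = 0 := by
    have h1 : P (0, 0) = 0 := by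
      change b.proj (C.ext 0) = 0
      rw [← C.eq_ext_zero hp, hpq, b.proj_self]
    have h2 : C.ext (0, 0) = f q := by rw [← hpq]; exact (C.eq_ext_zero hp).symm
    simp only [hφ, h1, hj0, h2, sub_self]
  have hsmall : ∀ᶠ s in 𝓝 (0 : ℝ), |s| < ε := by
    exact (continuous_abs.tendsto' (0 : ℝ) 0 abs_zero).eventually_lt_const hε
  -- φ changes sign on the axis, hence on a parallel line r > 0, where a zero is an intersection of
  -- two disjoint pieces of the interior.
  obtain ⟨s₁, hs₁, hs₁ε⟩ : ∃ s, φ (0, s) < 0 ∧ |s| < ε := by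
    have h1 : ¬ IsLocalMin (fun s : ℝ => φ (0, s)) 0 := fun h => hd0 (h.hasDerivAt_eq_zero hφ0)
    rw [IsLocalMin, IsMinFilter, not_eventually] at h1
    obtain ⟨s, hs, hs'⟩ := (h1.and_eventually hsmall).exists
    exact ⟨s, by simpa only [hφ00, not_le] using hs, hs'⟩
  obtain ⟨s₂, hs₂, hs₂ε⟩ : ∃ s, 0 < φ (0, s) ∧ |s| < ε := by
    have h1 : ¬ IsLocalMax (fun s : ℝ => φ (0, s)) 0 := fun h => hd0 (h.hasDerivAt_eq_zero hφ0)
    rw [IsLocalMax, IsMaxFilter, not_eventually] at h1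
    obtain ⟨s, hs, hs'⟩ := (h1.and_eventually hsmall).exists
    exact ⟨s, by simpa only [hφ00, not_le] using hs, hs'⟩
  have hc : ∀ s : ℝ, |s| < ε → Tendsto (fun r : ℝ => φ (r, s)) (𝓝[>] 0) (𝓝 (φ (0, s))) := by
    intro s hs
    have h1 := (hmem (r := 0) (s := s) (by simpa using hε) hs).1
    exact (ContinuousAt.comp (f := fun r : ℝ => (r, s)) h1
      (by fun_prop)).tendsto.mono_left nhdsWithin_le_nhds
  obtain ⟨r, hr₁, hr₂, hr0, hrε⟩ := ((hc s₁ hs₁ε).eventually_lt_const hs₁ |>.and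
    (((hc s₂ hs₂ε).eventually_const_lt hs₂).and
      ((eventually_mem_nhdsWithin (s := Ioi (0 : ℝ))).and (nhdsWithin_le_nhds hsmall)))).exists
  have hseg : ∀ s ∈ uIcc s₁ s₂, |s| < ε := by
    intro s hs
    have h1 : uIcc s₁ s₂ ⊆ Ioo (-ε) ε :=
      (ordConnected_Ioo).uIcc_subset (abs_lt.1 hs₁ε) (abs_lt.1 hs₂ε)
    exact abs_lt.2 (h1 hs)
  have hcont : ContinuousOn (fun s : ℝ => φ (r, s)) (uIcc s₁ s₂) := fun s hs =>
    (ContinuousAt.comp (f := fun s : ℝ => (r, s)) (hmem hrε (hseg s hs)).1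
      (by fun_prop)).continuousWithinAt
  obtain ⟨s, hs, hs0⟩ := intermediate_value_uIcc hcont (mem_uIcc_of_le hr₁.le hr₂.le)
  exact (hmem hrε (hseg s hs)).2 hr0 hs0

end InteriorBehaviour

end ReebSection

namespace ReebSection

open Set Filter

/-! ### Limits of first returns, and closed orbits. -/

section Returns

/-- Both sequences are positive multiples of `y`, and the quotient of their norms, which converges,
is the factor between them. -/
lemma eq_smul_of_tendsto_inv_smul {ι E : Type*} [NormedAddCommGroup E] [NormedSpace ℝ E]
    {l : Filter ι} [l.NeBot] {y : ι → E} {ρ ρ' : ι → ℝ} {a a' : E} (hρ : ∀ᶠ n in l, 0 < ρ n)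
    (hρ' : ∀ᶠ n in l, 0 < ρ' n) (ha : Tendsto (fun n => (ρ n)⁻¹ • y n) l (𝓝 a))
    (ha' : Tendsto (fun n => (ρ' n)⁻¹ • y n) l (𝓝 a')) (h0 : a ≠ 0) (h0' : a' ≠ 0) :
    ∃ μ : ℝ, 0 < μ ∧ a = μ • a' := by
  refine ⟨‖a‖ / ‖a'‖, div_pos (norm_pos_iff.2 h0) (norm_pos_iff.2 h0'), ?_⟩
  have h1 : Tendsto (fun n => (‖(ρ n)⁻¹ • y n‖ / ‖(ρ' n)⁻¹ • y n‖) • ((ρ' n)⁻¹ • y n)) l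
      (𝓝 ((‖a‖ / ‖a'‖) • a')) := (ha.norm.div ha'.norm (norm_ne_zero_iff.2 h0')).smul ha'
  refine tendsto_nhds_unique ha (h1.congr' ?_)
  filter_upwards [hρ, hρ', ha'.eventually_ne h0'] with n hn hn' hy
  have hy0 : ‖y n‖ ≠ 0 := by
    rw [norm_ne_zero_iff]
    rintro h
    exact hy (by rw [h, smul_zero])
  rw [norm_smul, norm_smul, smul_smul, Real.norm_of_nonneg (inv_nonneg.2 hn.le),
    Real.norm_of_nonneg (inv_nonneg.2 hn'.le)]
  congr 1
  field_simp

/-- A criterion for the convergence of first return maps. -/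
theorem exists_tendsto_return {S : Type*} [TopologicalSpace S] [CompactSpace S] {L : Filter S}
    [L.NeBot] {R : S → S} {τ : S → ℝ} {ℓ : ℝ} {K : S → Set ℝ} {H : ℝ → S → Prop}
    (hτ : ∀ᶠ x in L, IsLeast {t | 0 < t ∧ t ∈ K x} (τ x)) (hℓ : ∀ᶠ x in L, τ x ≤ ℓ)
    (hclosed : ∀ 𝒰 : Ultrafilter S, ↑𝒰 ≤ L → ∀ t q, Tendsto τ 𝒰 (𝓝 t) → Tendsto R 𝒰 (𝓝 q) →
      0 < t ∧ H t q)
    (hpersist : ∀ t q, 0 < t → H t q → ∀ ε > 0, ∀ᶠ x in L, ∃ s, |s - t| < ε ∧ s ∈ K x)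
    (hunique : ∀ t q q', H t q → H t q' → q = q') :
    ∃ t q, 0 < t ∧ H t q ∧ Tendsto R L (𝓝 q) := by
  have hlim : ∀ 𝒰 : Ultrafilter S, ↑𝒰 ≤ L → ∃ t q, Tendsto τ 𝒰 (𝓝 t) ∧ Tendsto R 𝒰 (𝓝 q) := by
    intro 𝒰 h𝒰
    obtain ⟨t, -, ht⟩ := (isCompact_Icc (a := (0 : ℝ)) (b := ℓ)).ultrafilter_le_nhds (𝒰.map τ) (by
      rw [le_principal_iff, Ultrafilter.mem_coe, Ultrafilter.mem_map]
      filter_upwards [h𝒰 hτ, h𝒰 hℓ] with x hx hx' using ⟨hx.1.1.le, hx'⟩)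
    obtain ⟨q, -, hq⟩ := isCompact_univ.ultrafilter_le_nhds (𝒰.map R) (by simp)
    exact ⟨t, q, ht, hq⟩
  -- A limit time along one ultrafilter persists as a return time for all nearby x, so minimality of
  -- τ bounds the limit along any other. By symmetry the limits agree.
  have hle : ∀ 𝒰 𝒰' : Ultrafilter S, ↑𝒰 ≤ L → ↑𝒰' ≤ L → ∀ t q t', Tendsto τ 𝒰 (𝓝 t) →
      Tendsto R 𝒰 (𝓝 q) → Tendsto τ 𝒰' (𝓝 t') → t' ≤ t := by
    intro 𝒰 𝒰' h𝒰 h𝒰' t q t' ht hq ht'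
    by_contra! hlt
    obtain ⟨ht0, hH⟩ := hclosed 𝒰 h𝒰 t q ht hq
    -- The bound t keeps the persisting time positive; the bound (t' − t)/2 keeps it away from t'.
    have h1 := hpersist t q ht0 hH (min t ((t' - t) / 2)) (lt_min ht0 (by linarith))
    have h2 : ∀ᶠ x in (𝒰' : Filter S), τ x ≤ t + (t' - t) / 2 := by
      filter_upwards [h𝒰' h1, h𝒰' hτ] with x ⟨s, hs, hsK⟩ hx
      have h3 := abs_lt.1 (hs.trans_le (min_le_left _ _))
      have h4 := abs_lt.1 (hs.trans_le (min_le_right _ _))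
      exact (hx.2 ⟨by linarith, hsK⟩).trans (by linarith)
    have := le_of_tendsto ht' h2
    linarith
  obtain ⟨t, q, ht, hq⟩ := hlim (Ultrafilter.of L) (Ultrafilter.of_le L)
  obtain ⟨ht0, hH⟩ := hclosed _ (Ultrafilter.of_le L) t q ht hq
  refine ⟨t, q, ht0, hH, tendsto_iff_ultrafilter _ _ _ |>.2 fun 𝒰 h𝒰 => ?_⟩
  obtain ⟨t', q', ht', hq'⟩ := hlim 𝒰 h𝒰
  have h1 : t' = t := le_antisymm
    (hle _ _ (Ultrafilter.of_le L) h𝒰 t q t' ht hq ht')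
    (hle _ _ h𝒰 (Ultrafilter.of_le L) t' q' t ht' hq' ht)
  have h2 := (hclosed 𝒰 h𝒰 t' q' ht' hq').2
  rw [h1] at h2
  rw [hunique t q q' hH h2]
  exact hq'

variable {N : Type*} [TopologicalSpace N] [ChartedSpace E3 N]
variable {S : Type*} [TopologicalSpace S]
variable {f : S → N} {p q : S} {X : VField N} {ψ : Flow ℝ N}

/-- Where the surface projects injectively along the flow, there are no short returns. -/
lemma FlowBox.not_tendsto_zero {ι : Type*} {l : Filter ι} [l.NeBot] (b : FlowBox X ψ (f p))
    (hf : ContinuousAt f p) {A : Set S} (hA : ∃ W ∈ 𝓝 p, InjOn (fun q => b.proj (f q)) (W ∩ A))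
    {x R : ι → S} {τ : ι → ℝ} (hx : Tendsto x l (𝓝[A] p)) (hR : Tendsto R l (𝓝 p))
    (hRA : ∀ᶠ n in l, R n ∈ A) (hτ : ∀ᶠ n in l, 0 < τ n)
    (h : ∀ᶠ n in l, ψ (τ n) (f (x n)) = f (R n)) : ¬ Tendsto τ l (𝓝 0) := by
  intro hτ0
  obtain ⟨W, hW, hinj⟩ := hA
  have h1 : Tendsto (fun n => (τ n, f (x n))) l (𝓝 (0, f p)) :=
    hτ0.prodMk_nhds (hf.tendsto.comp (hx.mono_right nhdsWithin_le_nhds))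
  have hxA := (tendsto_nhdsWithin_iff.1 hx).2
  have hxW := (tendsto_nhdsWithin_iff.1 hx).1.eventually hW
  obtain ⟨n, hfl, hn, hnA, hnW, hRn, hRW, hpos⟩ := (h1.eventually b.eventually_flow |>.and
    (h.and (hxA.and (hxW.and (hRA.and ((hR.eventually hW).and hτ)))))).exists
  simp only [hn] at hfl
  have h2 := hinj ⟨hRW, hRn⟩ ⟨hnW, hnA⟩ hfl.1
  rw [h2] at hfl
  linarith [hfl.2]

/-- Points that project to the surface along the flow meet it after a short time. -/
lemma FlowBox.eventually_exists_mem_range {ι : Type*} {l : Filter ι} (b : FlowBox X ψ (f q))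
    (hf : ContinuousAt f q) {y : ι → N} (hy : Tendsto y l (𝓝 (f q)))
    (hW : ∀ W ∈ 𝓝 q, ∀ᶠ n in l, ∃ r ∈ W, b.proj (f r) = b.proj (y n)) {ε : ℝ} (hε : 0 < ε) :
    ∀ᶠ n in l, ∃ s, |s| < ε ∧ ψ s (y n) ∈ range f := by
  have h1 : Tendsto (fun a : N × N => b.time a.2 - b.time a.1) (𝓝 (f q, f q)) (𝓝 0) := by
    have h2 : Tendsto (fun a : N × N => a.1) (𝓝 (f q, f q)) (𝓝 (f q)) :=
      continuous_fst.tendsto' _ _ rfl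
    have h3 : Tendsto (fun a : N × N => a.2) (𝓝 (f q, f q)) (𝓝 (f q)) :=
      continuous_snd.tendsto' _ _ rfl
    simpa using! (b.tendsto_time.comp h3).sub (b.tendsto_time.comp h2)
  have h4 : ∀ᶠ a : N × N in 𝓝 (f q, f q), |b.time a.2 - b.time a.1| < ε := by
    have h5 := h1.abs
    rw [abs_zero] at h5
    exact h5.eventually_lt_const hε
  obtain ⟨V, hV, V', hV', hVV⟩ := mem_nhds_prod_iff.1 (b.eventually_eq_flow.and h4)
  filter_upwards [hy hV, hW _ (hf hV')] with n hn ⟨r, hr, hrn⟩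
  obtain ⟨h5, h6⟩ := hVV (mk_mem_prod hn hr)
  exact ⟨_, h6, by rw [h5 hrn.symm]; exact mem_range_self r⟩

omit [ChartedSpace E3 N] in
lemma flow_mem_orbit_iff {y z : N} {t : ℝ} : ψ t y ∈ orbit ψ z ↔ y ∈ orbit ψ z := by
  constructor
  · rintro ⟨s, hs⟩
    refine ⟨-t + s, ?_⟩
    simp only at hs ⊢
    rw [ψ.map_add, hs, ← ψ.map_add, neg_add_cancel, ψ.map_zero_apply]
  · rintro ⟨s, rfl⟩
    exact ⟨t + s, ψ.map_add _ _ _⟩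

omit [ChartedSpace E3 N] in
lemma orbit_eq_of_mem {y z : N} (h : y ∈ orbit ψ z) : orbit ψ y = orbit ψ z := by
  obtain ⟨s, rfl⟩ := h
  ext w
  constructor
  · rintro ⟨t, rfl⟩
    exact ⟨t + s, ψ.map_add _ _ _⟩
  · rintro ⟨t, rfl⟩
    refine ⟨t - s, ?_⟩
    simp only [← ψ.map_add, sub_add_cancel]

omit [ChartedSpace E3 N] in
lemma HasPeriod.periodic {z : N} {T : ℝ} (h : HasPeriod ψ z T) :
    Function.Periodic (fun t => ψ t z) T := fun t => by
  simp only
  rw [ψ.map_add, h.1.2]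

omit [ChartedSpace E3 N] in
lemma HasPeriod.isCompact_orbit {z : N} {T : ℝ} (h : HasPeriod ψ z T)
    (hψ : Continuous fun t => ψ t z) : IsCompact (orbit ψ z) := by
  have h1 := h.periodic.image_Icc h.1.1 0
  rw [orbit, ← h1]
  exact isCompact_Icc.image hψ

omit [ChartedSpace E3 N] in
/-- The positive return times of a point of a closed orbit are the multiples of the period. -/
lemma HasPeriod.exists_nat_mul_eq {z : N} {T : ℝ} (h : HasPeriod ψ z T) {t : ℝ} (ht : 0 < t)
    (hz : ψ t z = z) : ∃ k : ℕ, 0 < k ∧ t = k * T := by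
  have hT := h.1.1
  -- The remainder lies in [0, T) and is again a return time, so minimality of T makes it zero.
  have h1 := h.periodic.sub_nat_mul_eq ⌊t / T⌋₊ (x := t)
  rw [hz] at h1
  have h2 := Nat.floor_le (div_pos ht hT).le
  have h3 := Nat.lt_floor_add_one (t / T)
  rw [le_div_iff₀ hT] at h2
  rw [div_lt_iff₀ hT] at h3
  have h4 : t - ⌊t / T⌋₊ * T = 0 := by
    by_contra h5
    have h6 := h.2 ⟨lt_of_le_of_ne (by linarith) (Ne.symm h5), h1⟩
    linarith
  refine ⟨⌊t / T⌋₊, ?_, by linarith⟩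
  rw [Nat.pos_iff_ne_zero]
  intro h5
  rw [h5] at h4
  simp at h4
  exact ht.ne' h4

end Returns

end ReebSection

namespace ReebSection

open Set Filter

/-! ### Boundary returns as a relation between rays. -/

section RotatingSection

variable {N : Type*} [TopologicalSpace N] [ChartedSpace E3 N] [IsManifold (𝓡 3) ∞ N]
variable {S : Type*} [TopologicalSpace S] [ChartedSpace (EuclideanHalfSpace 2) S]
variable [IsManifold (𝓡∂ 2) ∞ S]

omit [IsManifold (𝓡 3) ∞ N] in
/-- A surface of section of a flow without fixed points, with a rotating boundary orbit whose
trace on the unit normal bundle is embedded and transverse. -/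
structure RotatingSection (X : VField N) (ψ : Flow ℝ N) (f : S → N) (z : N) (T : ℝ) : Prop where
  flow : IsFlowOf ψ X
  field_ne_zero : ∀ x, fieldVec X x ≠ 0
  surface : IsSurfaceOfSection X ψ f
  period : HasPeriod ψ z T
  rotating : IsRotating ψ f (orbit ψ z)
  trace : HasTransverseTrace X ψ f (orbit ψ z)

/-- The relation between boundary points induced by the flow on the unit normal bundle:
the inward direction at `p` is transported by `ψ_t` to the inward direction at `q`. -/
def InwardRel (X : VField N) (ψ : Flow ℝ N) (f : S → N) (p : S) (t : ℝ) (q : S) : Prop :=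
  f q = ψ t (f p) ∧ ∃ μ : ℝ, 0 < μ ∧ ∃ a : ℝ,
    flowDeriv ψ t (f p) (inwardVec f p) = μ • inwardVec f q + a • fieldVec X (f q)

omit [IsManifold (𝓡 3) ∞ N] [IsManifold (𝓡∂ 2) ∞ S] in
lemma InwardRel.trans {X : VField N} {ψ : Flow ℝ N} {f : S → N} (hψ : IsFlowOf ψ X) {p q r : S}
    {s t : ℝ} (h : InwardRel X ψ f p s q) (h' : InwardRel X ψ f q t r) :
    InwardRel X ψ f p (t + s) r := by
  obtain ⟨hq, μ, hμ, a, h1⟩ := h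
  obtain ⟨hr, ν, hν, b, h2⟩ := h'
  refine ⟨by rw [hr, hq, ψ.map_add], ν * μ, mul_pos hν hμ, μ * b + a, ?_⟩
  rw [hψ.flowDeriv_add, h1, ← hq, map_add, map_smul, map_smul, h2, hψ.flowDeriv_field, ← hr]
  module

namespace RotatingSection

variable {X : VField N} {ψ : Flow ℝ N} {f : S → N} {z : N} {T : ℝ} {p q : S}

omit [IsManifold (𝓡 3) ∞ N] in
lemma continuous (h : RotatingSection X ψ f z T) : Continuous f := by
  rw [continuous_iff_continuousAt]
  intro p
  obtain ⟨C⟩ := exists_surfaceChart h.surface.immersion p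
  exact C.continuousAt_map

lemma isTangentToField (h : RotatingSection X ψ f z T) (hp : p ∈ boundaryOver f (orbit ψ z)) :
    IsTangentToField X f p := by
  obtain ⟨C⟩ := exists_surfaceChart h.surface.immersion p
  obtain ⟨b⟩ := exists_flowBox h.flow (h.field_ne_zero (f p))
  obtain ⟨-, ⟨d, hd0, hd⟩, -⟩ := C.boundary_structure h.flow hp.1 (h.trace.transverse p hp) b
  exact C.isTangentToField hp.1 hd0 hd

lemma mem_boundaryOver [T2Space S] (h : RotatingSection X ψ f z T) (hq : f q ∈ orbit ψ z) :
    q ∈ boundaryOver f (orbit ψ z) := by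
  refine ⟨?_, hq⟩
  rw [← ModelWithCorners.compl_interior]
  intro hint
  obtain ⟨p, hp, hpq⟩ := h.rotating.subset_boundary hq
  exact h.surface.map_ne_of_interior h.flow h.field_ne_zero hp
    (h.trace.transverse p ⟨hp, by rw [mem_preimage, hpq]; exact hq⟩) hint hpq

/-- dψ_t is invertible and carries X to X, so a vector that is not in ℝX stays outside ℝX. -/
lemma derivFrom_inwardVec_ne_zero (h : RotatingSection X ψ f z T)
    (hp : p ∈ boundaryOver f (orbit ψ z)) (t : ℝ) {y : N} (hy : y = ψ t (f p))
    (b : FlowBox X ψ y) : derivFrom b.proj y (flowDeriv ψ t (f p) (inwardVec f p)) ≠ 0 := by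
  subst hy
  intro h0
  obtain ⟨a, ha⟩ := b.ker _ h0
  refine (h.isTangentToField hp).ne_smul a ?_
  have h1 := congrArg (flowDeriv ψ (-t) (ψ t (f p))) ha
  rw [← h.flow.flowDeriv_add, neg_add_cancel, IsFlowOf.flowDeriv_zero, map_smul,
    h.flow.flowDeriv_field, ← ψ.map_add, neg_add_cancel, ψ.map_zero_apply] at h1
  exact h1

lemma inwardRel_unique (h : RotatingSection X ψ f z T) {r : S} {t : ℝ}
    (hq : q ∈ boundaryOver f (orbit ψ z)) (hr : r ∈ boundaryOver f (orbit ψ z))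
    (h1 : InwardRel X ψ f p t q) (h2 : InwardRel X ψ f p t r) : q = r := by
  obtain ⟨hfq, μ, hμ, a, hμa⟩ := h1
  obtain ⟨hfr, ν, hν, b, hνb⟩ := h2
  have hqr : f q = f r := hfq.trans hfr.symm
  refine h.trace.embedded hq hr (traceRay_eq_traceRay (μ := ν / μ) (a := (b - a) / μ)
    (h.isTangentToField hq) (h.isTangentToField hr) hqr (div_pos hν hμ) ?_)
  have h3 : μ • inwardVec f q = ν • inwardVec f r + (b - a) • fieldVec X (f r) := by
    rw [hμa, hqr] at hνb
    rw [sub_smul, ← add_sub_assoc, ← hνb]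
    abel
  have h4 := congrArg (fun v => μ⁻¹ • v) h3
  simp only [smul_smul, inv_mul_cancel₀ hμ.ne', one_smul, smul_add] at h4
  rw [h4, div_eq_inv_mul, div_eq_inv_mul]

omit [IsManifold (𝓡 3) ∞ N] in
/-- The limits of returns to the surface. -/
lemma map_eq_of_tendsto [T2Space N] (h : RotatingSection X ψ f z T) {ι : Type*} {l : Filter ι}
    [l.NeBot] {x R : ι → S} {τ : ι → ℝ} {t : ℝ} (hx : Tendsto x l (𝓝 p)) (hR : Tendsto R l (𝓝 q))
    (hτ : Tendsto τ l (𝓝 t)) (hret : ∀ᶠ n in l, ψ (τ n) (f (x n)) = f (R n)) :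
    f q = ψ t (f p) := by
  have h1 := (h.flow.continuous_uncurry.tendsto (t, f p)).comp
    (hτ.prodMk_nhds ((h.continuous.tendsto p).comp hx))
  have h2 := (h.continuous.tendsto q).comp hR
  exact tendsto_nhds_unique h2 (h1.congr' hret)

/-- Limit time 0 would give q = p by embeddedness, and a surface that projects injectively along the
flow has no short returns. -/
lemma pos_of_tendsto_interior [T2Space N] (h : RotatingSection X ψ f z T) {ι : Type*}
    {l : Filter ι} [l.NeBot] {x R : ι → S} {τ : ι → ℝ} {t : ℝ}
    (hp : p ∈ (𝓡∂ 2).interior S) (hq : q ∈ (𝓡∂ 2).interior S)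
    (hx : Tendsto x l (𝓝 p)) (hR : Tendsto R l (𝓝 q)) (hτ : Tendsto τ l (𝓝 t))
    (hτ0 : ∀ᶠ n in l, 0 < τ n) (hret : ∀ᶠ n in l, ψ (τ n) (f (x n)) = f (R n)) : 0 < t := by
  have ht : 0 ≤ t := ge_of_tendsto hτ (hτ0.mono fun n hn => hn.le)
  refine lt_of_le_of_ne ht ?_
  rintro rfl
  have h1 := h.map_eq_of_tendsto hx hR hτ hret
  rw [ψ.map_zero_apply] at h1
  obtain rfl : q = p := congrArg Subtype.val
    (h.surface.embedding.injective (a₁ := ⟨q, hq⟩) (a₂ := ⟨p, hp⟩) h1)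
  obtain ⟨b⟩ := exists_flowBox h.flow (h.field_ne_zero (f q))
  obtain ⟨⟨W, hW, hinj⟩, -⟩ := exists_section_proj h.surface.immersion hp
    (h.surface.transverse q hp) b
  exact b.not_tendsto_zero (A := univ) h.continuous.continuousAt
    ⟨W, hW, hinj.mono inter_subset_left⟩ (by rwa [nhdsWithin_univ]) hR (by simp) hτ0 hret hτ

/-- ψ_t(f x) and f(R x) lie on one short flow segment and share a projection; seen from `p` and from
`q`, it leaves the origin along the two rays, which must coincide. -/
lemma inwardRel_of_tendsto [T2Space N] [T2Space S] (h : RotatingSection X ψ f z T) {ι : Type*}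
    {l : Filter ι} [l.NeBot] {x R : ι → S} {τ : ι → ℝ} {t : ℝ}
    (hp : p ∈ boundaryOver f (orbit ψ z))
    (hx : Tendsto x l (𝓝[(𝓡∂ 2).interior S] p)) (hR : Tendsto R l (𝓝 q))
    (hRint : ∀ᶠ n in l, R n ∈ (𝓡∂ 2).interior S) (hτ : Tendsto τ l (𝓝 t))
    (hτ0 : ∀ᶠ n in l, 0 < τ n) (hret : ∀ᶠ n in l, ψ (τ n) (f (x n)) = f (R n)) :
    0 < t ∧ q ∈ boundaryOver f (orbit ψ z) ∧ InwardRel X ψ f p t q := by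
  have hx' := hx.mono_right nhdsWithin_le_nhds
  have hfq := h.map_eq_of_tendsto hx' hR hτ hret
  have hq : q ∈ boundaryOver f (orbit ψ z) :=
    h.mem_boundaryOver (by rw [hfq, flow_mem_orbit_iff]; exact hp.2)
  have hRint' : Tendsto R l (𝓝[(𝓡∂ 2).interior S] q) := tendsto_nhdsWithin_iff.2 ⟨hR, hRint⟩
  obtain ⟨b⟩ := exists_flowBox h.flow (h.field_ne_zero (f q))
  obtain ⟨ρ, hρ, hρlim⟩ := exists_tendsto_inv_smul_proj h.flow h.field_ne_zero
    h.surface.immersion hp.1 (h.trace.transverse p hp)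
  obtain ⟨ρ', hρ', hρlim'⟩ := exists_tendsto_inv_smul_proj h.flow h.field_ne_zero
    h.surface.immersion hq.1 (h.trace.transverse q hq)
  have h1 := (hρlim t (f q) hfq b).comp hx
  have h2 := (hρlim' 0 (f q) (ψ.map_zero_apply _).symm b).comp hRint'
  have hψt : Tendsto (fun n => (τ n - t, ψ t (f (x n)))) l (𝓝 (0, f q)) := by
    refine Tendsto.prodMk_nhds (by simpa using! hτ.sub_const t) ?_
    rw [hfq]
    exact ((h.flow.contMDiffAt t (f p)).continuousAt.tendsto).comp
      ((h.continuous.tendsto p).comp hx')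
  have heq : ∀ᶠ n in l, b.proj (ψ t (f (x n))) = b.proj (ψ 0 (f (R n))) := by
    filter_upwards [hψt.eventually b.eventually_flow, hret] with n hn hn'
    rw [← hn.1, ← ψ.map_add, sub_add_cancel, hn', ψ.map_zero_apply]
  have h2' : Tendsto (fun n => (ρ' (R n))⁻¹ • b.proj (ψ t (f (x n)))) l
      (𝓝 (derivFrom b.proj (f q) (flowDeriv ψ 0 (f q) (inwardVec f q)))) := by
    refine h2.congr' ?_
    filter_upwards [heq] with n hn
    rw [hn]; rfl
  obtain ⟨μ, hμ, hμeq⟩ := eq_smul_of_tendsto_inv_smul (hx.eventually hρ) (hRint'.eventually hρ')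
    h1 h2' (h.derivFrom_inwardVec_ne_zero hp t hfq b)
    (h.derivFrom_inwardVec_ne_zero hq 0 (ψ.map_zero_apply _).symm b)
  rw [IsFlowOf.flowDeriv_zero] at hμeq
  have hker : derivFrom b.proj (f q) (flowDeriv ψ t (f p) (inwardVec f p) -
      μ • inwardVec f q) = 0 := by rw [map_sub, map_smul, hμeq, sub_self]
  obtain ⟨a, ha⟩ := b.ker _ hker
  have hrel : InwardRel X ψ f p t q := ⟨hfq, μ, hμ, a, by rw [← ha]; abel⟩
  refine ⟨?_, hq, hrel⟩
  refine lt_of_le_of_ne (ge_of_tendsto hτ (hτ0.mono fun n hn => hn.le)) ?_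
  rintro rfl
  -- At t = 0 uniqueness forces q = p, and short returns are excluded by the polar picture.
  have hself : InwardRel X ψ f p 0 p := by
    refine ⟨(ψ.map_zero_apply _).symm, 1, one_pos, 0, ?_⟩
    rw [IsFlowOf.flowDeriv_zero, one_smul, zero_smul, add_zero]
  obtain rfl := h.inwardRel_unique hq hp hrel hself
  exact b.not_tendsto_zero h.continuous.continuousAt
    (exists_injOn_proj_boundary.{_, _, 0} h.flow h.surface.immersion hq.1 (h.trace.transverse q hq) b).1
    hx hR hRint hτ0 hret hτ

lemma eventually_return_interior (h : RotatingSection X ψ f z T) {t : ℝ}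
    (hq : q ∈ (𝓡∂ 2).interior S) (hpq : f q = ψ t (f p)) {ε : ℝ} (hε : 0 < ε) :
    ∀ᶠ x in 𝓝 p, ∃ s, |s - t| < ε ∧ ψ s (f x) ∈ range f := by
  obtain ⟨b⟩ := exists_flowBox h.flow (h.field_ne_zero (f q))
  obtain ⟨-, j, hj, hjproj, -⟩ := exists_section_proj h.surface.immersion hq
    (h.surface.transverse q hq) b
  have hy : Tendsto (fun x => ψ t (f x)) (𝓝 p) (𝓝 (f q)) := by
    rw [hpq]
    exact ((h.flow.contMDiffAt t (f p)).continuousAt.tendsto).comp (h.continuous.tendsto p)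
  have hP := b.tendsto_proj.comp hy
  filter_upwards [b.eventually_exists_mem_range h.continuous.continuousAt hy (fun W hW => by
    filter_upwards [hP.eventually hjproj, hP.eventually (hj.eventually hW)] with x hx hx'
    exact ⟨_, hx', hx⟩) hε] with x ⟨s, hs, hsx⟩
  exact ⟨s + t, by simpa using hs, by rwa [ψ.map_add]⟩

/-- The transported points approach the orbit along the ray at `q`, and the projected surface near
`q` contains such points. -/
lemma eventually_return_boundary (h : RotatingSection X ψ f z T) {t : ℝ}
    (hp : p ∈ boundaryOver f (orbit ψ z)) (hq : q ∈ boundaryOver f (orbit ψ z))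
    (hpq : InwardRel X ψ f p t q) {ε : ℝ} (hε : 0 < ε) :
    ∀ᶠ x in 𝓝[(𝓡∂ 2).interior S] p, ∃ s, |s - t| < ε ∧ ψ s (f x) ∈ range f := by
  obtain ⟨hfq, μ, hμ, a, hμa⟩ := hpq
  obtain ⟨b⟩ := exists_flowBox h.flow (h.field_ne_zero (f q))
  obtain ⟨ρ, hρ, hρlim⟩ := exists_tendsto_inv_smul_proj h.flow h.field_ne_zero
    h.surface.immersion hp.1 (h.trace.transverse p hp)
  have hlim := hρlim t (f q) hfq b
  rw [hμa, map_add, map_smul, map_smul, b.derivFrom_proj_field h.flow, smul_zero, add_zero] at hlim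
  have hy : Tendsto (fun x => ψ t (f x)) (𝓝[(𝓡∂ 2).interior S] p) (𝓝 (f q)) := by
    rw [hfq]
    exact (((h.flow.contMDiffAt t (f p)).continuousAt.tendsto).comp
      (h.continuous.tendsto p)).mono_left nhdsWithin_le_nhds
  have hP := b.tendsto_proj.comp hy
  filter_upwards [b.eventually_exists_mem_range h.continuous.continuousAt hy (fun W hW =>
    (exists_injOn_proj_boundary h.flow h.surface.immersion hq.1
      (h.trace.transverse q hq) b).2 W hW _ _ ρ μ hμ hP hρ hlim) hε] with x ⟨s, hs, hsx⟩
  exact ⟨s + t, by simpa using hs, by rwa [ψ.map_add]⟩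

end RotatingSection

end RotatingSection

end ReebSection

namespace ReebSection

open Set Filter

/-! ### Existence of first returns, and the Floquet obstruction. -/

namespace RotatingSection

variable {N : Type*} [TopologicalSpace N] [ChartedSpace E3 N] [IsManifold (𝓡 3) ∞ N]
variable {S : Type*} [TopologicalSpace S] [ChartedSpace (EuclideanHalfSpace 2) S]
variable [IsManifold (𝓡∂ 2) ∞ S]
variable {X : VField N} {ψ : Flow ℝ N} {f : S → N} {z : N} {T : ℝ} {p q : S}

/-- Near the boundary circles over the orbit, returns to the surface are bounded in time, and
those of the interior points are interior. -/
lemma exists_nhds [T2Space N] [T2Space S] (h : RotatingSection X ψ f z T) :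
    ∃ (U : Set S) (ℓ : ℝ), IsOpen U ∧ boundaryOver f (orbit ψ z) ⊆ U ∧
      (∀ p ∈ U, p ∉ (𝓡∂ 2).interior S → p ∈ boundaryOver f (orbit ψ z)) ∧
      (∀ p ∈ U ∩ (𝓡∂ 2).interior S, ∀ t q, f q = ψ t (f p) → q ∈ (𝓡∂ 2).interior S) ∧
      ∀ p ∈ U, ∃ t ∈ Ioo 0 ℓ, ψ t (f p) ∈ range f := by
  obtain ⟨ℓ, -, U, hU, hBU, hret⟩ := h.rotating.returns
  obtain ⟨Z, hZ, hmaps, -⟩ := h.surface.boundary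
  -- The other boundary orbits form a closed invariant set disjoint from Γ; off it, interior points
  -- never flow into the boundary.
  set K : Set N := ⋃ z' ∈ {z' | z' ∈ Z ∧ orbit ψ z' ≠ orbit ψ z}, orbit ψ z' with hK
  have hKc : IsClosed K := by
    refine Set.Finite.isClosed_biUnion (Z.finite_toSet.subset fun z' hz' => hz'.1) ?_
    rintro z' ⟨hz', -⟩
    obtain ⟨T', hT'⟩ := hZ z' hz'
    exact (hT'.isCompact_orbit
      (h.flow.continuous_uncurry.comp (Continuous.prodMk_left z'))).isClosed
  have hbd : ∀ q ∈ (𝓡∂ 2).boundary S, f q ∈ K ∪ orbit ψ z := by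
    intro q hq
    obtain ⟨z', hz', hqz⟩ := mem_iUnion₂.1 (hmaps hq)
    by_cases heq : orbit ψ z' = orbit ψ z
    · exact Or.inr (heq ▸ hqz)
    · exact Or.inl (mem_biUnion (show z' ∈ {z' | z' ∈ Z ∧ orbit ψ z' ≠ orbit ψ z} from ⟨hz', heq⟩) hqz)
  have hKflow : ∀ {y t}, ψ t y ∈ K → y ∈ K := by
    intro y t hy
    obtain ⟨z', hz', hyz⟩ := mem_iUnion₂.1 hy
    exact mem_biUnion hz' (flow_mem_orbit_iff.1 hyz)
  refine ⟨U ∩ f ⁻¹' Kᶜ, ℓ, hU.inter (hKc.isOpen_compl.preimage h.continuous), ?_, ?_, ?_, ?_⟩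
  · intro p hp
    refine ⟨hBU hp, fun hpK => ?_⟩
    obtain ⟨z', ⟨-, hne⟩, hpz⟩ := mem_iUnion₂.1 hpK
    exact hne ((orbit_eq_of_mem hpz).symm.trans (orbit_eq_of_mem hp.2))
  · rintro p ⟨-, hpK⟩ hp
    rw [← ModelWithCorners.compl_boundary, notMem_compl_iff] at hp
    exact ⟨hp, (hbd p hp).resolve_left hpK⟩
  · rintro p ⟨⟨-, hpK⟩, hp⟩ t q hq
    rw [← ModelWithCorners.compl_boundary]
    intro hqb
    rcases hbd q hqb with h1 | h1
    · rw [hq] at h1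
      exact hpK (hKflow h1)
    · rw [hq, flow_mem_orbit_iff] at h1
      have h2 := (h.mem_boundaryOver h1).1
      rw [← ModelWithCorners.compl_boundary] at hp
      exact hp h2
  · rintro p ⟨hp, -⟩
    exact (hret p hp).1

/-- Compactness of S makes the infimum of the return times an arrival time; it is positive since
arrivals are interior. -/
lemma exists_firstReturn [T2Space N] [CompactSpace S] (h : RotatingSection X ψ f z T)
    (hp : p ∈ (𝓡∂ 2).interior S) (hint : ∀ t q, f q = ψ t (f p) → q ∈ (𝓡∂ 2).interior S)
    (hret : ∃ t, 0 < t ∧ ψ t (f p) ∈ range f) :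
    ∃ q τ, IsLeast {t : ℝ | 0 < t ∧ ψ t (f p) ∈ range f} τ ∧ ψ τ (f p) = f q := by
  set K := {t : ℝ | 0 < t ∧ ψ t (f p) ∈ range f} with hK
  have hbdd : BddBelow K := ⟨0, fun t ht => ht.1.le⟩
  obtain ⟨u, -, hu, huK⟩ := exists_seq_tendsto_sInf (S := K) hret hbdd
  choose R hR using fun n => (huK n).2
  obtain ⟨q, -, hq⟩ := isCompact_univ.ultrafilter_le_nhds ((hyperfilter ℕ).map R) (by simp)
  have hq' : Tendsto R (hyperfilter ℕ) (𝓝 q) := hq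
  have hu' : Tendsto u (hyperfilter ℕ : Filter ℕ) (𝓝 (sInf K)) :=
    hu.mono_left Nat.hyperfilter_le_atTop
  have hret' : ∀ᶠ n in (hyperfilter ℕ : Filter ℕ), ψ (u n) (f p) = f (R n) :=
    Eventually.of_forall fun n => (hR n).symm
  have hfq := h.map_eq_of_tendsto (x := fun _ => p) tendsto_const_nhds hq' hu' hret'
  have hpos := h.pos_of_tendsto_interior hp (hint _ _ hfq) (x := fun _ => p) tendsto_const_nhds hq'
    hu' (Eventually.of_forall fun n => (huK n).1) hret'
  exact ⟨q, sInf K, ⟨⟨hpos, ⟨q, hfq⟩⟩, fun t ht => csInf_le hbdd ht⟩, hfq.symm⟩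

/-- A boundary point is not related to itself in positive time if the orbit is elliptic with
irrational rotation number. -/
lemma not_inwardRel_self {lam : OneForm N} (h : RotatingSection X ψ f z T)
    (hlam : SmoothOneForm lam) (hX : IsReebField lam X) (hell : IsElliptic lam ψ z T)
    (hunity : ∀ σ : ℂ, IsFloquetMultiplier lam ψ z T σ → ∀ n : ℕ, 0 < n → σ ^ n ≠ 1)
    (hp : p ∈ boundaryOver f (orbit ψ z)) {t : ℝ} (ht : 0 < t) : ¬ InwardRel X ψ f p t p := by
  rintro ⟨hfp, μ, hμ, a, hμa⟩
  obtain ⟨s, hs⟩ := hp.2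
  simp only at hs
  have hsp : ψ (-s) (f p) = z := by rw [← hs, ← ψ.map_add, neg_add_cancel, ψ.map_zero_apply]
  have htz : ψ t z = z := by
    rw [← hsp, ← ψ.map_add, add_comm, ψ.map_add, ← hfp]
  obtain ⟨k, hk, htk⟩ := h.period.exists_nat_mul_eq ht htz
  -- The ray is moved to the base point `z`, where the Floquet multipliers are defined.
  set e := flowDeriv ψ (-s) (f p) (inwardVec f p) with he
  have hpow : ∀ n : ℕ, ψ (n * T) z = z := fun n => by
    have := h.period.periodic.nat_mul n 0
    simpa using this
  have hiter : ∀ (n : ℕ) (v : E3),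
      ((flowDeriv ψ T z : E3 →ₗ[ℝ] E3) ^ n) v = flowDeriv ψ (n * T) z v := by
    intro n
    induction n with
    | zero => intro v; simp [IsFlowOf.flowDeriv_zero]
    | succ n ih =>
      intro v
      rw [pow_succ, Module.End.mul_apply, ih, Nat.cast_succ, add_mul, one_mul, h.flow.flowDeriv_add,
        h.period.1.2]
      rfl
  have hek : flowDeriv ψ t z e = μ • e + a • fieldVec X z := by
    have h1 := h.flow.flowDeriv_add t (-s) (f p) (inwardVec f p)
    rw [hsp] at h1
    rw [he, ← h1, add_comm, h.flow.flowDeriv_add, ← hfp, hμa, map_add, map_smul, map_smul,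
      h.flow.flowDeriv_field, hsp]
  have hA : ((flowDeriv ψ T z : E3 →ₗ[ℝ] E3) ^ k) e = μ • e + a • fieldVec X z := by
    rw [hiter, ← htk, hek]
  have hne : ∀ c : ℝ, e ≠ c • fieldVec X z := by
    intro c hc
    obtain ⟨b⟩ := exists_flowBox h.flow (h.field_ne_zero z)
    refine h.derivFrom_inwardVec_ne_zero hp (-s) hsp.symm b ?_
    rw [← he, hc, map_smul, b.derivFrom_proj_field h.flow, smul_zero]
  obtain ⟨σ, u, v, hu, hv, huv, hAu, hAv, hσ⟩ := exists_complex_eigenvalue_on_ker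
    (A := (flowDeriv ψ T z : E3 →ₗ[ℝ] E3)) (φ := (formVec lam z : E3 →ₗ[ℝ] ℝ))
    (x := fieldVec X z) (fun v => by
      have h1 := h.flow.formVec_flowDeriv hlam hX T z v
      rwa [h.period.1.2] at h1) (by
      have h1 := h.flow.flowDeriv_field T z
      rwa [h.period.1.2] at h1) (hX.apply_self z) hk hA hne
  have hfm : IsFloquetMultiplier lam ψ z T σ := ⟨u, v, hu, hv, huv, hAu, hAv⟩
  refine hunity σ hfm k hk ?_
  -- The eigenvalue μ is real and positive, so modulus 1 means μ = 1; positivity comes from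
  -- comparing rays, not lines.
  have h1 : ‖σ ^ k‖ = 1 := by rw [norm_pow, hell σ hfm, one_pow]
  rw [hσ, Complex.norm_real, Real.norm_of_nonneg hμ.le] at h1
  rw [hσ, h1, Complex.ofReal_one]

end RotatingSection

end ReebSection

namespace ReebSection

open Set Filter

/-! ### The extension of the return map and its uniqueness. -/

namespace RotatingSection

variable {N : Type*} [TopologicalSpace N] [T2Space N] [ChartedSpace E3 N] [IsManifold (𝓡 3) ∞ N]
variable {S : Type*} [TopologicalSpace S] [T2Space S] [CompactSpace S]
variable [ChartedSpace (EuclideanHalfSpace 2) S] [IsManifold (𝓡∂ 2) ∞ S]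
variable {X : VField N} {ψ : Flow ℝ N} {f : S → N} {z : N} {T : ℝ}

omit [T2Space N] [IsManifold (𝓡 3) ∞ N] [T2Space S] [CompactSpace S] in
lemma mem_closure_interior (h : RotatingSection X ψ f z T) (p : S) :
    p ∈ closure ((𝓡∂ 2).interior S) := by
  obtain ⟨C⟩ := exists_surfaceChart h.surface.immersion p
  exact C.mem_closure_interior

/-- The first return map of a rotating section has a limit at the boundary. -/
theorem exists_returnExtension (h : RotatingSection X ψ f z T) :
    ∃ F : S → S, IsReturnExtension ψ f (orbit ψ z) F ∧
      ∀ p ∈ boundaryOver f (orbit ψ z), F p ∈ boundaryOver f (orbit ψ z) ∧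
        ∃ t : ℝ, 0 < t ∧ InwardRel X ψ f p t (F p) := by
  obtain ⟨U, ℓ, hU, hBU, hUB, hUint, hUret⟩ := h.exists_nhds
  obtain ⟨p₀, -⟩ := h.rotating.subset_boundary (show z ∈ orbit ψ z from ⟨0, ψ.map_zero_apply z⟩)
  have : Nonempty S := ⟨p₀⟩
  have hex : ∀ p, p ∈ U ∩ (𝓡∂ 2).interior S → ∃ q τ,
      IsLeast {t : ℝ | 0 < t ∧ ψ t (f p) ∈ range f} τ ∧ ψ τ (f p) = f q := fun p hp => by
    obtain ⟨t, ht, htp⟩ := hUret p hp.1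
    exact h.exists_firstReturn hp.2 (hUint p hp) ⟨t, ht.1, htp⟩
  choose! R τ hτ hR using hex
  set I := (𝓡∂ 2).interior S with hI
  have hRI : ∀ p ∈ U ∩ I, R p ∈ I := fun p hp => hUint p hp _ _ (hR p hp).symm
  have hLne : ∀ p, (𝓝[I] p).NeBot := fun p =>
    mem_closure_iff_nhdsWithin_neBot.1 (h.mem_closure_interior p)
  have hev : ∀ p ∈ U, ∀ᶠ x in 𝓝[I] p, x ∈ U ∩ I := fun p hp =>
    inter_mem (nhdsWithin_le_nhds (hU.mem_nhds hp)) self_mem_nhdsWithin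
  have hevτ : ∀ p ∈ U, (∀ᶠ x in 𝓝[I] p,
      IsLeast {t | 0 < t ∧ t ∈ {t | ψ t (f x) ∈ range f}} (τ x)) ∧ ∀ᶠ x in 𝓝[I] p, τ x ≤ ℓ := by
    refine fun p hp => ⟨(hev p hp).mono fun x hx => hτ x hx, (hev p hp).mono fun x hx => ?_⟩
    obtain ⟨t, ht, htx⟩ := hUret x hx.1
    exact ((hτ x hx).2 ⟨ht.1, htx⟩).trans ht.2.le
  -- the limits at the interior points
  have hlim_int : ∀ p ∈ U ∩ I, Tendsto R (𝓝[I] p) (𝓝 (R p)) := by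
    intro p hp
    obtain ⟨t, q, -, -, hq⟩ := exists_tendsto_return (H := fun t q => f q = ψ t (f p))
      (hevτ p hp.1).1 (hevτ p hp.1).2 (fun 𝒰 h𝒰 t q ht hq => by
        have hx : Tendsto id (𝒰 : Filter S) (𝓝 p) := h𝒰.trans nhdsWithin_le_nhds
        have hret : ∀ᶠ x in (𝒰 : Filter S), ψ (τ x) (f x) = f (R x) :=
          h𝒰 ((hev p hp.1).mono fun x hx => hR x hx)
        have hfq := h.map_eq_of_tendsto hx hq ht hret
        exact ⟨h.pos_of_tendsto_interior hp.2 (hUint p hp _ _ hfq) hx hq ht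
          (h𝒰 ((hev p hp.1).mono fun x hx => (hτ x hx).1.1)) hret, hfq⟩)
      (fun t q _ hq ε hε => nhdsWithin_le_nhds
        (h.eventually_return_interior (hUint p hp _ _ hq) hq hε))
      (fun t q q' hq hq' => congrArg Subtype.val (h.surface.embedding.injective
        (a₁ := ⟨q, hUint p hp _ _ hq⟩) (a₂ := ⟨q', hUint p hp _ _ hq'⟩) (hq.trans hq'.symm)))
    -- The point `p` itself belongs to the interior, so the limit there is the value R p.
    have h1 : Tendsto R (pure p) (𝓝 q) := hq.mono_left (pure_le_nhdsWithin hp.2)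
    have h2 : R p = q := tendsto_nhds_unique (tendsto_pure_nhds R p) h1
    rwa [h2]
  -- the limits at the boundary points
  have hlim_bd : ∀ p ∈ boundaryOver f (orbit ψ z), ∃ t q, 0 < t ∧
      (q ∈ boundaryOver f (orbit ψ z) ∧ InwardRel X ψ f p t q) ∧ Tendsto R (𝓝[I] p) (𝓝 q) := by
    intro p hp
    have hpU := hBU hp
    refine exists_tendsto_return (hevτ p hpU).1 (hevτ p hpU).2 (fun 𝒰 h𝒰 t q ht hq => ?_)
      (fun t q _ hq ε hε => h.eventually_return_boundary hp hq.1 hq.2 hε)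
      (fun t q q' hq hq' => h.inwardRel_unique hq.1 hq'.1 hq.2 hq'.2)
    exact h.inwardRel_of_tendsto (x := id) hp h𝒰 hq
      (h𝒰 ((hev p hpU).mono fun x hx => hRI x hx)) ht
      (h𝒰 ((hev p hpU).mono fun x hx => (hτ x hx).1.1))
      (h𝒰 ((hev p hpU).mono fun x hx => hR x hx))
  refine ⟨extendFrom I R, ⟨U, hU, hBU, ?_, ?_⟩, ?_⟩
  · refine continuousOn_extendFrom (fun p _ => h.mem_closure_interior p) fun p hp => ?_
    by_cases hpI : p ∈ I
    · exact ⟨_, hlim_int p ⟨hp, hpI⟩⟩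
    · obtain ⟨t, q, -, -, hq⟩ := hlim_bd p (hUB p hp hpI)
      exact ⟨q, hq⟩
  · intro p hp
    rw [extendFrom_eq (h.mem_closure_interior p) (hlim_int p hp)]
    exact ⟨τ p, hτ p hp, hR p hp⟩
  · intro p hp
    obtain ⟨t, q, ht, hq, hlim⟩ := hlim_bd p hp
    rw [extendFrom_eq (h.mem_closure_interior p) hlim]
    exact ⟨hq.1, t, ht, hq.2⟩

omit [CompactSpace S] in
/-- The continuous extension of the first return map to the boundary is unique. -/
theorem eqOn_returnExtension (h : RotatingSection X ψ f z T) {F G : S → S}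
    (hF : IsReturnExtension ψ f (orbit ψ z) F) (hG : IsReturnExtension ψ f (orbit ψ z) G) :
    EqOn G F (boundaryOver f (orbit ψ z)) := by
  obtain ⟨U, ℓ, hU, hBU, -, hUint, -⟩ := h.exists_nhds
  obtain ⟨V, hV, hBV, hFc, hFr⟩ := hF
  obtain ⟨W, hW, hBW, hGc, hGr⟩ := hG
  intro p hp
  have : (𝓝[(𝓡∂ 2).interior S] p).NeBot :=
    mem_closure_iff_nhdsWithin_neBot.1 (h.mem_closure_interior p)
  have h1 : Tendsto F (𝓝[(𝓡∂ 2).interior S] p) (𝓝 (F p)) :=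
    (hFc.continuousAt (hV.mem_nhds (hBV hp))).tendsto.mono_left nhdsWithin_le_nhds
  have h2 : Tendsto G (𝓝[(𝓡∂ 2).interior S] p) (𝓝 (G p)) :=
    (hGc.continuousAt (hW.mem_nhds (hBW hp))).tendsto.mono_left nhdsWithin_le_nhds
  refine tendsto_nhds_unique h2 (h1.congr' ?_)
  filter_upwards [self_mem_nhdsWithin, nhdsWithin_le_nhds (hU.mem_nhds (hBU hp)),
    nhdsWithin_le_nhds (hV.mem_nhds (hBV hp)), nhdsWithin_le_nhds (hW.mem_nhds (hBW hp))]
    with x hx hxU hxV hxW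
  obtain ⟨τ, hτ, hFx⟩ := hFr x ⟨hxV, hx⟩
  obtain ⟨τ', hτ', hGx⟩ := hGr x ⟨hxW, hx⟩
  -- Both maps use the same least time, so they can differ only by a double point of the embedded
  -- interior.
  rw [hτ'.unique hτ] at hGx
  exact congrArg Subtype.val (h.surface.embedding.injective
    (a₁ := ⟨F x, hUint x ⟨hxU, hx⟩ _ _ hFx.symm⟩) (a₂ := ⟨G x, hUint x ⟨hxU, hx⟩ _ _ hGx.symm⟩)
    (hFx.symm.trans hGx))

end RotatingSection

/-- Composition adds times, so they stay positive; the exponent n + 1 excludes the trivial relation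
at time 0. -/
lemma exists_inwardRel_iterate {N : Type*} [TopologicalSpace N] [ChartedSpace E3 N]
    {S : Type*} [TopologicalSpace S] [ChartedSpace (EuclideanHalfSpace 2) S]
    {X : VField N} {ψ : Flow ℝ N} (hψ : IsFlowOf ψ X) {f : S → N} {F : S → S} {B : Set S}
    (hF : ∀ p ∈ B, F p ∈ B ∧ ∃ t : ℝ, 0 < t ∧ InwardRel X ψ f p t (F p)) {p : S} (hp : p ∈ B)
    (n : ℕ) : F^[n + 1] p ∈ B ∧ ∃ t : ℝ, 0 < t ∧ InwardRel X ψ f p t (F^[n + 1] p) := by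
  induction n with
  | zero => exact hF p hp
  | succ n ih =>
    obtain ⟨hB, t, ht, hrel⟩ := ih
    obtain ⟨hB', s, hs, hrel'⟩ := hF _ hB
    rw [Function.iterate_succ_apply']
    exact ⟨hB', s + t, add_pos hs ht, hrel.trans hψ hrel'⟩

end ReebSection

theorem mainTheorem10
    {N : Type*} [TopologicalSpace N] [T2Space N] [CompactSpace N]
    [ChartedSpace ReebSection.E3 N] [IsManifold (𝓡 3) ∞ N]
    (lam : ReebSection.OneForm N) (hlam : ReebSection.IsContactForm lam)
    (X : ReebSection.VField N) (hX : ReebSection.IsReebField lam X)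
    (ψ : Flow ℝ N) (hψ : ReebSection.IsFlowOf ψ X)
    {S : Type*} [TopologicalSpace S] [T2Space S] [CompactSpace S]
    [ChartedSpace (EuclideanHalfSpace 2) S] [IsManifold (𝓡∂ 2) ∞ S]
    (f : S → N) (hf : ReebSection.IsSurfaceOfSection X ψ f)
    (z : N) (T : ℝ) (hT : ReebSection.HasPeriod ψ z T)
    (hrot : ReebSection.IsRotating ψ f (ReebSection.orbit ψ z))
    (htrace : ReebSection.HasTransverseTrace X ψ f (ReebSection.orbit ψ z))
    (hell : ReebSection.IsElliptic lam ψ z T)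
    (hunity : ∀ σ : ℂ, ReebSection.IsFloquetMultiplier lam ψ z T σ →
      ∀ n : ℕ, 0 < n → σ ^ n ≠ 1) :
    ∃ F : S → S,
      ReebSection.IsReturnExtension ψ f (ReebSection.orbit ψ z) F ∧
      (∀ G : S → S, ReebSection.IsReturnExtension ψ f (ReebSection.orbit ψ z) G →
        Set.EqOn G F (ReebSection.boundaryOver f (ReebSection.orbit ψ z))) ∧
      Set.MapsTo F (ReebSection.boundaryOver f (ReebSection.orbit ψ z))
        (ReebSection.boundaryOver f (ReebSection.orbit ψ z)) ∧
      ∀ p ∈ ReebSection.boundaryOver f (ReebSection.orbit ψ z),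
        p ∉ Function.periodicPts F := by
  have h : ReebSection.RotatingSection X ψ f z T :=
    { flow := hψ
      field_ne_zero := fun x hx => by
        have h1 : ReebSection.formVec lam x (ReebSection.fieldVec X x) = 1 := hX.apply_self x
        rw [hx, map_zero] at h1
        exact zero_ne_one h1
      surface := hf
      period := hT
      rotating := hrot
      trace := htrace }
  obtain ⟨F, hF, hrel⟩ := h.exists_returnExtension
  refine ⟨F, hF, fun G hG => h.eqOn_returnExtension hF hG, fun p hp => (hrel p hp).1, ?_⟩
  rintro p hp ⟨n, hn, hper⟩
  obtain ⟨m, rfl⟩ := Nat.exists_eq_succ_of_ne_zero hn.ne'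
  obtain ⟨-, t, ht, hrel'⟩ := ReebSection.exists_inwardRel_iterate hψ hrel hp m
  rw [show F^[m + 1] p = p from hper] at hrel'
  exact h.not_inwardRel_self hlam.smooth hX hell hunity hp ht hrel'
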